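/- Conventions. Graphs are finite, simple and without isolated vertices (the empty graph, denoted $1$, is allowed). A partially labeled graph has some of its vertices labeled by distinct natural numbers. The product $AB$ of partially labeled graphs glues $A$ and $B$ along vertices with equal labels and keeps one copy of every doubled edge; for unlabeled graphs it is the disjoint union. $[[\cdot]]$ removes all labels. Both operations are extended (bi)linearly to formal finite real linear combinations, called graph combinations. An unlabeled graph $H$ is a *trivial square* if, whenever $H=[[F^2]]$ for a partially labeled graph $F$, $F$ is a fully labeled copy of $H$. For $d\ge 1$, a *$d$-sos graph combination* is a finite sum $\sum_j [[a_j^2]]$ where every graph occurring in the combinations $a_j$ has at most $d$ edges. Let $\mathcal V_d$ be the set of connected unlabeled graphs of the form $[[AB]]$, where $A,B$ have at most $d$ edges. A combination of unlabeled graphs all of whose connected components lie in $\mathcal V_d$ is evaluated at ${\bf v}\in\mathbb R^{\mathcal V_d}$ by replacing each graph by the product of the coordinates of its connected components. The *$d$-sos-profile* $\mathcal S_d$ is the set of ${\bf v}\in\mathbb R_{\ge 0}^{\mathcal V_d}$ at which every $d$-sos graph combination is nonnegative. A combination $a$ of unlabeled graphs is *sos-testable* if there is a $d\ge 1$ such that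 the connected components of all graphs in $a$ lie in $\mathcal V_d$ and $a\ge 0$ on $\mathcal S_d$. Theorem. Let $\overline H$ and $\underline H$ be two non-isomorphic unlabeled graphs with the same number of edges. Suppose that $\overline H$ is a trivial square and that, for some integer $p\ge 1$, every vertex of $\overline H$ has degree $p$ or $p+1$ and every vertex of $\underline H$ has degree at most $p+1$. Then for every integer $k\ge 2|E(\underline H)|+1$, the graph combination $\overline H^{k}-\underline H^{k+1}$ is not sos-testable. In particular, writing $P_3$ for the path with three edges and $K_2$ for the edge, $P_3^k-K_2^{3(k+1)}$ is not sos-testable for every $k\ge 7$. -/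

import Mathlib

open SimpleGraph

namespace GraphDensity

/-! ### Unlabeled graphs -/

/-- No vertex of the graph is isolated. -/
def NoIsolated {V : Type*} (G : SimpleGraph V) : Prop := ∀ v, ∃ w, G.Adj v w

/-- A finite simple graph without isolated vertices, on the vertex set `{0, …, n - 1}`
(the graph with no vertices is allowed). -/
structure FinGraph where
  n : ℕ
  graph : SimpleGraph (Fin n)
  noIsolated : NoIsolated graph

namespace FinGraph

/-- The number of edges. -/
noncomputable def numEdges (G : FinGraph) : ℕ := G.graph.edgeSet.ncard

/-- The degree of a vertex. -/
noncomputable def deg (G : FinGraph) (v : Fin G.n) : ℕ := (G.graph.neighborSet v).ncard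

/-- Isomorphism of graphs. -/
def Isom (G H : FinGraph) : Prop := Nonempty (G.graph ≃g H.graph)

instance setoid : Setoid FinGraph where
  r := Isom
  iseqv :=
    { refl := fun _ => ⟨Iso.refl⟩
      symm := fun ⟨e⟩ => ⟨e.symm⟩
      trans := fun ⟨e⟩ ⟨f⟩ => ⟨e.trans f⟩ }

end FinGraph

/-- An unlabeled graph: an isomorphism class of finite simple graphs without isolated vertices. -/
def UGraph : Type := Quotient FinGraph.setoid

/-- The isomorphism class of a graph on `Fin n`. -/
def FinGraph.toUGraph (G : FinGraph) : UGraph := Quotient.mk FinGraph.setoid G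

theorem NoIsolated.of_iso {V W : Type*} {G : SimpleGraph V} {H : SimpleGraph W}
    (h : NoIsolated G) (e : G ≃g H) : NoIsolated H := by
  intro w
  obtain ⟨u, hu⟩ := h (e.symm w)
  refine ⟨e u, ?_⟩
  have := e.map_adj_iff.2 hu
  simpa using this

theorem NoIsolated.sum {V W : Type*} {G : SimpleGraph V} {H : SimpleGraph W}
    (hG : NoIsolated G) (hH : NoIsolated H) : NoIsolated (G ⊕g H) := by
  rintro (v | w)
  · obtain ⟨u, hu⟩ := hG v
    exact ⟨Sum.inl u, hu⟩
  · obtain ⟨u, hu⟩ := hH w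
    exact ⟨Sum.inr u, hu⟩

theorem NoIsolated.component {V : Type*} {G : SimpleGraph V} (h : NoIsolated G)
    (c : G.ConnectedComponent) : NoIsolated c.toSimpleGraph := by
  rintro ⟨v, hv⟩
  obtain ⟨w, hw⟩ := h v
  have hwc : w ∈ c := by
    have h1 : G.connectedComponentMk v = c := hv
    have h2 : G.connectedComponentMk w = c := by
      rw [← h1]
      exact (ConnectedComponent.sound hw.reachable).symm
    exact h2
  exact ⟨⟨w, hwc⟩, (ConnectedComponent.toSimpleGraph_adj c hv hwc).2 hw⟩

/-- A copy of a finite graph on a vertex set `{0, …, n - 1}`. -/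
noncomputable def FinGraph.ofGraph {V : Type*} [Finite V] (G : SimpleGraph V)
    (h : NoIsolated G) : FinGraph where
  n := Nat.card V
  graph := G.map (Finite.equivFin V)
  noIsolated := h.of_iso (Iso.map (Finite.equivFin V) G)

/-- The isomorphism class of a finite graph without isolated vertices, on any vertex type. -/
noncomputable def UGraph.mk {V : Type*} [Finite V] (G : SimpleGraph V) (h : NoIsolated G) :
    UGraph := (FinGraph.ofGraph G h).toUGraph

theorem UGraph.mk_eq_mk_iff {V W : Type*} [Finite V] [Finite W] {G : SimpleGraph V}
    {H : SimpleGraph W} (hG : NoIsolated G) (hH : NoIsolated H) :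
    UGraph.mk G hG = UGraph.mk H hH ↔ Nonempty (G ≃g H) := by
  have eG : G ≃g (FinGraph.ofGraph G hG).graph := Iso.map (Finite.equivFin V) G
  have eH : H ≃g (FinGraph.ofGraph H hH).graph := Iso.map (Finite.equivFin W) H
  constructor
  · intro h
    obtain ⟨e⟩ : FinGraph.Isom _ _ := Quotient.exact h
    exact ⟨eG.trans (e.trans eH.symm)⟩
  · rintro ⟨e⟩
    exact Quotient.sound ⟨eG.symm.trans (e.trans eH)⟩

theorem FinGraph.toUGraph_eq_mk (G : FinGraph) : G.toUGraph = UGraph.mk G.graph G.noIsolated :=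
  Quotient.sound ⟨Iso.map (Finite.equivFin (Fin G.n)) G.graph⟩

open Classical in
/-- The multiset of connected components of a graph. -/
noncomputable def FinGraph.components (G : FinGraph) : Multiset UGraph :=
  (Finset.univ : Finset G.graph.ConnectedComponent).val.map
    fun c => UGraph.mk c.toSimpleGraph (G.noIsolated.component c)

namespace UGraph

/-- The empty graph, with no vertices. -/
noncomputable instance : One UGraph := ⟨UGraph.mk (⊥ : SimpleGraph (Fin 0)) (fun v => v.elim0)⟩

/-- The product of unlabeled graphs is their disjoint union. -/
noncomputable instance : Mul UGraph :=
  ⟨Quotient.map₂ (fun G H : FinGraph => FinGraph.ofGraph (G.graph ⊕g H.graph)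
      (G.noIsolated.sum H.noIsolated)) (by
    rintro G G' ⟨e⟩ H H' ⟨f⟩
    exact Quotient.exact ((mk_eq_mk_iff _ _).2 ⟨Iso.sumCongr e f⟩))⟩

theorem mk_mul_mk {V W : Type*} [Finite V] [Finite W] {G : SimpleGraph V}
    {H : SimpleGraph W} (hG : NoIsolated G) (hH : NoIsolated H) :
    UGraph.mk G hG * UGraph.mk H hH = UGraph.mk (G ⊕g H) (hG.sum hH) :=
  (mk_eq_mk_iff _ _).2
    ⟨Iso.sumCongr (Iso.map (Finite.equivFin V) G).symm (Iso.map (Finite.equivFin W) H).symm⟩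

theorem exists_rep (x : UGraph) : ∃ G : FinGraph, x = UGraph.mk G.graph G.noIsolated := by
  obtain ⟨G, rfl⟩ := Quotient.exists_rep x
  exact ⟨G, G.toUGraph_eq_mk⟩

noncomputable instance : CommMonoid UGraph where
  mul_assoc x y z := by
    obtain ⟨G, rfl⟩ := x.exists_rep
    obtain ⟨H, rfl⟩ := y.exists_rep
    obtain ⟨K, rfl⟩ := z.exists_rep
    simp only [mk_mul_mk]
    exact (mk_eq_mk_iff _ _).2 ⟨Iso.sumAssoc⟩
  mul_comm x y := by
    obtain ⟨G, rfl⟩ := x.exists_rep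
    obtain ⟨H, rfl⟩ := y.exists_rep
    simp only [mk_mul_mk]
    exact (mk_eq_mk_iff _ _).2 ⟨Iso.sumComm⟩
  one_mul x := by
    obtain ⟨G, rfl⟩ := x.exists_rep
    refine (mk_mul_mk _ _).trans ((mk_eq_mk_iff _ _).2 ⟨⟨Equiv.emptySum (Fin 0) (Fin G.n), ?_⟩⟩)
    rintro (a | a) (b | b)
    · exact a.elim0
    · exact a.elim0
    · exact b.elim0
    · simp
  mul_one x := by
    obtain ⟨G, rfl⟩ := x.exists_rep
    refine (mk_mul_mk _ _).trans ((mk_eq_mk_iff _ _).2 ⟨⟨Equiv.sumEmpty (Fin G.n) (Fin 0), ?_⟩⟩)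
    rintro (a | a) (b | b)
    · simp
    · exact b.elim0
    · exact a.elim0
    · exact a.elim0

/-- The unlabeled graph is connected (in particular it has a vertex, so it is not the empty
graph). -/
def Connected (C : UGraph) : Prop := ∃ G : FinGraph, G.toUGraph = C ∧ G.graph.Connected

/-- The multiset of connected components of an unlabeled graph, i.e. the factors in its
factorization `G = C₁ ⋯ Cₘ` into connected unlabeled graphs. -/
noncomputable def components : UGraph → Multiset UGraph :=
  Quotient.lift FinGraph.components (by
    classical
    rintro G H ⟨e⟩
    unfold FinGraph.components
    have h : (Finset.univ : Finset H.graph.ConnectedComponent)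
        = Finset.univ.map e.connectedComponentEquiv.toEmbedding := by simp
    rw [h, Finset.map_val, Multiset.map_map]
    refine Multiset.map_congr rfl fun c _ => ?_
    refine (mk_eq_mk_iff _ _).2 ⟨⟨ConnectedComponent.isoEquivSupp e c, ?_⟩⟩
    rintro ⟨a, ha⟩ ⟨b, hb⟩
    exact e.map_adj_iff)

end UGraph

/-! ### Partially labeled graphs and the gluing product -/

/-- A partially labeled finite graph without isolated vertices. Its labeled vertices are
identified with their labels (a finite set of natural numbers, each used once), its unlabeled
vertices are numbered `0, …, unl - 1`. This is a representative: the numbering of the unlabeled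
vertices carries no information, and disappears under unlabeling. -/
structure PLGraph where
  labels : Finset ℕ
  unl : ℕ
  graph : SimpleGraph (labels ⊕ Fin unl)
  noIsolated : NoIsolated graph

namespace PLGraph

/-- The number of edges. -/
noncomputable def numEdges (A : PLGraph) : ℕ := A.graph.edgeSet.ncard

/-- The inclusion of the vertices of `A` in those of the glued graph `A * B`. -/
def inLeft (A B : PLGraph) :
    A.labels ⊕ Fin A.unl → ↥(A.labels ∪ B.labels) ⊕ Fin (A.unl + B.unl) :=
  Sum.map (fun l => ⟨l, Finset.mem_union_left _ l.2⟩) (Fin.castAdd B.unl)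

/-- The inclusion of the vertices of `B` in those of the glued graph `A * B`. -/
def inRight (A B : PLGraph) :
    B.labels ⊕ Fin B.unl → ↥(A.labels ∪ B.labels) ⊕ Fin (A.unl + B.unl) :=
  Sum.map (fun l => ⟨l, Finset.mem_union_right _ l.2⟩) (Fin.natAdd A.unl)

theorem inLeft_injective (A B : PLGraph) : Function.Injective (inLeft A B) := by
  refine Function.Injective.sumMap ?_ (Fin.castAdd_injective _ _)
  rintro ⟨a, ha⟩ ⟨b, hb⟩ h
  have h' : a = b := Subtype.mk.inj h
  subst h'
  rfl

theorem inRight_injective (A B : PLGraph) : Function.Injective (inRight A B) := by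
  refine Function.Injective.sumMap ?_ (Fin.natAdd_injective _ _)
  rintro ⟨a, ha⟩ ⟨b, hb⟩ h
  have h' : a = b := Subtype.mk.inj h
  subst h'
  rfl

/-- The gluing product: vertices with the same label are identified, unlabeled vertices are kept
apart, and of two parallel edges only one is kept. -/
instance : Mul PLGraph where
  mul A B :=
    { labels := A.labels ∪ B.labels
      unl := A.unl + B.unl
      graph := A.graph.map (inLeft A B) ⊔ B.graph.map (inRight A B)
      noIsolated := by
        have hL : ∀ x, ∃ w, (A.graph.map (inLeft A B) ⊔ B.graph.map (inRight A B)).Adj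
            (inLeft A B x) w := fun x => by
          obtain ⟨y, hy⟩ := A.noIsolated x
          exact ⟨inLeft A B y, Or.inl ((map_adj' _ _ _ _).2
            ⟨fun h => hy.ne (inLeft_injective A B h), x, y, hy, rfl, rfl⟩)⟩
        have hR : ∀ x, ∃ w, (A.graph.map (inLeft A B) ⊔ B.graph.map (inRight A B)).Adj
            (inRight A B x) w := fun x => by
          obtain ⟨y, hy⟩ := B.noIsolated x
          exact ⟨inRight A B y, Or.inr ((map_adj' _ _ _ _).2
            ⟨fun h => hy.ne (inRight_injective A B h), x, y, hy, rfl, rfl⟩)⟩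
        rintro (⟨l, hl⟩ | i)
        · rcases Finset.mem_union.1 hl with h | h
          · exact hL (Sum.inl ⟨l, h⟩)
          · exact hR (Sum.inl ⟨l, h⟩)
        · refine Fin.addCases (fun j => ?_) (fun j => ?_) i
          · exact hL (Sum.inr j)
          · exact hR (Sum.inr j) }

/-- Unlabeling `[[A]]`: the labels are removed. -/
noncomputable def unlabel (A : PLGraph) : UGraph := UGraph.mk A.graph A.noIsolated

end PLGraph

/-- `H` is a trivial square: whenever `H = [[F²]]`, then `F` is a fully labeled copy of `H`. -/
def IsTrivialSquare (H : UGraph) : Prop :=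
  ∀ F : PLGraph, (F * F).unlabel = H → F.unl = 0 ∧ F.unlabel = H

/-! ### Graph combinations and sos-profiles -/

/-- Combinations of partially labeled graphs: formal finite real linear combinations, with the
bilinear extension of the gluing product. -/
abbrev PLComb : Type := MonoidAlgebra ℝ PLGraph

/-- Combinations of unlabeled graphs: formal finite real linear combinations, with the bilinear
extension of the disjoint union. -/
abbrev GraphComb : Type := MonoidAlgebra ℝ UGraph

/-- The linear extension of unlabeling to graph combinations. -/
noncomputable def PLComb.unlabel (a : PLComb) : GraphComb :=
  MonoidAlgebra.mapDomain PLGraph.unlabel a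

/-- The unlabeled graph `G` as a graph combination. -/
noncomputable def UGraph.toComb (G : UGraph) : GraphComb := MonoidAlgebra.of ℝ UGraph G

/-- A `d`-sos graph combination: a finite sum `∑ [[aⱼ²]]`, where each constituent graph of each
`aⱼ` has at most `d` edges. -/
def IsSOS (d : ℕ) (a : GraphComb) : Prop :=
  ∃ (m : ℕ) (f : Fin m → PLComb),
    (∀ j, ∀ A ∈ (f j).coeff.support, A.numEdges ≤ d) ∧
    a = ∑ j, (f j * f j).unlabel

/-- The connected graphs of the form `[[AB]]`, where `A` and `B` have at most `d` edges. -/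
def connGraphs (d : ℕ) : Set UGraph :=
  {C | C.Connected ∧ ∃ A B : PLGraph, A.numEdges ≤ d ∧ B.numEdges ≤ d ∧ (A * B).unlabel = C}

open Classical in
/-- The value of an unlabeled graph at a point with coordinates indexed by `connGraphs d`: the
product of the coordinates of its connected components. The value `0` for a component without a
coordinate is a placeholder; all components of the graphs in `d`-sos graph combinations have
coordinates, and `SosTestable` asks for this explicitly. -/
noncomputable def evalGraph (d : ℕ) (x : connGraphs d → ℝ) (G : UGraph) : ℝ :=
  (G.components.map fun C => if h : C ∈ connGraphs d then x ⟨C, h⟩ else 0).prod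

/-- The value of a graph combination at a point with coordinates indexed by `connGraphs d`. -/
noncomputable def evalComb (d : ℕ) (x : connGraphs d → ℝ) (a : GraphComb) : ℝ :=
  a.coeff.sum fun G c => c * evalGraph d x G

/-- The `d`-sos-profile: the points with nonnegative coordinates indexed by `connGraphs d` at
which all `d`-sos graph combinations are nonnegative. -/
def sosProfile (d : ℕ) : Set (connGraphs d → ℝ) :=
  {x | (∀ C, 0 ≤ x C) ∧ ∀ a : GraphComb, IsSOS d a → 0 ≤ evalComb d x a}

/-- A graph combination is sos-testable if, for some positive integer `d`, it is (an expression in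
the coordinates of, and) nonnegative on the `d`-sos-profile. -/
def SosTestable (a : GraphComb) : Prop :=
  ∃ d : ℕ, 1 ≤ d ∧ (∀ G ∈ a.coeff.support, ∀ C ∈ G.components, C ∈ connGraphs d) ∧
    ∀ x ∈ sosProfile d, 0 ≤ evalComb d x a

/-! ### The edge and the path with three edges -/

/-- `K₂`, the graph with one edge. -/
def K₂ : FinGraph where
  n := 2
  graph := ⊤
  noIsolated := by unfold NoIsolated; decide

/-- `P₃`, the path with three edges. -/
def P₃ : FinGraph where
  n := 4
  graph := pathGraph 4
  noIsolated := by
    intro v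
    fin_cases v
    · exact ⟨1, by simp [pathGraph_adj]⟩
    · exact ⟨0, by simp [pathGraph_adj]⟩
    · exact ⟨1, by simp [pathGraph_adj]⟩
    · exact ⟨2, by simp [pathGraph_adj]⟩

end GraphDensity

/-! Write H and K for the two graphs. For each `d`, a positive multiplicative graph parameter φ with
positive semidefinite connection matrix (φ([[AB]])) gives a point of the `d`-sos-profile by
restriction to connected graphs (`mem_sosProfile`). If also φ(H)^k < φ(K)^(k+1), the combination is
negative there. So it suffices to build such a φ (`exists_character`).

The parameter is φ(G) = (θ^e(G) · ∏ t(G, T_i))^s, where 0 < θ < 1, e is the integer exponent `expo`,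
additive over disjoint unions, the t(·, T_i) are homomorphism densities in finite weighted targets,
and s is large. Two facts make this work. (a) e(AA) + e(BB) ≤ 2 e(AB) (`expo_glue`), so φ satisfies
the Cauchy-Schwarz inequality on all 2×2 minors. (b) If no target makes Cauchy-Schwarz strict for A
and B, then A times the unlabeled part of B and B times the unlabeled part of A are isomorphic over
the labels (`exists_strict_or_iso`), and the rows of A and B are proportional for every
multiplicative parameter. After normalization the matrix thus has entries 1 between equal rows and
entries below 1 elsewhere. A high entrywise power makes the latter negligible, so the matrix becomes
positive semidefinite (`exists_pow_form_nonneg`). As θ may be taken small, only the exponents matter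
for the separation: (k+1) e(K) < k e(H) is enough.

The exponent depends on a component C of H with n vertices. A tree of copies of C is built from
disjoint induced copies by joining with single edges; it is live if no edge leaves it. The cost of G
is the minimum over vertex sets U of (2p+3)|U| plus the numbers of darts and of live sets left after
deleting all edges at U. The exponent is n times the cost outside a closed set D, plus (darts(C) +
1) times the number of non-isolated vertices in D, minimized over D. The live sets contribute the
extra 1 that singles out C. The set D prevents larger trees of copies from gaining as well.

The heart is (a) for the cost (`cost_tri`). Both sides are compared with the maximal excess of
families of live sets, that is, the number of members minus the number of touching edges. One
comparison merges trees along edges (`excess_add_excess_le`). The other (`cost_double_le`) deletes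
vertices one by one, guided by supermodularity, until the reflection of a doubled graph forces its
live sets to be evident. There the trivial square property enters: a copy of C that is invariant
under the reflection and meets the fixed part is fixed pointwise.

Finally C is chosen among the components of H not matched in K, with (darts + 1)/n maximal. With
degrees p or p+1 in H, this gives e(H) ≥ e(K) + n and e(K) ≤ n · darts(K)
(`exists_separating_component`), hence the separation for k > 2|E(K)|. -/

namespace GraphDensity

/-! ### Trees of induced copies of a connected graph -/

section CTree

variable {V W κ : Type*}

/-- Exactly one edge joins `S` to `T`. -/
def OneEdge (G : SimpleGraph V) (S T : Finset V) : Prop :=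
  ∃ a ∈ S, ∃ b ∈ T, G.Adj a b ∧ ∀ a' ∈ S, ∀ b' ∈ T, G.Adj a' b' → a' = a ∧ b' = b

theorem OneEdge.symm {G : SimpleGraph V} {S T : Finset V} (h : OneEdge G S T) :
    OneEdge G T S := by
  obtain ⟨a, ha, b, hb, hab, hu⟩ := h
  exact ⟨b, hb, a, ha, hab.symm, fun x hx y hy h => (hu y hy x hx h.symm).symm⟩

/-- `P` is a tree of induced copies of `C` in `G`: it is built from disjoint induced copies by
repeatedly joining two sets with exactly one edge of `G` between them. -/
inductive CTree (C : SimpleGraph κ) (G : SimpleGraph V) : Finset V → Prop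
  | base {P : Finset V} (f : C ↪g G) (hP : ∀ v, v ∈ P ↔ ∃ i, f i = v) : CTree C G P
  | join {S T P : Finset V} (hS : CTree C G S) (hT : CTree C G T) (hd : Disjoint S T)
      (he : OneEdge G S T) (hP : ∀ v, v ∈ P ↔ v ∈ S ∨ v ∈ T) : CTree C G P

variable {C : SimpleGraph κ} {G : SimpleGraph V}

theorem card_of_mem_iff_or {S T P : Finset V} (hd : Disjoint S T)
    (hP : ∀ v, v ∈ P ↔ v ∈ S ∨ v ∈ T) : P.card = S.card + T.card := by
  classical
  rw [← Finset.card_union_of_disjoint hd]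
  congr 1
  ext v
  rw [hP, Finset.mem_union]

theorem card_of_embedding [Fintype κ] {P : Finset V} (f : C ↪g G)
    (hP : ∀ v, v ∈ P ↔ ∃ i, f i = v) : P.card = Fintype.card κ := by
  classical
  have : P = Finset.univ.map f.toEmbedding := by
    ext v
    simp [hP]
  rw [this, Finset.card_map, Finset.card_univ]

theorem CTree.dvd_card [Fintype κ] {P : Finset V} (h : CTree C G P) :
    Fintype.card κ ∣ P.card := by
  induction h with
  | base f hP => rw [card_of_embedding f hP]
  | join _ _ hd _ hP ihS ihT =>
    rw [card_of_mem_iff_or hd hP]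
    exact dvd_add ihS ihT

theorem CTree.nonempty [Nonempty κ] {P : Finset V} (h : CTree C G P) : P.Nonempty := by
  induction h with
  | base f hP => exact ⟨f (Classical.arbitrary κ), (hP _).2 ⟨_, rfl⟩⟩
  | join _ _ _ _ hP ihS _ =>
    obtain ⟨v, hv⟩ := ihS
    exact ⟨v, (hP v).2 (Or.inl hv)⟩

/-- A set that splits a tree of copies of a connected graph is crossed by an edge of the tree. -/
theorem CTree.exists_adj (hC : C.Connected) {P : Finset V} (h : CTree C G P) {Q : V → Prop}
    (h1 : ∃ a ∈ P, Q a) (h2 : ∃ b ∈ P, ¬ Q b) :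
    ∃ a ∈ P, ∃ b ∈ P, Q a ∧ ¬ Q b ∧ G.Adj a b := by
  induction h with
  | base f hP =>
    obtain ⟨_, ha, hQa⟩ := h1
    obtain ⟨_, hb, hQb⟩ := h2
    obtain ⟨i, rfl⟩ := (hP _).1 ha
    obtain ⟨j, rfl⟩ := (hP _).1 hb
    obtain ⟨w⟩ := hC.preconnected i j
    obtain ⟨d, -, hd1, hd2⟩ := w.exists_boundary_dart {i | Q (f i)} hQa hQb
    exact ⟨f d.fst, (hP _).2 ⟨_, rfl⟩, f d.snd, (hP _).2 ⟨_, rfl⟩, hd1, hd2,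
      f.map_adj_iff.2 d.adj⟩
  | @join S T P _ _ _ he hP ihS ihT =>
    by_cases hS : (∃ a ∈ S, Q a) ∧ ∃ b ∈ S, ¬ Q b
    · obtain ⟨a, ha, b, hb, h⟩ := ihS hS.1 hS.2
      exact ⟨a, (hP a).2 (Or.inl ha), b, (hP b).2 (Or.inl hb), h⟩
    by_cases hT : (∃ a ∈ T, Q a) ∧ ∃ b ∈ T, ¬ Q b
    · obtain ⟨a, ha, b, hb, h⟩ := ihT hT.1 hT.2
      exact ⟨a, (hP a).2 (Or.inr ha), b, (hP b).2 (Or.inr hb), h⟩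
    obtain ⟨s, hs, t, ht, hst, -⟩ := he
    have hsP := (hP s).2 (Or.inl hs)
    have htP := (hP t).2 (Or.inr ht)
    by_cases hQs : Q s <;> by_cases hQt : Q t
    · obtain ⟨b, hb, hQb⟩ := h2
      rcases (hP b).1 hb with hb | hb
      · exact (hS ⟨⟨s, hs, hQs⟩, b, hb, hQb⟩).elim
      · exact (hT ⟨⟨t, ht, hQt⟩, b, hb, hQb⟩).elim
    · exact ⟨s, hsP, t, htP, hQs, hQt, hst⟩
    · exact ⟨t, htP, s, hsP, hQt, hQs, hst.symm⟩
    · obtain ⟨b, hb, hQb⟩ := h1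
      rcases (hP b).1 hb with hb | hb
      · exact (hS ⟨⟨b, hb, hQb⟩, s, hs, hQs⟩).elim
      · exact (hT ⟨⟨b, hb, hQb⟩, t, ht, hQt⟩).elim

/-- Transport along a map that is injective on `P` and preserves and reflects adjacency there. -/
theorem CTree.transport {G' : SimpleGraph W} {P : Finset V} (h : CTree C G P) :
    ∀ {P' : Finset W} (f : V → W), (∀ a ∈ P, ∀ b ∈ P, f a = f b → a = b) →
    (∀ a ∈ P, ∀ b ∈ P, G.Adj a b ↔ G'.Adj (f a) (f b)) →
    (∀ w, w ∈ P' ↔ ∃ v ∈ P, f v = w) → CTree C G' P' := by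
  classical
  induction h with
  | base g hP =>
    intro P' f hf hadj hP'
    have hg : ∀ i, g i ∈ _ := fun i => (hP (g i)).2 ⟨i, rfl⟩
    refine CTree.base ⟨⟨fun i => f (g i), fun i j hij => g.injective (hf _ (hg i) _ (hg j) hij)⟩,
      ?_⟩ ?_
    · intro i j
      exact (hadj _ (hg i) _ (hg j)).symm.trans g.map_adj_iff
    · intro w
      rw [hP']
      constructor
      · rintro ⟨v, hv, rfl⟩
        obtain ⟨i, rfl⟩ := (hP v).1 hv
        exact ⟨i, rfl⟩
      · rintro ⟨i, rfl⟩
        exact ⟨g i, hg i, rfl⟩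
  | @join S T P _ _ hd he hP ihS ihT =>
    intro P' f hf hadj hP'
    have hSP : ∀ v ∈ S, v ∈ P := fun v hv => (hP v).2 (Or.inl hv)
    have hTP : ∀ v ∈ T, v ∈ P := fun v hv => (hP v).2 (Or.inr hv)
    refine CTree.join
      (ihS (P' := S.image f) f (fun a ha b hb => hf a (hSP a ha) b (hSP b hb))
        (fun a ha b hb => hadj a (hSP a ha) b (hSP b hb)) (fun w => Finset.mem_image))
      (ihT (P' := T.image f) f (fun a ha b hb => hf a (hTP a ha) b (hTP b hb))
        (fun a ha b hb => hadj a (hTP a ha) b (hTP b hb)) (fun w => Finset.mem_image)) ?_ ?_ ?_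
    · rw [Finset.disjoint_left]
      intro w hw hw'
      obtain ⟨a, ha, rfl⟩ := Finset.mem_image.1 hw
      obtain ⟨b, hb, hab⟩ := Finset.mem_image.1 hw'
      have := hf b (hTP b hb) a (hSP a ha) hab
      subst this
      exact Finset.disjoint_left.1 hd ha hb
    · obtain ⟨a, ha, b, hb, hab, hu⟩ := he
      refine ⟨f a, Finset.mem_image_of_mem f ha, f b, Finset.mem_image_of_mem f hb,
        (hadj a (hSP a ha) b (hTP b hb)).1 hab, ?_⟩
      intro a' ha' b' hb' h'
      obtain ⟨x, hx, rfl⟩ := Finset.mem_image.1 ha'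
      obtain ⟨y, hy, rfl⟩ := Finset.mem_image.1 hb'
      obtain ⟨rfl, rfl⟩ := hu x hx y hy ((hadj x (hSP x hx) y (hTP y hy)).2 h')
      exact ⟨rfl, rfl⟩
    · intro w
      rw [hP', Finset.mem_image, Finset.mem_image]
      constructor
      · rintro ⟨v, hv, rfl⟩
        rcases (hP v).1 hv with h | h
        · exact Or.inl ⟨v, h, rfl⟩
        · exact Or.inr ⟨v, h, rfl⟩
      · rintro (⟨v, h, rfl⟩ | ⟨v, h, rfl⟩)
        · exact ⟨v, hSP v h, rfl⟩
        · exact ⟨v, hTP v h, rfl⟩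

theorem CTree.congr_graph {G' : SimpleGraph V} {P : Finset V} (h : CTree C G P)
    (hadj : ∀ a ∈ P, ∀ b ∈ P, G.Adj a b ↔ G'.Adj a b) : CTree C G' P :=
  h.transport id (fun _ _ _ _ h => h) hadj (by simp)

/-- This is the case of `CTree.split` where one of the two joined trees lies on one side of the cut.
The cut then either splits the other tree, to which the induction hypothesis `ih` applies, or is the
joint itself. -/
theorem CTree.split_aux [Fintype κ] (hC : C.Connected) {S1 S2 T1 T2 : Finset V}
    (h1 : CTree C G S1) (h2 : CTree C G S2) (hd : Disjoint S1 S2) (he : OneEdge G S1 S2)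
    (ih : ∀ T1 T2 : Finset V, Disjoint T1 T2 → OneEdge G T1 T2 → (∀ v, v ∈ S1 ↔ v ∈ T1 ∨ v ∈ T2) →
      Fintype.card κ ∣ T1.card → CTree C G T1 ∧ CTree C G T2)
    (hT : Disjoint T1 T2) (heT : OneEdge G T1 T2)
    (hP : ∀ v, v ∈ S1 ∨ v ∈ S2 ↔ v ∈ T1 ∨ v ∈ T2)
    (hn : Fintype.card κ ∣ T1.card) (hsub : ∀ v ∈ S2, v ∈ T1) :
    CTree C G T1 ∧ CTree C G T2 := by
  classical
  have hT2 : ∀ v ∈ T2, v ∈ S1 := by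
    intro v hv
    rcases (hP v).2 (Or.inr hv) with h | h
    · exact h
    · exact (Finset.disjoint_left.1 hT (hsub v h) hv).elim
  by_cases hne : ∃ v ∈ S1, v ∈ T1
  · obtain ⟨t1, ht1, t2, ht2, htt, hut⟩ := heT
    -- `S1` is connected and meets both sides, so the only edge of the cut lies inside `S1` and is
    -- also the only edge between `S1 ∩ T1` and `T2`.
    obtain ⟨a, haS, b, hbS, ha, hb, hab⟩ := h1.exists_adj hC (Q := fun v => v ∈ T1) hne
      ⟨t2, hT2 t2 ht2, fun h => Finset.disjoint_left.1 hT h ht2⟩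
    have hb2 : b ∈ T2 := by
      rcases (hP b).1 (Or.inl hbS) with h | h
      · exact (hb h).elim
      · exact h
    obtain ⟨rfl, rfl⟩ := hut a ha b hb2 hab
    have hcard : T1.card = (S1 ∩ T1).card + S2.card := by
      refine card_of_mem_iff_or ?_ ?_
      · exact hd.mono_left Finset.inter_subset_left
      · intro v
        have h1 := hP v
        have h2 := hsub v
        have h3 := hT2 v
        simp only [Finset.mem_inter]
        tauto
    have hn1 : Fintype.card κ ∣ (S1 ∩ T1).card := by
      rw [hcard] at hn
      exact (Nat.dvd_add_left h2.dvd_card).1 hn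
    obtain ⟨h3, h4⟩ := ih (S1 ∩ T1) T2 (hT.mono_left Finset.inter_subset_right)
      ⟨a, Finset.mem_inter.2 ⟨haS, ha⟩, b, hb2, hab, fun x hx y hy =>
        hut x (Finset.mem_inter.1 hx).2 y hy⟩ (fun v => by
          have h1 := hP v
          have h2 := hT2 v
          simp only [Finset.mem_inter]
          tauto) hn1
    refine ⟨CTree.join h3 h2 (hd.mono_left Finset.inter_subset_left) ?_ ?_, h4⟩
    · obtain ⟨s1, hs1, s2, hs2, hss, hus⟩ := he
      -- The joint between `S1` and `S2` ends in `T1`: otherwise it would be the edge of the cut,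
      -- which lies inside `S1`.
      refine ⟨s1, Finset.mem_inter.2 ⟨hs1, ?_⟩, s2, hs2, hss, fun x hx y hy =>
        hus x (Finset.mem_inter.1 hx).1 y hy⟩
      rcases (hP s1).1 (Or.inl hs1) with h | h
      · exact h
      · obtain ⟨h, -⟩ := hut s2 (hsub s2 hs2) s1 h hss.symm
        subst h
        exact (Finset.disjoint_left.1 hd haS hs2).elim
    · intro v
      have h1 := hP v
      have h2 := hsub v
      have h3 := hT2 v
      simp only [Finset.mem_inter]
      tauto
  · push Not at hne
    have e1 : S1 = T2 := by
      ext v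
      have := hP v; have := hne v; have := hT2 v
      tauto
    have e2 : S2 = T1 := by
      ext v
      have := hP v; have := hne v; have := hsub v
      tauto
    rw [← e1, ← e2]
    exact ⟨h2, h1⟩

/-- If a tree of copies of `C` is cut along a single edge into parts whose sizes are multiples of
the size of `C`, then both parts are trees of copies of `C`. -/
theorem CTree.split [Fintype κ] (hC : C.Connected) {P : Finset V} (h : CTree C G P) :
    ∀ T1 T2 : Finset V, Disjoint T1 T2 → OneEdge G T1 T2 → (∀ v, v ∈ P ↔ v ∈ T1 ∨ v ∈ T2) →
      Fintype.card κ ∣ T1.card → CTree C G T1 ∧ CTree C G T2 := by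
  induction h with
  | base f hP =>
    intro T1 T2 hd he hT hn
    have h1 := card_of_mem_iff_or hd hT
    rw [card_of_embedding f hP] at h1
    obtain ⟨a, ha, b, hb, -⟩ := he
    have h2 := Finset.card_pos.2 ⟨a, ha⟩
    have h3 := Finset.card_pos.2 ⟨b, hb⟩
    have := Nat.le_of_dvd h2 hn
    omega
  | @join S1 S2 P h1 h2 hd he hP ih1 ih2 =>
    intro T1 T2 hdT heT hT hn
    have hP' : ∀ v, v ∈ S1 ∨ v ∈ S2 ↔ v ∈ T1 ∨ v ∈ T2 := fun v => (hP v).symm.trans (hT v)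
    have hn2 : Fintype.card κ ∣ T2.card := by
      have h4 := (CTree.join h1 h2 hd he hP).dvd_card
      rw [card_of_mem_iff_or hdT hT] at h4
      exact (Nat.dvd_add_right hn).1 h4
    by_cases c1 : ∀ v ∈ S2, v ∈ T1
    · exact CTree.split_aux hC h1 h2 hd he ih1 hdT heT hP' hn c1
    by_cases c2 : ∀ v ∈ S2, v ∈ T2
    · exact (CTree.split_aux hC h1 h2 hd he ih1 hdT.symm heT.symm
        (fun v => (hP' v).trans or_comm) hn2 c2).symm
    by_cases c3 : ∀ v ∈ S1, v ∈ T1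
    · exact CTree.split_aux hC h2 h1 hd.symm he.symm ih2 hdT heT
        (fun v => or_comm.trans (hP' v)) hn c3
    by_cases c4 : ∀ v ∈ S1, v ∈ T2
    · exact (CTree.split_aux hC h2 h1 hd.symm he.symm ih2 hdT.symm heT.symm
        (fun v => (or_comm.trans (hP' v)).trans or_comm) hn2 c4).symm
    -- If both trees met both sides, each would contain an edge of the cut, but there is only one
    -- such edge and the trees are disjoint.
    exfalso
    push Not at c1 c2 c3 c4
    have key : ∀ S : Finset V, (∀ v ∈ S, v ∈ T1 ∨ v ∈ T2) → (∃ v ∈ S, v ∉ T1) →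
        (∃ v ∈ S, v ∉ T2) → (∃ a ∈ S, a ∈ T1) ∧ ∃ b ∈ S, b ∉ T1 := by
      rintro S hS hv ⟨w, hw, hw2⟩
      exact ⟨⟨w, hw, (hS w hw).resolve_right hw2⟩, hv⟩
    have k1 := key S1 (fun v hv => (hP' v).1 (Or.inl hv)) c3 c4
    have k2 := key S2 (fun v hv => (hP' v).1 (Or.inr hv)) c1 c2
    obtain ⟨a, haS, b, hbS, ha, hb, hab⟩ := h1.exists_adj hC (Q := fun v => v ∈ T1) k1.1 k1.2
    obtain ⟨a', haS', b', hbS', ha', hb', hab'⟩ :=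
      h2.exists_adj hC (Q := fun v => v ∈ T1) k2.1 k2.2
    obtain ⟨x, hx, y, hy, hxy, hu⟩ := heT
    have e1 := (hu a ha b (((hP' b).1 (Or.inl hbS)).resolve_left hb) hab).1
    have e2 := (hu a' ha' b' (((hP' b').1 (Or.inr hbS')).resolve_left hb') hab').1
    rw [e1] at haS
    rw [e2] at haS'
    exact Finset.disjoint_left.1 hd haS haS'

/-- Any vertex `l` of a tree of copies of `C` has at least `p` neighbors in it such that no part
of the rest reaching one of them has size divisible by the size of `C`. -/
theorem CTree.exists_neighbors [Fintype κ] (hC : C.Connected) {p : ℕ}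
    (hp : ∀ i, ∃ s : Finset κ, p ≤ s.card ∧ ∀ j ∈ s, C.Adj i j)
    {P : Finset V} (h : CTree C G P) : ∀ l ∈ P, ∃ Q : Finset V, Q ⊆ P ∧ (∀ v ∈ Q, G.Adj l v) ∧
      p ≤ Q.card ∧ ∀ S ⊆ P, l ∉ S → (∀ a ∈ S, ∀ b ∈ P, b ≠ l → G.Adj a b → b ∈ S) →
        (∃ v ∈ S, v ∈ Q) → ¬ Fintype.card κ ∣ S.card := by
  classical
  induction h with
  | base f hP =>
    intro l hl
    obtain ⟨i, rfl⟩ := (hP l).1 hl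
    obtain ⟨s, hs, hs'⟩ := hp i
    refine ⟨s.map f.toEmbedding, ?_, ?_, by rwa [Finset.card_map], ?_⟩
    · intro v hv
      obtain ⟨j, -, rfl⟩ := Finset.mem_map.1 hv
      exact (hP _).2 ⟨j, rfl⟩
    · intro v hv
      obtain ⟨j, hj, rfl⟩ := Finset.mem_map.1 hv
      exact f.map_adj_iff.2 (hs' j hj)
    -- Inside a single copy, a nonempty set avoiding `l` has fewer elements than `C`.
    · rintro S hS hlS - ⟨v, hv, -⟩ hdvd
      have h1 := Finset.card_lt_card (Finset.ssubset_iff_of_subset hS |>.2 ⟨f i, hl, hlS⟩)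
      rw [card_of_embedding f hP] at h1
      have := Nat.le_of_dvd (Finset.card_pos.2 ⟨v, hv⟩) hdvd
      omega
  | @join S1 S2 P h1 h2 hd he hP ih1 ih2 =>
    have key : ∀ S1 S2 : Finset V, CTree C G S2 → Disjoint S1 S2 →
        (∀ v, v ∈ P ↔ v ∈ S1 ∨ v ∈ S2) → ∀ l ∈ S1, (∃ Q : Finset V, Q ⊆ S1 ∧ (∀ v ∈ Q, G.Adj l v) ∧
        p ≤ Q.card ∧ ∀ S ⊆ S1, l ∉ S → (∀ a ∈ S, ∀ b ∈ S1, b ≠ l → G.Adj a b → b ∈ S) →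
        (∃ v ∈ S, v ∈ Q) → ¬ Fintype.card κ ∣ S.card) →
        ∃ Q : Finset V, Q ⊆ P ∧ (∀ v ∈ Q, G.Adj l v) ∧
        p ≤ Q.card ∧ ∀ S ⊆ P, l ∉ S → (∀ a ∈ S, ∀ b ∈ P, b ≠ l → G.Adj a b → b ∈ S) →
        (∃ v ∈ S, v ∈ Q) → ¬ Fintype.card κ ∣ S.card := by
      rintro S1 S2 h2 hd hP l hl ⟨Q, hQ, hadj, hc, hmain⟩
      refine ⟨Q, fun v hv => (hP v).2 (Or.inl (hQ hv)), hadj, hc, ?_⟩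
      rintro S hSP hlS hcl ⟨v, hvS, hvQ⟩ hdvd
      have hm := hmain (S ∩ S1) Finset.inter_subset_right (fun h => hlS (Finset.mem_inter.1 h).1)
        (fun a ha b hb hbl hab => Finset.mem_inter.2 ⟨hcl a (Finset.mem_inter.1 ha).1 b
          ((hP b).2 (Or.inl hb)) hbl hab, hb⟩) ⟨v, Finset.mem_inter.2 ⟨hvS, hQ hvQ⟩, hvQ⟩
      have hc2 : S.card = (S ∩ S1).card + (S ∩ S2).card := by
        refine card_of_mem_iff_or ?_ ?_
        · exact hd.mono Finset.inter_subset_right Finset.inter_subset_right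
        · intro v
          have := (hP v).1
          have := @hSP v
          simp only [Finset.mem_inter]
          tauto
      -- The tree `S2` is connected and avoids `l`, so `S` contains all of it or nothing. Attaching
      -- it does not affect divisibility, and the old `Q` still works.
      have hdv2 : Fintype.card κ ∣ (S ∩ S2).card := by
        by_cases c1 : ∃ a ∈ S2, a ∈ S
        · by_cases c2 : ∃ a ∈ S2, a ∉ S
          · obtain ⟨a, ha, b, hb, haS, hbS, hab⟩ := h2.exists_adj hC (Q := fun v => v ∈ S) c1 c2
            refine (hbS (hcl a haS b ((hP b).2 (Or.inr hb)) ?_ hab)).elim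
            rintro rfl
            exact Finset.disjoint_left.1 hd hl hb
          · push Not at c2
            rw [Finset.inter_eq_right.2 c2]
            exact h2.dvd_card
        · push Not at c1
          have : S ∩ S2 = ∅ := by
            ext v
            have := c1 v
            simp only [Finset.mem_inter, Finset.notMem_empty, iff_false]
            tauto
          rw [this]
          simp
      rw [hc2] at hdvd
      exact hm ((Nat.dvd_add_left hdv2).1 hdvd)
    intro l hl
    rcases (hP l).1 hl with hl | hl
    · exact key S1 S2 h2 hd hP l hl (ih1 l hl)
    · exact key S2 S1 h1 hd.symm (fun v => (hP v).trans or_comm) l hl (ih2 l hl)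

/-- The fixed part of a symmetric tree of copies of `C`. -/
theorem CTree.exists_fixed [Fintype κ] (hC : C.Connected) {σ : V → V} (hσ : ∀ v, σ (σ v) = v)
    (hadj : ∀ a b, G.Adj (σ a) (σ b) ↔ G.Adj a b)
    (hbase : ∀ (P : Finset V) (f : C ↪g G), (∀ v, v ∈ P ↔ ∃ i, f i = v) → (∀ v ∈ P, σ v ∈ P) →
      (∃ v ∈ P, σ v = v) → ∀ v ∈ P, σ v = v) :
    ∀ (N : ℕ) (P : Finset V), P.card = N → CTree C G P → (∀ v ∈ P, σ v ∈ P) →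
      ∀ l ∈ P, σ l = l → ∃ E : Finset V, CTree C G E ∧ l ∈ E ∧ (∀ v ∈ E, v ∈ P ∧ σ v = v) ∧
        ∀ a ∈ E, ∀ b ∈ P, σ b = b → G.Adj a b → b ∈ E := by
  classical
  intro N
  induction N using Nat.strong_induction_on with
  | _ N IH =>
  intro P hN hP hσP l hl hσl
  have hinj : ∀ a b, σ a = σ b → a = b := fun a b h => by rw [← hσ a, h, hσ]
  have key : ∀ S1 S2 : Finset V, CTree C G S1 → CTree C G S2 → Disjoint S1 S2 →
      OneEdge G S1 S2 → (∀ v, v ∈ P ↔ v ∈ S1 ∨ v ∈ S2) → l ∈ S1 →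
      ∃ E : Finset V, CTree C G E ∧ l ∈ E ∧ (∀ v ∈ E, v ∈ P ∧ σ v = v) ∧
        ∀ a ∈ E, ∀ b ∈ P, σ b = b → G.Adj a b → b ∈ E := by
    rintro S1 S2 h1 h2 hd ⟨a, ha, b, hb, hab, hu⟩ hPS hl
    have hcard := card_of_mem_iff_or hd hPS
    have hne1 := Finset.card_pos.2 ⟨a, ha⟩
    have hne2 := Finset.card_pos.2 ⟨b, hb⟩
    have hdj : ∀ v ∈ S1, v ∉ S2 := fun v hv => Finset.disjoint_left.1 hd hv
    by_cases hinv : ∀ v ∈ S1, σ v ∈ S1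
    · have hinv2 : ∀ v ∈ S2, σ v ∈ S2 := by
        intro v hv
        rcases (hPS _).1 (hσP v ((hPS v).2 (Or.inr hv))) with h | h
        · have := hinv _ h
          rw [hσ] at this
          exact (hdj v this hv).elim
        · exact h
      -- Both trees are invariant, so uniqueness of the joining edge makes its ends fixed. The fixed
      -- parts of the two trees are joined along it if the first one reaches `a`.
      obtain ⟨hσa, hσb⟩ := hu _ (hinv a ha) _ (hinv2 b hb) ((hadj a b).2 hab)
      obtain ⟨E1, hE1, hlE1, hf1, hc1⟩ := IH S1.card (by omega) S1 rfl h1 hinv l hl hσl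
      by_cases haE : a ∈ E1
      · obtain ⟨E2, hE2, hbE2, hf2, hc2⟩ := IH S2.card (by omega) S2 rfl h2 hinv2 b hb hσb
        refine ⟨E1 ∪ E2, CTree.join hE1 hE2 ?_ ⟨a, haE, b, hbE2, hab, fun x hx y hy =>
          hu x (hf1 x hx).1 y (hf2 y hy).1⟩ (by simp), Finset.mem_union_left _ hlE1, ?_, ?_⟩
        · exact Finset.disjoint_left.2 fun v hv hv' => hdj v (hf1 v hv).1 (hf2 v hv').1
        · intro v hv
          rcases Finset.mem_union.1 hv with hv | hv
          · exact ⟨(hPS v).2 (Or.inl (hf1 v hv).1), (hf1 v hv).2⟩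
          · exact ⟨(hPS v).2 (Or.inr (hf2 v hv).1), (hf2 v hv).2⟩
        · intro x hx y hy hσy hxy
          rw [Finset.mem_union]
          rcases Finset.mem_union.1 hx with hx | hx <;> rcases (hPS y).1 hy with hy | hy
          · exact Or.inl (hc1 x hx y hy hσy hxy)
          · right
            rw [(hu x (hf1 x hx).1 y hy hxy).2]
            exact hbE2
          · left
            rw [(hu y hy x (hf2 x hx).1 hxy.symm).1]
            exact haE
          · exact Or.inr (hc2 x hx y hy hσy hxy)
      · refine ⟨E1, hE1, hlE1, fun v hv => ⟨(hPS v).2 (Or.inl (hf1 v hv).1), (hf1 v hv).2⟩, ?_⟩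
        intro x hx y hy hσy hxy
        rcases (hPS y).1 hy with hy | hy
        · exact hc1 x hx y hy hσy hxy
        · rw [(hu x (hf1 x hx).1 y hy hxy).1] at hx
          exact (haE hx).elim
    · push Not at hinv
      obtain ⟨w, hw, hσw⟩ := hinv
      have hσw2 : σ w ∈ S2 := ((hPS _).1 (hσP w ((hPS w).2 (Or.inl hw)))).resolve_left hσw
      -- Along `S1`, from the fixed vertex `l` to a vertex mapped into `S2`, some edge is mapped to
      -- the joining edge `a b`. So the reflected edge, from `σ a` to `σ b`, lies inside `S1`.
      obtain ⟨x, hx, y, hy, hσx, hσy, hxy⟩ := h1.exists_adj hC (Q := fun v => σ v ∈ S1)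
        ⟨l, hl, by rwa [hσl]⟩ ⟨w, hw, hσw⟩
      have hσy2 : σ y ∈ S2 := ((hPS _).1 (hσP y ((hPS y).2 (Or.inl hy)))).resolve_left hσy
      obtain ⟨hxa, hyb⟩ := hu _ hσx _ hσy2 ((hadj x y).2 hxy)
      have hxa' : x = σ a := by rw [← hxa, hσ]
      have hyb' : y = σ b := by rw [← hyb, hσ]
      -- The image of `S2` is connected and meets `S1`. If it met `S2`, it would use the edge `a b`
      -- and contain `a`, so `σ a` would lie in `S2`; but it lies in `S1`.
      have hdis : ∀ v ∈ S2, σ v ∉ S2 := by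
        intro v hv hσv
        have hT2 : CTree C G (S2.image σ) := h2.transport σ (fun a _ b _ h => hinj a b h)
          (fun a _ b _ => (hadj a b).symm) (fun w => Finset.mem_image)
        obtain ⟨c, hc, d, hd', hcS, hdS, hcd⟩ := hT2.exists_adj hC (Q := fun v => v ∈ S1)
          ⟨w, Finset.mem_image.2 ⟨σ w, hσw2, hσ w⟩, hw⟩
          ⟨σ v, Finset.mem_image_of_mem _ hv, fun h => hdj _ h hσv⟩
        have hdP : d ∈ S2 := by
          obtain ⟨d', hd'', rfl⟩ := Finset.mem_image.1 hd'
          exact ((hPS _).1 (hσP d' ((hPS d').2 (Or.inr hd'')))).resolve_left hdS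
        obtain ⟨rfl, rfl⟩ := hu c hcS d hdP hcd
        obtain ⟨c', hc', hcc⟩ := Finset.mem_image.1 hc
        have : σ c = c' := by rw [← hcc, hσ]
        rw [← hxa'] at this
        rw [this] at hx
        exact hdj _ hx hc'
      have hS2S1 : ∀ v ∈ S2, σ v ∈ S1 := fun v hv =>
        ((hPS _).1 (hσP v ((hPS v).2 (Or.inr hv)))).resolve_right (hdis v hv)
      -- Cut off the reflection of `S2` from `S1`, along the reflected edge. By `CTree.split` the
      -- invariant rest `T1` is again a tree of copies; it is smaller, and it contains all fixed
      -- vertices of `P`.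
      set T1 := S1.filter fun v => σ v ∈ S1 with hT1
      set T2 := S2.image σ with hT2
      have hmT1 : ∀ v, v ∈ T1 ↔ v ∈ S1 ∧ σ v ∈ S1 := fun v => by simp [hT1]
      have hmT2 : ∀ v, v ∈ T2 ↔ σ v ∈ S2 := fun v => by
        rw [hT2, Finset.mem_image]
        constructor
        · rintro ⟨u, hu, rfl⟩
          rwa [hσ]
        · intro h
          exact ⟨_, h, hσ v⟩
      have hTd : Disjoint T1 T2 := Finset.disjoint_left.2 fun v hv hv' =>
        hdj _ ((hmT1 v).1 hv).2 ((hmT2 v).1 hv')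
      have hTu : ∀ v, v ∈ S1 ↔ v ∈ T1 ∨ v ∈ T2 := by
        intro v
        rw [hmT1, hmT2]
        constructor
        · intro hv
          rcases (hPS _).1 (hσP v ((hPS v).2 (Or.inl hv))) with h | h
          · exact Or.inl ⟨hv, h⟩
          · exact Or.inr h
        · rintro (h | h)
          · exact h.1
          · have := hS2S1 _ h
            rwa [hσ] at this
      have hn1 : Fintype.card κ ∣ T1.card := by
        have e1 := card_of_mem_iff_or hTd hTu
        have e2 : T2.card = S2.card := Finset.card_image_of_injective _ fun a b h => hinj a b h
        have e3 := h1.dvd_card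
        rw [e1, e2] at e3
        exact (Nat.dvd_add_left h2.dvd_card).1 e3
      obtain ⟨hTt, -⟩ := h1.split hC T1 T2 hTd ⟨x, (hmT1 x).2 ⟨hx, hσx⟩, y, (hmT2 y).2 hσy2, hxy,
        fun c hc d hd' hcd => by
          obtain ⟨h5, h6⟩ := hu _ ((hmT1 c).1 hc).2 _ ((hmT2 d).1 hd') ((hadj c d).2 hcd)
          rw [hxa', hyb', ← h5, ← h6, hσ, hσ]
          exact ⟨rfl, rfl⟩⟩ hTu hn1
      have hlt : T1.card < N := by
        have : T1.card ≤ S1.card := Finset.card_le_card fun v hv => ((hmT1 v).1 hv).1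
        omega
      obtain ⟨E, hE, hlE, hf, hc⟩ := IH T1.card hlt T1 rfl hTt (fun v hv => by
        rw [hmT1, hσ]
        exact ((hmT1 v).1 hv).symm) l ((hmT1 l).2 ⟨hl, by rwa [hσl]⟩) hσl
      refine ⟨E, hE, hlE, fun v hv => ⟨(hPS v).2 (Or.inl ((hmT1 v).1 (hf v hv).1).1),
        (hf v hv).2⟩, fun u hu' v hv hσv huv => ?_⟩
      refine hc u hu' v ((hmT1 v).2 ?_) hσv huv
      rw [hσv, and_self]
      rcases (hPS v).1 hv with h | h
      · exact h
      · have := hdis v h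
        rw [hσv] at this
        exact (this h).elim
  rcases hP with ⟨f, hf⟩ | ⟨h1, h2, hd, he, hPS⟩
  · have := hbase P f hf hσP ⟨l, hl, hσl⟩
    exact ⟨P, CTree.base f hf, hl, fun v hv => ⟨hv, this v hv⟩, fun _ _ b hb _ _ => hb⟩
  · rcases (hPS l).1 hl with h | h
    · exact key _ _ h1 h2 hd he hPS h
    · exact key _ _ h2 h1 hd.symm he.symm (fun v => (hPS v).trans or_comm) h

end CTree

/-! ### Counting edges in trees of copies -/

section Darts

variable {V W κ : Type*} {C : SimpleGraph κ} {G : SimpleGraph V}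

open Classical in
/-- The number of ordered pairs of adjacent vertices in `P`. -/
noncomputable def dartsIn (G : SimpleGraph V) (P : Finset V) : ℕ :=
  ∑ a ∈ P, ∑ b ∈ P, if G.Adj a b then 1 else 0

/-- The number of ordered pairs of adjacent vertices. -/
noncomputable def numDarts [Fintype V] (G : SimpleGraph V) : ℕ := dartsIn G Finset.univ

theorem dartsIn_embedding [Fintype κ] {P : Finset V} (f : C ↪g G)
    (hP : ∀ v, v ∈ P ↔ ∃ i, f i = v) : dartsIn G P = numDarts C := by
  classical
  have : P = Finset.univ.map f.toEmbedding := by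
    ext v
    simp [hP]
  rw [this, numDarts, dartsIn, dartsIn, Finset.sum_map]
  refine Finset.sum_congr rfl fun i _ => ?_
  rw [Finset.sum_map]
  refine Finset.sum_congr rfl fun j _ => ?_
  exact if_congr f.map_adj_iff rfl rfl

theorem dartsIn_join {S T P : Finset V} (hd : Disjoint S T) (he : OneEdge G S T)
    (hP : ∀ v, v ∈ P ↔ v ∈ S ∨ v ∈ T) : dartsIn G S + dartsIn G T + 2 ≤ dartsIn G P := by
  classical
  have : P = S ∪ T := by
    ext v
    rw [hP, Finset.mem_union]
  subst this
  obtain ⟨a, ha, b, hb, hab, -⟩ := he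
  have key : ∀ S T : Finset V, ∀ a ∈ S, ∀ b ∈ T, G.Adj a b →
      1 ≤ ∑ x ∈ S, ∑ y ∈ T, if G.Adj x y then 1 else 0 := by
    intro S T a ha b hb hab
    calc 1 = if G.Adj a b then 1 else 0 := by rw [if_pos hab]
      _ ≤ ∑ y ∈ T, if G.Adj a y then 1 else 0 :=
        Finset.single_le_sum (f := fun y => if G.Adj a y then 1 else 0)
          (fun _ _ => Nat.zero_le _) hb
      _ ≤ _ := Finset.single_le_sum (f := fun x => ∑ y ∈ T, if G.Adj x y then 1 else 0)
          (fun _ _ => Nat.zero_le _) ha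
  have k1 := key S T a ha b hb hab
  have k2 := key T S b hb a ha hab.symm
  unfold dartsIn
  rw [Finset.sum_union hd]
  simp_rw [Finset.sum_union hd, Finset.sum_add_distrib]
  omega

/-- A tree of copies of `C` either is a copy of `C` or has more edges than its copies. -/
theorem CTree.count [Fintype κ] {P : Finset V} (h : CTree C G P) :
    ∃ m : ℕ, 1 ≤ m ∧ P.card = m * Fintype.card κ ∧
      m * numDarts C + 2 * (m - 1) ≤ dartsIn G P ∧
      (m = 1 → ∃ f : C ↪g G, ∀ v, v ∈ P ↔ ∃ i, f i = v) := by
  induction h with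
  | base f hP =>
    exact ⟨1, le_rfl, by rw [card_of_embedding f hP, one_mul],
      by rw [dartsIn_embedding f hP]; omega, fun _ => ⟨f, hP⟩⟩
  | join _ _ hd he hP ihS ihT =>
    obtain ⟨m1, h1, c1, d1, -⟩ := ihS
    obtain ⟨m2, h2, c2, d2, -⟩ := ihT
    refine ⟨m1 + m2, by omega, by rw [card_of_mem_iff_or hd hP, c1, c2, add_mul], ?_,
      fun h => by omega⟩
    have := dartsIn_join hd he hP
    rw [add_mul]
    omega

end Darts

/-! ### Live sets: disjointness, monotonicity, and merging -/

section Live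

variable {V W κ : Type*}

/-- A tree of copies of `C` that no edge leaves. -/
def Live (C : SimpleGraph κ) (G : SimpleGraph V) (P : Finset V) : Prop :=
  CTree C G P ∧ ∀ a ∈ P, ∀ b, G.Adj a b → b ∈ P

open Classical in
/-- The finite set of all live sets. -/
noncomputable def liveSets [Fintype V] (C : SimpleGraph κ) (G : SimpleGraph V) :
    Finset (Finset V) := Finset.univ.filter (Live C G)

/-- The number of live sets. -/
noncomputable def numLive [Fintype V] (C : SimpleGraph κ) (G : SimpleGraph V) : ℕ :=
  (liveSets C G).card

variable {C : SimpleGraph κ} {G G' : SimpleGraph V}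

theorem mem_liveSets [Fintype V] {P : Finset V} : P ∈ liveSets C G ↔ Live C G P := by
  simp [liveSets]

/-- A tree of copies is connected, so it cannot leave a closed set. In particular, live sets are
connected components. -/
theorem CTree.subset_of_closed (hC : C.Connected) {P Q : Finset V} (h : CTree C G P)
    (hQ : ∀ a ∈ Q, ∀ b, G.Adj a b → b ∈ Q) {v : V} (hP : v ∈ P) (hv : v ∈ Q) : P ⊆ Q := by
  intro w hw
  by_contra hwQ
  obtain ⟨a, -, b, -, ha, hb, hab⟩ := h.exists_adj hC (Q := fun v => v ∈ Q) ⟨v, hP, hv⟩ ⟨w, hw, hwQ⟩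
  exact hb (hQ a ha b hab)

theorem Live.eq_of_mem (hC : C.Connected) {P Q : Finset V} (hP : Live C G P) (hQ : Live C G Q)
    {v : V} (h1 : v ∈ P) (h2 : v ∈ Q) : P = Q :=
  (hP.1.subset_of_closed hC hQ.2 h1 h2).antisymm (hQ.1.subset_of_closed hC hP.2 h2 h1)

theorem Live.exists_mem_adj [Fintype κ] (hC : C.Connected) (h2 : 2 ≤ Fintype.card κ)
    {P : Finset V} (h : CTree C G P) {v : V} (hv : v ∈ P) : ∃ w ∈ P, G.Adj v w := by
  classical
  have : 2 ≤ P.card := h2.trans (Nat.le_of_dvd (Finset.card_pos.2 ⟨v, hv⟩) h.dvd_card)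
  obtain ⟨w, hw, hwv⟩ := Finset.exists_mem_ne this v
  obtain ⟨a, -, b, hb, ha, -, hab⟩ := h.exists_adj hC (Q := fun u => u = v) ⟨v, hv, rfl⟩ ⟨w, hw, hwv⟩
  subst ha
  exact ⟨b, hb, hab⟩

open Classical in
theorem numDarts_eq_card [Fintype V] (G : SimpleGraph V) :
    numDarts G = ((Finset.univ : Finset (V × V)).filter fun q => G.Adj q.1 q.2).card := by
  rw [Finset.card_filter, ← Finset.univ_product_univ, Finset.sum_product]
  rfl

/-- Adding edges destroys at most one live set per added dart. -/
theorem numDarts_add_numLive_mono [Fintype V] [Nonempty κ] (hC : C.Connected) (h : G ≤ G') :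
    numDarts G + numLive C G ≤ numDarts G' + numLive C G' := by
  classical
  set D := (Finset.univ : Finset (V × V)).filter fun q => G'.Adj q.1 q.2 ∧ ¬ G.Adj q.1 q.2 with hD
  have h1 : numDarts G' = numDarts G + D.card := by
    rw [numDarts_eq_card, numDarts_eq_card, ← Finset.card_union_of_disjoint]
    · congr 1
      ext q
      have := @h q.1 q.2
      simp only [hD, Finset.mem_filter, Finset.mem_union, Finset.mem_univ, true_and]
      tauto
    · rw [Finset.disjoint_left]
      intro q hq hq'
      simp only [hD, Finset.mem_filter, Finset.mem_univ, true_and] at hq hq'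
      exact hq'.2 hq
  -- A live set from which no added dart starts stays live. Since live sets are disjoint, a dart
  -- starts in at most one of them.
  have h2 : (liveSets C G \ liveSets C G').card ≤ D.card := by
    refine Finset.card_le_card_of_forall_subsingleton (fun P q => q.1 ∈ P) ?_ ?_
    · intro P hP
      rw [Finset.mem_sdiff, mem_liveSets, mem_liveSets] at hP
      by_contra hcon
      push Not at hcon
      have key : ∀ a ∈ P, ∀ b, G'.Adj a b → G.Adj a b := by
        intro a ha b hab
        by_contra hn
        exact hcon (a, b) (by simp [hD, hab, hn]) ha
      exact hP.2 ⟨hP.1.1.congr_graph fun a ha b _ => ⟨fun hab => h hab, key a ha b⟩,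
        fun a ha b hab => hP.1.2 a ha b (key a ha b hab)⟩
    · rintro q - P ⟨hP, hqP⟩ Q ⟨hQ, hqQ⟩
      rw [Finset.mem_sdiff, mem_liveSets] at hP hQ
      exact hP.1.eq_of_mem hC hQ.1 hqP hqQ
  have h3 : (liveSets C G).card ≤ (liveSets C G \ liveSets C G').card + (liveSets C G').card :=
    Finset.card_le_card_sdiff_add_card
  unfold numLive
  omega

/-- A family of disjoint trees of copies of `C` exceeds the number of live sets at most by the
number of edges leaving its members. -/
theorem card_family_le [Fintype V] [DecidableEq V] [Nonempty κ] :
    ∀ (N : ℕ) (S : Finset (Finset V)) (E : Finset (Sym2 V)), S.card = N →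
      (∀ P ∈ S, CTree C G P) → (∀ P ∈ S, ∀ Q ∈ S, P ≠ Q → Disjoint P Q) →
      (∀ P ∈ S, ∀ a ∈ P, ∀ b, b ∉ P → G.Adj a b → s(a, b) ∈ E) →
      S.card ≤ numLive C G + E.card := by
  intro N
  induction N using Nat.strong_induction_on with
  | _ N IH =>
  intro S E hN hT hd hE
  by_cases hlive : ∀ P ∈ S, Live C G P
  · exact (Finset.card_le_card fun P hP => mem_liveSets.2 (hlive P hP)).trans (Nat.le_add_right _ _)
  push Not at hlive
  obtain ⟨P, hP, hPl⟩ := hlive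
  have : ∃ a ∈ P, ∃ b, b ∉ P ∧ G.Adj a b := by
    by_contra hcon
    push Not at hcon
    exact hPl ⟨hT P hP, fun a ha b hab => by
      by_contra hb
      exact hcon a ha b hb hab⟩
  obtain ⟨a, ha, b, hb, hab⟩ := this
  have hPc : (S.erase P).card + 1 = S.card := Finset.card_erase_add_one hP
  have hEc : (E.erase s(a, b)).card + 1 = E.card :=
    Finset.card_erase_add_one (hE P hP a ha b hb hab)
  have hnot : ∀ Q ∈ S, Q ≠ P → ∀ v ∈ Q, v ∉ P := fun Q hQ hQP v hv hvP =>
    Finset.disjoint_left.1 (hd Q hQ P hP hQP) hv hvP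
  -- Each reduction uses up at least as many edges as it loses members. Two members with a single
  -- edge between them are merged, at the price of that edge. With a second edge between them, both
  -- members and two edges are dropped. If `b` is in no member, only `P` and one edge are dropped.
  by_cases hb2 : ∃ Q ∈ S, b ∈ Q
  · obtain ⟨Q, hQ, hbQ⟩ := hb2
    have hQP : Q ≠ P := by
      rintro rfl
      exact hb hbQ
    have hQe : Q ∈ S.erase P := Finset.mem_erase.2 ⟨hQP, hQ⟩
    have hQc : ((S.erase P).erase Q).card + 1 = (S.erase P).card := Finset.card_erase_add_one hQe
    have hnotQ : ∀ R ∈ S, R ≠ Q → ∀ v ∈ R, v ∉ Q := fun R hR hRQ v hv hvQ =>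
      Finset.disjoint_left.1 (hd R hR Q hQ hRQ) hv hvQ
    by_cases hone : OneEdge G P Q
    · have hPQ : P ∪ Q ∉ (S.erase P).erase Q := by
        intro h
        rw [Finset.mem_erase, Finset.mem_erase] at h
        exact hnot _ h.2.2 h.2.1 a (Finset.mem_union_left _ ha) ha
      have hcard : (insert (P ∪ Q) ((S.erase P).erase Q)).card
          = ((S.erase P).erase Q).card + 1 := Finset.card_insert_of_notMem hPQ
      have := IH _ (by omega) (insert (P ∪ Q) ((S.erase P).erase Q)) (E.erase s(a, b)) rfl ?_ ?_ ?_
      · omega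
      · intro R hR
        rcases Finset.mem_insert.1 hR with rfl | hR
        · exact CTree.join (hT P hP) (hT Q hQ) (hd P hP Q hQ (Ne.symm hQP)) hone (by simp)
        · rw [Finset.mem_erase, Finset.mem_erase] at hR
          exact hT R hR.2.2
      · have aux : ∀ R ∈ (S.erase P).erase Q, Disjoint R (P ∪ Q) := by
          intro R hR
          rw [Finset.mem_erase, Finset.mem_erase] at hR
          rw [Finset.disjoint_union_right]
          exact ⟨hd R hR.2.2 P hP hR.2.1, hd R hR.2.2 Q hQ hR.1⟩
        intro R hR R' hR' hne
        rcases Finset.mem_insert.1 hR with rfl | hR <;> rcases Finset.mem_insert.1 hR' with rfl | hR'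
        · exact (hne rfl).elim
        · exact (aux R' hR').symm
        · exact aux R hR
        · rw [Finset.mem_erase, Finset.mem_erase] at hR hR'
          exact hd R hR.2.2 R' hR'.2.2 hne
      · intro R hR x hx y hy hxy
        rw [Finset.mem_erase]
        rcases Finset.mem_insert.1 hR with rfl | hR
        · rw [Finset.mem_union, not_or] at hy
          constructor
          · intro h
            rw [Sym2.eq_iff] at h
            rcases h with ⟨rfl, rfl⟩ | ⟨rfl, rfl⟩
            · exact hy.2 hbQ
            · exact hy.1 ha
          · rcases Finset.mem_union.1 hx with hx | hx
            · exact hE P hP x hx y hy.1 hxy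
            · exact hE Q hQ x hx y hy.2 hxy
        · rw [Finset.mem_erase, Finset.mem_erase] at hR
          refine ⟨fun h => ?_, hE R hR.2.2 x hx y hy hxy⟩
          rw [Sym2.eq_iff] at h
          rcases h with ⟨rfl, rfl⟩ | ⟨rfl, rfl⟩
          · exact hnot R hR.2.2 hR.2.1 _ hx ha
          · exact hnotQ R hR.2.2 hR.1 _ hx hbQ
    · obtain ⟨a', ha', b', hb', hab', hne⟩ :
          ∃ a' ∈ P, ∃ b' ∈ Q, G.Adj a' b' ∧ ¬ (a' = a ∧ b' = b) := by
        by_contra hcon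
        push Not at hcon
        exact hone ⟨a, ha, b, hbQ, hab, fun x hx y hy hxy => hcon x hx y hy hxy⟩
      have hbP' : b' ∉ P := hnot Q hQ hQP _ hb'
      have hmem : s(a', b') ∈ E.erase s(a, b) := by
        rw [Finset.mem_erase]
        refine ⟨fun h => ?_, hE P hP a' ha' b' hbP' hab'⟩
        rw [Sym2.eq_iff] at h
        rcases h with h | ⟨rfl, rfl⟩
        · exact hne h
        · exact hb ha'
      have hEc' : ((E.erase s(a, b)).erase s(a', b')).card + 1 = (E.erase s(a, b)).card :=
        Finset.card_erase_add_one hmem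
      have := IH _ (by omega) ((S.erase P).erase Q) ((E.erase s(a, b)).erase s(a', b')) rfl ?_ ?_ ?_
      · omega
      · intro R hR
        rw [Finset.mem_erase, Finset.mem_erase] at hR
        exact hT R hR.2.2
      · intro R hR R' hR' hne
        rw [Finset.mem_erase, Finset.mem_erase] at hR hR'
        exact hd R hR.2.2 R' hR'.2.2 hne
      · intro R hR x hx y hy hxy
        rw [Finset.mem_erase, Finset.mem_erase] at hR
        rw [Finset.mem_erase, Finset.mem_erase]
        have h1 := hnot R hR.2.2 hR.2.1 _ hx
        have h2 := hnotQ R hR.2.2 hR.1 _ hx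
        refine ⟨fun h => ?_, fun h => ?_, hE R hR.2.2 x hx y hy hxy⟩ <;> rw [Sym2.eq_iff] at h
        · rcases h with ⟨rfl, rfl⟩ | ⟨rfl, rfl⟩
          · exact h1 ha'
          · exact h2 hb'
        · rcases h with ⟨rfl, rfl⟩ | ⟨rfl, rfl⟩
          · exact h1 ha
          · exact h2 hbQ
  · push Not at hb2
    have := IH _ (by omega) (S.erase P) (E.erase s(a, b)) rfl ?_ ?_ ?_
    · omega
    · intro R hR
      exact hT R (Finset.mem_erase.1 hR).2
    · intro R hR R' hR' hne
      exact hd R (Finset.mem_erase.1 hR).2 R' (Finset.mem_erase.1 hR').2 hne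
    · intro R hR x hx y hy hxy
      rw [Finset.mem_erase] at hR
      rw [Finset.mem_erase]
      refine ⟨fun h => ?_, hE R hR.2 x hx y hy hxy⟩
      rw [Sym2.eq_iff] at h
      rcases h with ⟨rfl, rfl⟩ | ⟨rfl, rfl⟩
      · exact hnot R hR.2 hR.1 _ hx ha
      · exact hb2 R hR.2 hx

end Live

/-! ### Supermodularity of the excess -/

section Supermodular

/-- If the excess `|S| - |⋃ N|` is at most `T` on subfamilies of `M`, and `e` is a member of `M`,
then at some part `A l` of `N e` the excess computed without the elements of `A l` exceeds `T` by
less than `|A l|`. -/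
theorem exists_part_excess_le {ι E L : Type*} [DecidableEq ι] [DecidableEq E] {N : ι → Finset E}
    {M : Finset ι} {T : ℤ} (hT : ∀ S ⊆ M, (S.card : ℤ) - (S.biUnion N).card ≤ T) {e : ι}
    (he : e ∈ M) (hne : (N e).Nonempty) {I : Finset L} {A : L → Finset E}
    (hI : ∀ x ∈ N e, ∃ l ∈ I, x ∈ A l) :
    ∃ l ∈ I, (A l).Nonempty ∧ ∀ S ⊆ M.erase e,
      (S.card : ℤ) - (S.biUnion N \ A l).card ≤ T + (A l).card - 1 := by
  classical
  by_contra hcon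
  push Not at hcon
  -- Failure at `l` is only possible through a tight family, one of excess exactly `T`, whose union
  -- contains `A l`.
  have key : ∀ l ∈ I, (A l).Nonempty → ∃ S ⊆ M.erase e, T ≤ S.card - (S.biUnion N).card ∧
      A l ⊆ S.biUnion N := by
    intro l hl hA
    obtain ⟨S, hS, hlt⟩ := hcon l hl hA
    have h1 : (S.biUnion N \ A l).card + (S.biUnion N ∩ A l).card = (S.biUnion N).card :=
      Finset.card_sdiff_add_card_inter _ _
    have h2 : (S.biUnion N ∩ A l).card ≤ (A l).card :=
      Finset.card_le_card Finset.inter_subset_right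
    have h3 := hT S (hS.trans (Finset.erase_subset _ _))
    refine ⟨S, hS, by omega, ?_⟩
    have h4 : S.biUnion N ∩ A l = A l :=
      Finset.eq_of_subset_of_card_le Finset.inter_subset_right (by omega)
    rw [← h4]
    exact Finset.inter_subset_left
  -- The excess is supermodular and at most `T` on intersections, so unions of tight families are
  -- tight. The empty case needs one tight family to start with, which `hne` provides.
  have all : ∀ J ⊆ I, ∃ S ⊆ M.erase e, T ≤ S.card - (S.biUnion N).card ∧
      ∀ l ∈ J, A l ⊆ S.biUnion N := by
    intro J
    induction J using Finset.induction_on with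
    | empty =>
      intro _
      obtain ⟨x, hx⟩ := hne
      obtain ⟨l, hl, hxl⟩ := hI x hx
      obtain ⟨S, hS, h, -⟩ := key l hl ⟨x, hxl⟩
      exact ⟨S, hS, h, by simp⟩
    | insert l J hlJ ih =>
      intro hJ
      obtain ⟨S, hS, h1, h2⟩ := ih ((Finset.subset_insert _ _).trans hJ)
      by_cases hA : (A l).Nonempty
      · obtain ⟨S', hS', h1', h2'⟩ := key l (hJ (Finset.mem_insert_self _ _)) hA
        have c1 : (S ∪ S').card + (S ∩ S').card = S.card + S'.card :=
          Finset.card_union_add_card_inter _ _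
        have c2 : (S.biUnion N ∪ S'.biUnion N).card + (S.biUnion N ∩ S'.biUnion N).card
          = (S.biUnion N).card + (S'.biUnion N).card := Finset.card_union_add_card_inter _ _
        have c3 : (S ∪ S').biUnion N = S.biUnion N ∪ S'.biUnion N := Finset.union_biUnion
        have c4 : ((S ∩ S').biUnion N).card ≤ (S.biUnion N ∩ S'.biUnion N).card := by
          refine Finset.card_le_card ?_
          exact Finset.subset_inter (Finset.biUnion_subset_biUnion_of_subset_left _
            Finset.inter_subset_left) (Finset.biUnion_subset_biUnion_of_subset_left _
            Finset.inter_subset_right)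
        have c5 := hT (S ∩ S') ((Finset.inter_subset_left.trans hS).trans (Finset.erase_subset _ _))
        refine ⟨S ∪ S', Finset.union_subset hS hS', ?_, ?_⟩
        · rw [c3]
          omega
        · intro l' hl'
          rw [c3]
          rcases Finset.mem_insert.1 hl' with rfl | hl'
          · exact h2'.trans Finset.subset_union_right
          · exact (h2 l' hl').trans Finset.subset_union_left
      · rw [Finset.not_nonempty_iff_eq_empty] at hA
        refine ⟨S, hS, h1, fun l' hl' => ?_⟩
        rcases Finset.mem_insert.1 hl' with rfl | hl'
        · rw [hA]
          exact Finset.empty_subset _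
        · exact h2 l' hl'
  -- A tight family covering all of `N e` would reach the excess `T + 1` when `e` is added.
  obtain ⟨S, hS, h1, h2⟩ := all I subset_rfl
  have heS : e ∉ S := fun h => (Finset.mem_erase.1 (hS h)).1 rfl
  have hsub : N e ⊆ S.biUnion N := by
    intro x hx
    obtain ⟨l, hl, hxl⟩ := hI x hx
    exact h2 l hl hxl
  have h3 := hT (insert e S) (Finset.insert_subset he (hS.trans (Finset.erase_subset _ _)))
  rw [Finset.card_insert_of_notMem heS, Finset.biUnion_insert,
    Finset.union_eq_right.2 hsub] at h3
  push_cast at h3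
  omega

end Supermodular

/-! ### Deleting edges at vertices, and the cost -/

section Cut

variable {V W κ : Type*}

/-- Delete all edges at vertices of `U`. -/
def cut (G : SimpleGraph V) (U : Finset V) : SimpleGraph V where
  Adj a b := G.Adj a b ∧ a ∉ U ∧ b ∉ U
  symm := ⟨fun _ _ h => ⟨h.1.symm, h.2.2, h.2.1⟩⟩
  loopless := ⟨fun _ h => G.loopless.irrefl _ h.1⟩

@[simp] theorem cut_adj {G : SimpleGraph V} {U : Finset V} {a b : V} :
    (cut G U).Adj a b ↔ G.Adj a b ∧ a ∉ U ∧ b ∉ U := Iff.rfl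

@[simp] theorem cut_empty (G : SimpleGraph V) : cut G ∅ = G := by
  ext a b
  simp

theorem cut_cut [DecidableEq V] (G : SimpleGraph V) (U U' : Finset V) :
    cut (cut G U) U' = cut G (U ∪ U') := by
  ext a b
  simp only [cut_adj, Finset.mem_union]
  tauto

theorem cut_mono {G G' : SimpleGraph V} (h : G ≤ G') (U : Finset V) : cut G U ≤ cut G' U :=
  fun _ _ hab => ⟨h hab.1, hab.2⟩

/-- The cost of deleting the edges at the vertices of `U`. -/
noncomputable def costAt [Fintype V] (p : ℕ) (C : SimpleGraph κ) (G : SimpleGraph V)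
    (U : Finset V) : ℕ :=
  (2 * p + 3) * U.card + (numDarts (cut G U) + numLive C (cut G U))

/-- The minimal cost of deleting the edges at a set of vertices. -/
noncomputable def cost [Fintype V] (p : ℕ) (C : SimpleGraph κ) (G : SimpleGraph V) : ℕ :=
  ⨅ U, costAt p C G U

variable [Fintype V] {p : ℕ} {C : SimpleGraph κ} {G G' : SimpleGraph V}

theorem cost_le_costAt (U : Finset V) : cost p C G ≤ costAt p C G U :=
  ciInf_le (OrderBot.bddBelow _) U

theorem exists_cost_eq (p : ℕ) (C : SimpleGraph κ) (G : SimpleGraph V) :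
    ∃ U, costAt p C G U = cost p C G :=
  Nat.sInf_mem (Set.range_nonempty _)

theorem cost_le : cost p C G ≤ numDarts G + numLive C G := by
  have := cost_le_costAt (p := p) (C := C) (G := G) ∅
  simpa [costAt] using this

/-- For each fixed `U`, more edges destroy live sets only at the price of at least as many new
darts. -/
theorem cost_mono [Nonempty κ] (hC : C.Connected) (h : G ≤ G') : cost p C G ≤ cost p C G' := by
  obtain ⟨U, hU⟩ := exists_cost_eq p C G'
  rw [← hU]
  exact (cost_le_costAt U).trans
    (Nat.add_le_add_left (numDarts_add_numLive_mono hC (cut_mono h U)) _)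

theorem cost_le_cut (U : Finset V) :
    cost p C G ≤ (2 * p + 3) * U.card + cost p C (cut G U) := by
  classical
  obtain ⟨U', hU'⟩ := exists_cost_eq p C (cut G U)
  rw [← hU']
  refine (cost_le_costAt (U ∪ U')).trans ?_
  unfold costAt
  rw [cut_cut]
  have := Nat.mul_le_mul_left (2 * p + 3) (Finset.card_union_le U U')
  rw [mul_add] at this
  omega

end Cut

/-! ### Two graphs glued along a common part -/

section Tri

variable {L X Y κ : Type*}

/-- The graph consisting of graphs on `L`, `X` and `Y` and bipartite graphs between `L` and each
of `X` and `Y`. -/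
def tri (HL : SimpleGraph L) (HX : SimpleGraph X) (HY : SimpleGraph Y) (FA : Finset (L × X))
    (FB : Finset (L × Y)) : SimpleGraph (L ⊕ (X ⊕ Y)) where
  Adj a b := match a, b with
    | Sum.inl l, Sum.inl l' => HL.Adj l l'
    | Sum.inl l, Sum.inr (Sum.inl x) => (l, x) ∈ FA
    | Sum.inl l, Sum.inr (Sum.inr y) => (l, y) ∈ FB
    | Sum.inr (Sum.inl x), Sum.inl l => (l, x) ∈ FA
    | Sum.inr (Sum.inr y), Sum.inl l => (l, y) ∈ FB
    | Sum.inr (Sum.inl x), Sum.inr (Sum.inl x') => HX.Adj x x'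
    | Sum.inr (Sum.inr y), Sum.inr (Sum.inr y') => HY.Adj y y'
    | Sum.inr (Sum.inl _), Sum.inr (Sum.inr _) => False
    | Sum.inr (Sum.inr _), Sum.inr (Sum.inl _) => False
  symm := ⟨by
    rintro (l | x | y) (l' | x' | y') h
    exacts [HL.adj_symm h, h, h, h, HX.adj_symm h, h, h, h, HY.adj_symm h]⟩
  loopless := ⟨by
    rintro (l | x | y) h
    exacts [HL.loopless.irrefl _ h, HX.loopless.irrefl _ h, HY.loopless.irrefl _ h]⟩

section
variable (HL : SimpleGraph L) (HX : SimpleGraph X) (HY : SimpleGraph Y) (FA : Finset (L × X))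
  (FB : Finset (L × Y))

@[simp] theorem tri_ll {l l' : L} :
    (tri HL HX HY FA FB).Adj (Sum.inl l) (Sum.inl l') ↔ HL.Adj l l' := Iff.rfl
@[simp] theorem tri_lx {l : L} {x : X} :
    (tri HL HX HY FA FB).Adj (Sum.inl l) (Sum.inr (Sum.inl x)) ↔ (l, x) ∈ FA := Iff.rfl
@[simp] theorem tri_ly {l : L} {y : Y} :
    (tri HL HX HY FA FB).Adj (Sum.inl l) (Sum.inr (Sum.inr y)) ↔ (l, y) ∈ FB := Iff.rfl
@[simp] theorem tri_xl {l : L} {x : X} :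
    (tri HL HX HY FA FB).Adj (Sum.inr (Sum.inl x)) (Sum.inl l) ↔ (l, x) ∈ FA := Iff.rfl
@[simp] theorem tri_yl {l : L} {y : Y} :
    (tri HL HX HY FA FB).Adj (Sum.inr (Sum.inr y)) (Sum.inl l) ↔ (l, y) ∈ FB := Iff.rfl
@[simp] theorem tri_xx {x x' : X} :
    (tri HL HX HY FA FB).Adj (Sum.inr (Sum.inl x)) (Sum.inr (Sum.inl x')) ↔ HX.Adj x x' := Iff.rfl
@[simp] theorem tri_yy {y y' : Y} :
    (tri HL HX HY FA FB).Adj (Sum.inr (Sum.inr y)) (Sum.inr (Sum.inr y')) ↔ HY.Adj y y' := Iff.rfl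
@[simp] theorem tri_xy {x : X} {y : Y} :
    (tri HL HX HY FA FB).Adj (Sum.inr (Sum.inl x)) (Sum.inr (Sum.inr y)) ↔ False := Iff.rfl
@[simp] theorem tri_yx {x : X} {y : Y} :
    (tri HL HX HY FA FB).Adj (Sum.inr (Sum.inr y)) (Sum.inr (Sum.inl x)) ↔ False := Iff.rfl

theorem sum_ite_mem_pair [Fintype L] [Fintype X] [DecidableEq L] [DecidableEq X]
    (F : Finset (L × X)) : (∑ l, ∑ x, if (l, x) ∈ F then 1 else 0) = F.card := by
  rw [← Finset.sum_product', Finset.univ_product_univ]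
  simp

theorem numDarts_tri [Fintype L] [Fintype X] [Fintype Y] :
    numDarts (tri HL HX HY FA FB) =
      numDarts HL + numDarts HX + numDarts HY + 2 * FA.card + 2 * FB.card := by
  classical
  have e1 := sum_ite_mem_pair FA
  have e2 := sum_ite_mem_pair FB
  have e1' := e1
  have e2' := e2
  rw [Finset.sum_comm] at e1' e2'
  unfold numDarts dartsIn
  simp only [Fintype.sum_sum_type, tri_ll, tri_lx, tri_ly, tri_xl, tri_yl, tri_xx, tri_yy, tri_xy,
    tri_yx, Finset.sum_add_distrib, if_false, Finset.sum_const_zero]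
  omega

end

variable {HL : SimpleGraph L} {HX : SimpleGraph X} {HY : SimpleGraph Y} {FA : Finset (L × X)}
  {FB : Finset (L × Y)} {C : SimpleGraph κ}

/-- The inclusion of `X`. -/
abbrev inX : X ↪ L ⊕ (X ⊕ Y) := Function.Embedding.inl.trans Function.Embedding.inr

/-- The inclusion of `Y`. -/
abbrev inY : Y ↪ L ⊕ (X ⊕ Y) := Function.Embedding.inr.trans Function.Embedding.inr

theorem CTree.map_left {P : Finset L} (h : CTree C HL P) :
    CTree C (tri HL HX HY FA FB) (P.map Function.Embedding.inl) :=
  h.transport Sum.inl (fun _ _ _ _ h => Sum.inl_injective h) (fun _ _ _ _ => Iff.rfl)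
    (by simp)

theorem CTree.map_inX {P : Finset X} (h : CTree C HX P) :
    CTree C (tri HL HX HY FA FB) (P.map inX) :=
  h.transport (fun x => Sum.inr (Sum.inl x)) (fun _ _ _ _ h => by simpa using h)
    (fun _ _ _ _ => Iff.rfl) (by simp)

theorem CTree.map_inY {P : Finset Y} (h : CTree C HY P) :
    CTree C (tri HL HX HY FA FB) (P.map inY) :=
  h.transport (fun x => Sum.inr (Sum.inr x)) (fun _ _ _ _ h => by simpa using h)
    (fun _ _ _ _ => Iff.rfl) (by simp)

/-- The edges of a bipartite graph meeting a set in one of the two parts. -/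
def touch [DecidableEq L] [DecidableEq X] (F : Finset (L × X)) :
    Finset L ⊕ Finset X → Finset (L × X) :=
  Sum.elim (fun P => F.filter fun q => q.1 ∈ P) (fun P => F.filter fun q => q.2 ∈ P)

/-- The live sets in the two parts. -/
noncomputable def members [Fintype L] [Fintype X] (C : SimpleGraph κ) (HL : SimpleGraph L)
    (HX : SimpleGraph X) : Finset (Finset L ⊕ Finset X) :=
  (liveSets C HL).disjSum (liveSets C HX)

/-- The number of members of a family minus the number of edges touching them. -/
def excess [DecidableEq L] [DecidableEq X] (F : Finset (L × X)) (S : Finset (Finset L ⊕ Finset X)) :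
    ℤ := S.card - (S.biUnion (touch F)).card

/-- This bounds the live sets of the glued graph from below. The members on `X`, those on `Y`, and
the members on `L` common to both families are disjoint trees of copies, and the edges leaving them
are among the touching edges. So `card_family_le` applies. -/
theorem excess_add_excess_le [Fintype L] [Fintype X] [Fintype Y] [DecidableEq L] [DecidableEq X]
    [DecidableEq Y] [Nonempty κ] (hC : C.Connected) {SA : Finset (Finset L ⊕ Finset X)}
    {SB : Finset (Finset L ⊕ Finset Y)} (hA : SA ⊆ members C HL HX) (hB : SB ⊆ members C HL HY) :
    excess FA SA + excess FB SB ≤ numLive C HL + numLive C (tri HL HX HY FA FB) := by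
  set f : Finset L ⊕ (Finset X ⊕ Finset Y) → Finset (L ⊕ (X ⊕ Y)) :=
    Sum.elim (fun P => P.map Function.Embedding.inl)
      (Sum.elim (fun P => P.map inX) (fun P => P.map inY)) with hf
  -- The two families have as many members on `L` as their intersection and union together. The
  -- union accounts for the term `numLive C HL`.
  set I := (SA.toLeft ∩ SB.toLeft).disjSum (SA.toRight.disjSum SB.toRight) with hI
  have hL : ∀ P ∈ SA.toLeft, Live C HL P := fun P hP => by
    have := hA (Finset.mem_toLeft.1 hP)
    simpa [members, mem_liveSets] using this
  have hX : ∀ P ∈ SA.toRight, Live C HX P := fun P hP => by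
    have := hA (Finset.mem_toRight.1 hP)
    simpa [members, mem_liveSets] using this
  have hL' : ∀ P ∈ SB.toLeft, Live C HL P := fun P hP => by
    have := hB (Finset.mem_toLeft.1 hP)
    simpa [members, mem_liveSets] using this
  have hY : ∀ P ∈ SB.toRight, Live C HY P := fun P hP => by
    have := hB (Finset.mem_toRight.1 hP)
    simpa [members, mem_liveSets] using this
  have hIT : ∀ i ∈ I, CTree C (tri HL HX HY FA FB) (f i) := by
    rintro (P | P | P) hi
    · simp only [hI, Finset.inl_mem_disjSum, Finset.mem_inter] at hi
      exact (hL P hi.1).1.map_left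
    · simp only [hI, Finset.inr_mem_disjSum, Finset.inl_mem_disjSum] at hi
      exact (hX P hi).1.map_inX
    · simp only [hI, Finset.inr_mem_disjSum] at hi
      exact (hY P hi).1.map_inY
  have hID : ∀ i ∈ I, ∀ j ∈ I, i ≠ j → Disjoint (f i) (f j) := by
    rintro (P | P | P) hi (Q | Q | Q) hj hne
    all_goals
      simp only [hI, Finset.inl_mem_disjSum, Finset.inr_mem_disjSum, Finset.mem_inter] at hi hj
      simp only [hf, Sum.elim_inl, Sum.elim_inr]
      rw [Finset.disjoint_left]
      intro v hv hv'
      obtain ⟨a, ha, rfl⟩ := Finset.mem_map.1 hv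
      obtain ⟨b, hb, hab⟩ := Finset.mem_map.1 hv'
      first
        | exact Sum.inl_ne_inr hab
        | exact Sum.inr_ne_inl hab
        | exact Sum.inl_ne_inr (Sum.inr_injective hab)
        | exact Sum.inr_ne_inl (Sum.inr_injective hab)
        | have hab' := Function.Embedding.injective _ hab
          subst hab'
    · exact hne (congrArg _ ((hL P hi.1).eq_of_mem hC (hL Q hj.1) ha hb))
    · exact hne (congrArg _ (congrArg _ ((hX P hi).eq_of_mem hC (hX Q hj) ha hb)))
    · exact hne (congrArg _ (congrArg _ ((hY P hi).eq_of_mem hC (hY Q hj) ha hb)))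
  have hinj : Set.InjOn f I := by
    intro i hi j hj hij
    by_contra hne
    have h1 := hID i hi j hj hne
    rw [hij, disjoint_self] at h1
    exact (hIT j hj).nonempty.ne_empty h1
  have hcard : (I.image f).card = I.card := Finset.card_image_of_injOn hinj
  set E : Finset (Sym2 (L ⊕ (X ⊕ Y))) :=
    (SA.biUnion (touch FA)).image (fun q => s(Sum.inl q.1, Sum.inr (Sum.inl q.2))) ∪
    (SB.biUnion (touch FB)).image (fun q => s(Sum.inl q.1, Sum.inr (Sum.inr q.2))) with hE
  have hEc : E.card ≤ (SA.biUnion (touch FA)).card + (SB.biUnion (touch FB)).card :=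
    (Finset.card_union_le _ _).trans (Nat.add_le_add Finset.card_image_le Finset.card_image_le)
  have hEA : ∀ (i : Finset L ⊕ Finset X) (l : L) (x : X), i ∈ SA → (l, x) ∈ touch FA i →
      s(Sum.inl l, Sum.inr (Sum.inl x)) ∈ E := fun i l x hi h =>
    Finset.mem_union_left _ (Finset.mem_image.2 ⟨(l, x), Finset.mem_biUnion.2 ⟨i, hi, h⟩, rfl⟩)
  have hEB : ∀ (i : Finset L ⊕ Finset Y) (l : L) (x : Y), i ∈ SB → (l, x) ∈ touch FB i →
      s(Sum.inl l, Sum.inr (Sum.inr x)) ∈ E := fun i l x hi h =>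
    Finset.mem_union_right _ (Finset.mem_image.2 ⟨(l, x), Finset.mem_biUnion.2 ⟨i, hi, h⟩, rfl⟩)
  have main := card_family_le (G := tri HL HX HY FA FB) _ (I.image f) E rfl (by
      intro P hP
      obtain ⟨i, hi, rfl⟩ := Finset.mem_image.1 hP
      exact hIT i hi) (by
      intro P hP Q hQ hPQ
      obtain ⟨i, hi, rfl⟩ := Finset.mem_image.1 hP
      obtain ⟨j, hj, rfl⟩ := Finset.mem_image.1 hQ
      exact hID i hi j hj fun h => hPQ (by rw [h])) (by
      intro P hP v hv b hb hadj
      obtain ⟨i, hi, rfl⟩ := Finset.mem_image.1 hP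
      rcases i with P | P | P
      all_goals
        simp only [hI, Finset.inl_mem_disjSum, Finset.inr_mem_disjSum, Finset.mem_inter] at hi
        simp only [hf, Sum.elim_inl, Sum.elim_inr] at hv hb
        obtain ⟨a, ha, rfl⟩ := Finset.mem_map.1 hv
      · rcases b with b | b | b
        · exact (hb (Finset.mem_map_of_mem _ ((hL P hi.1).2 a ha b hadj))).elim
        · exact hEA (Sum.inl P) a b (Finset.mem_toLeft.1 hi.1) (Finset.mem_filter.2 ⟨hadj, ha⟩)
        · exact hEB (Sum.inl P) a b (Finset.mem_toLeft.1 hi.2) (Finset.mem_filter.2 ⟨hadj, ha⟩)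
      · rcases b with b | b | b
        · rw [Sym2.eq_swap]
          exact hEA (Sum.inr P) b a (Finset.mem_toRight.1 hi) (Finset.mem_filter.2 ⟨hadj, ha⟩)
        · exact (hb (Finset.mem_map_of_mem inX ((hX P hi).2 a ha b hadj))).elim
        · exact hadj.elim
      · rcases b with b | b | b
        · rw [Sym2.eq_swap]
          exact hEB (Sum.inr P) b a (Finset.mem_toRight.1 hi) (Finset.mem_filter.2 ⟨hadj, ha⟩)
        · exact hadj.elim
        · exact (hb (Finset.mem_map_of_mem inY ((hY P hi).2 a ha b hadj))).elim)
  have c1 : I.card = (SA.toLeft ∩ SB.toLeft).card + (SA.toRight.card + SB.toRight.card) := by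
    rw [hI, Finset.card_disjSum, Finset.card_disjSum]
  have c2 : SA.toLeft.card + SA.toRight.card = SA.card := Finset.card_toLeft_add_card_toRight
  have c3 : SB.toLeft.card + SB.toRight.card = SB.card := Finset.card_toLeft_add_card_toRight
  have c4 : (SA.toLeft ∪ SB.toLeft).card + (SA.toLeft ∩ SB.toLeft).card
    = SA.toLeft.card + SB.toLeft.card := Finset.card_union_add_card_inter _ _
  have c5 : (SA.toLeft ∪ SB.toLeft).card ≤ numLive C HL :=
    Finset.card_le_card (Finset.union_subset (fun P hP => mem_liveSets.2 (hL P hP))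
      fun P hP => mem_liveSets.2 (hL' P hP))
  unfold excess
  omega

end Tri

/-! ### The cost of a doubled graph -/

section Doubling

variable {L X Y κ : Type*} {HL : SimpleGraph L} {HX : SimpleGraph X} {HY : SimpleGraph Y}
  {F : Finset (L × X)} {FA : Finset (L × X)} {FB : Finset (L × Y)} {C : SimpleGraph κ}

/-- An involutive automorphism with a fixed vertex is trivial if its moved vertices fall into two
halves, interchanged by it, without edges between them. -/
def SwapTrivial (C : SimpleGraph κ) : Prop :=
  ∀ (τ : κ → κ) (D : κ → Prop), (∀ i, τ (τ i) = i) → (∀ i j, C.Adj (τ i) (τ j) ↔ C.Adj i j) →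
    (∀ i, τ i ≠ i → (D i ↔ ¬ D (τ i))) →
    (∀ i j, τ i ≠ i → τ j ≠ j → D i → D j → ¬ C.Adj i (τ j)) → (∃ i, τ i = i) → ∀ i, τ i = i

/-- The involution interchanging the two copies of `X`. -/
def swapX : L ⊕ (X ⊕ X) → L ⊕ (X ⊕ X) := Sum.map id Sum.swap

theorem swapX_swapX (v : L ⊕ (X ⊕ X)) : swapX (swapX v) = v := by
  rcases v with l | x | x <;> rfl

theorem swapX_eq {v : L ⊕ (X ⊕ X)} (h : swapX v = v) : ∃ l, v = Sum.inl l := by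
  rcases v with l | x | x
  · exact ⟨l, rfl⟩
  · simp [swapX] at h
  · simp [swapX] at h

theorem tri_swapX (a b : L ⊕ (X ⊕ X)) :
    (tri HL HX HX F F).Adj (swapX a) (swapX b) ↔ (tri HL HX HX F F).Adj a b := by
  rcases a with l | x | x <;> rcases b with l' | x' | x' <;> exact Iff.rfl

/-- The two copies of `X` are the two halves in `SwapTrivial`: they are exchanged and no edge joins
them. This supplies the base case of `CTree.exists_fixed` for the reflection. -/
theorem SwapTrivial.copy (hC : SwapTrivial C) {P : Finset (L ⊕ (X ⊕ X))}
    (f : C ↪g tri HL HX HX F F) (hP : ∀ v, v ∈ P ↔ ∃ i, f i = v) (hσ : ∀ v ∈ P, swapX v ∈ P)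
    (hfix : ∃ v ∈ P, swapX v = v) : ∀ v ∈ P, swapX v = v := by
  have : ∀ i, ∃ j, f j = swapX (f i) := fun i => (hP _).1 (hσ _ ((hP _).2 ⟨i, rfl⟩))
  choose τ hτ using this
  have hiff : ∀ i, τ i = i ↔ swapX (f i) = f i := fun i => by
    rw [← hτ]
    exact ⟨fun h => by rw [h], fun h => f.injective h⟩
  have main := hC τ (fun i => ∃ x, f i = Sum.inr (Sum.inl x)) (fun i => f.injective (by
      rw [hτ, hτ, swapX_swapX])) (fun i j => by
      rw [← f.map_adj_iff, hτ, hτ, tri_swapX, f.map_adj_iff]) (fun i hi => by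
      rw [Ne, hiff] at hi
      rw [hτ]
      generalize f i = v at hi ⊢
      rcases v with l | x | x
      · exact (hi rfl).elim
      · simp [swapX]
      · simp [swapX]) (fun i j _ _ hi hj => by
      obtain ⟨x, hx⟩ := hi
      obtain ⟨y, hy⟩ := hj
      rw [← f.map_adj_iff, hτ, hx, hy]
      exact id) (by
      obtain ⟨v, hv, hvv⟩ := hfix
      obtain ⟨i, rfl⟩ := (hP v).1 hv
      exact ⟨i, (hiff i).2 hvv⟩)
  intro v hv
  obtain ⟨i, rfl⟩ := (hP v).1 hv
  exact (hiff i).1 (main i)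

/-- A connected set avoiding `L` cannot pass from `X` to `Y`. As it is closed, it is not touched by
`FA` either. -/
theorem exists_eq_map_inX [Nonempty κ] (hC : C.Connected) {P : Finset (L ⊕ (X ⊕ Y))}
    (h : Live C (tri HL HX HY FA FB) P) (hL : ∀ l, Sum.inl l ∉ P) {x : X}
    (hx : Sum.inr (Sum.inl x) ∈ P) :
    ∃ P', Live C HX P' ∧ (∀ q ∈ FA, q.2 ∉ P') ∧ P = P'.map inX := by
  classical
  have hall : ∀ v ∈ P, ∃ x, v = Sum.inr (Sum.inl x) := by
    by_contra hcon
    push Not at hcon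
    obtain ⟨w, hw, hw'⟩ := hcon
    obtain ⟨a, -, b, hb, ⟨x, rfl⟩, hbx, hab⟩ := h.1.exists_adj hC
      (Q := fun v => ∃ x, v = Sum.inr (Sum.inl x)) ⟨_, hx, x, rfl⟩ ⟨w, hw, fun ⟨x, hx⟩ => hw' x hx⟩
    rcases b with b | b | b
    · exact hL b hb
    · exact hbx ⟨b, rfl⟩
    · exact hab
  set g : L ⊕ (X ⊕ Y) → X := Sum.elim (fun _ => x) (Sum.elim id fun _ => x) with hg
  have hm : ∀ y, y ∈ P.image g ↔ Sum.inr (Sum.inl y) ∈ P := by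
    intro y
    rw [Finset.mem_image]
    constructor
    · rintro ⟨v, hv, rfl⟩
      obtain ⟨z, rfl⟩ := hall v hv
      exact hv
    · exact fun hy => ⟨_, hy, rfl⟩
  refine ⟨P.image g, ⟨h.1.transport g ?_ ?_ fun w => Finset.mem_image, ?_⟩, ?_, ?_⟩
  · intro a ha b hb hab
    obtain ⟨a, rfl⟩ := hall a ha
    obtain ⟨b, rfl⟩ := hall b hb
    exact congrArg (fun z => Sum.inr (Sum.inl z)) hab
  · intro a ha b hb
    obtain ⟨a, rfl⟩ := hall a ha
    obtain ⟨b, rfl⟩ := hall b hb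
    exact Iff.rfl
  · intro a ha b hab
    rw [hm] at ha ⊢
    exact h.2 _ ha _ hab
  · rintro ⟨l, y⟩ hq hy
    rw [hm] at hy
    exact hL l (h.2 _ hy (Sum.inl l) hq)
  · ext v
    rw [Finset.mem_map]
    constructor
    · intro hv
      obtain ⟨a, rfl⟩ := hall v hv
      exact ⟨a, (hm a).2 hv, rfl⟩
    · rintro ⟨a, ha, rfl⟩
      exact (hm a).1 ha

theorem exists_eq_map_inY [Nonempty κ] (hC : C.Connected) {P : Finset (L ⊕ (X ⊕ Y))}
    (h : Live C (tri HL HX HY FA FB) P) (hL : ∀ l, Sum.inl l ∉ P) {x : Y}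
    (hx : Sum.inr (Sum.inr x) ∈ P) :
    ∃ P', Live C HY P' ∧ (∀ q ∈ FB, q.2 ∉ P') ∧ P = P'.map inY := by
  classical
  -- Exchanging `X` and `Y` reduces this to `exists_eq_map_inX`.
  set s : L ⊕ (X ⊕ Y) → L ⊕ (Y ⊕ X) := Sum.map id Sum.swap with hs
  have hadj : ∀ a b, (tri HL HX HY FA FB).Adj a b ↔ (tri HL HY HX FB FA).Adj (s a) (s b) := by
    intro a b
    rcases a with a | a | a <;> rcases b with b | b | b <;> exact Iff.rfl
  have hinj : Function.Injective s := by
    rintro (a | a | a) (b | b | b) hab <;> simp_all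
  have hsurj : ∀ w, ∃ v, s v = w := by
    rintro (a | a | a)
    exacts [⟨Sum.inl a, rfl⟩, ⟨Sum.inr (Sum.inr a), rfl⟩, ⟨Sum.inr (Sum.inl a), rfl⟩]
  obtain ⟨P', h1, h2, h3⟩ := exists_eq_map_inX hC (P := P.map ⟨s, hinj⟩) (x := x) (HL := HL)
    (HX := HY) (HY := HX) (FA := FB) (FB := FA)
    ⟨h.1.transport s (fun a _ b _ h => hinj h) (fun a _ b _ => hadj a b) (by simp), by
      intro _ h' b hab
      obtain ⟨a, ha, rfl⟩ := Finset.mem_map.1 h'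
      obtain ⟨b, rfl⟩ := hsurj b
      exact Finset.mem_map_of_mem _ (h.2 a ha b ((hadj a b).2 hab))⟩ (by
      intro l hl
      obtain ⟨a, ha, hal⟩ := Finset.mem_map.1 hl
      rcases a with a | a | a
      · exact hL a ha
      · exact Sum.inr_ne_inl hal
      · exact Sum.inr_ne_inl hal) (Finset.mem_map.2 ⟨_, hx, rfl⟩)
  refine ⟨P', h1, h2, ?_⟩
  ext v
  have h4 : v ∈ P ↔ s v ∈ P.map ⟨s, hinj⟩ := (Finset.mem_map' (⟨s, hinj⟩ : _ ↪ _)).symm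
  rw [h4, h3]
  rcases v with v | v | v <;> simp [hs]

/-- The live sets of a doubled graph when no live set of the common part is touched by edges to
the doubled part. -/
theorem numLive_double_le [Fintype L] [Fintype X] [Fintype κ] [Nonempty κ] [DecidableEq L]
    [DecidableEq X] (hC : C.Connected) (hs : SwapTrivial C)
    (hF : ∀ P, Live C HL P → touch F (Sum.inl P) = ∅) :
    numLive C (tri HL HX HX F F) ≤ numLive C HL +
      2 * ((liveSets C HX).filter fun P => touch F (Sum.inr P) = ∅).card := by
  set Z := (liveSets C HX).filter fun P => touch F (Sum.inr P) = ∅ with hZ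
  have hsub : liveSets C (tri HL HX HX F F) ⊆
      (liveSets C HL).image (fun P => P.map Function.Embedding.inl) ∪
        (Z.image (fun P => P.map inX) ∪ Z.image (fun P => P.map inY)) := by
    intro P hP
    rw [mem_liveSets] at hP
    rw [Finset.mem_union, Finset.mem_union]
    by_cases hl : ∃ l, Sum.inl l ∈ P
    · left
      obtain ⟨l, hl⟩ := hl
      have hinj : Function.Injective (swapX : L ⊕ (X ⊕ X) → _) :=
        Function.LeftInverse.injective swapX_swapX
      have hlive : Live C (tri HL HX HX F F) (P.image swapX) := by
        refine ⟨hP.1.transport swapX (fun a _ b _ h => hinj h)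
          (fun a _ b _ => (tri_swapX a b).symm) (fun w => Finset.mem_image), ?_⟩
        intro _ h' b hab
        obtain ⟨a, ha, rfl⟩ := Finset.mem_image.1 h'
        rw [← swapX_swapX b, tri_swapX] at hab
        exact Finset.mem_image.2 ⟨_, hP.2 a ha _ hab, swapX_swapX b⟩
      -- The reflected set is live too and shares the fixed vertex `l` with `P`.
      have heq : P.image swapX = P := hlive.eq_of_mem hC hP
        (Finset.mem_image.2 ⟨Sum.inl l, hl, rfl⟩) hl
      obtain ⟨E, hE, hlE, hEf, hEc⟩ := CTree.exists_fixed hC swapX_swapX tri_swapX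
        (fun P f h1 h2 h3 => hs.copy f h1 h2 h3) _ P rfl hP.1 (fun v hv => by
          rw [← heq]
          exact Finset.mem_image_of_mem _ hv) (Sum.inl l) hl rfl
      have hEl : ∀ v ∈ E, ∃ l, v = Sum.inl l := fun v hv => swapX_eq (hEf v hv).2
      set g : L ⊕ (X ⊕ X) → L := Sum.elim id (fun _ => l) with hg
      have hm : ∀ y, y ∈ E.image g ↔ Sum.inl y ∈ E := by
        intro y
        rw [Finset.mem_image]
        constructor
        · rintro ⟨v, hv, rfl⟩
          obtain ⟨z, rfl⟩ := hEl v hv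
          exact hv
        · exact fun hy => ⟨_, hy, rfl⟩
      have hEL : Live C HL (E.image g) := by
        refine ⟨hE.transport g ?_ ?_ fun w => Finset.mem_image, ?_⟩
        · intro a ha b hb hab
          obtain ⟨a, rfl⟩ := hEl a ha
          obtain ⟨b, rfl⟩ := hEl b hb
          exact congrArg Sum.inl hab
        · intro a ha b hb
          obtain ⟨a, rfl⟩ := hEl a ha
          obtain ⟨b, rfl⟩ := hEl b hb
          exact Iff.rfl
        · intro a ha b hab
          rw [hm] at ha ⊢
          exact hEc _ ha _ (hP.2 _ (hEf _ ha).1 (Sum.inl b) hab) rfl hab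
      -- The fixed part `E` is live in `HL`, so by assumption no edge of `F` leaves it. It is closed
      -- in the doubled graph and hence is all of `P`.
      have hno : ∀ l' x, Sum.inl l' ∈ E → (l', x) ∉ F := by
        intro l' x hl' hmem
        have : (l', x) ∈ touch F (Sum.inl (E.image g)) :=
          Finset.mem_filter.2 ⟨hmem, (hm l').2 hl'⟩
        rw [hF _ hEL] at this
        simp at this
      have hEcl : ∀ a ∈ E, ∀ b, (tri HL HX HX F F).Adj a b → b ∈ E := by
        intro a ha b hab
        obtain ⟨a, rfl⟩ := hEl a ha
        rcases b with b | b | b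
        · exact hEc _ ha _ (hP.2 _ (hEf _ ha).1 _ hab) rfl hab
        · exact (hno _ _ ha hab).elim
        · exact (hno _ _ ha hab).elim
      have hPE : P = E := (hP.1.subset_of_closed hC hEcl hl hlE).antisymm fun v hv => (hEf v hv).1
      refine Finset.mem_image.2 ⟨E.image g, mem_liveSets.2 hEL, ?_⟩
      rw [hPE]
      ext v
      rw [Finset.mem_map]
      constructor
      · rintro ⟨a, ha, rfl⟩
        exact (hm a).1 ha
      · intro hv
        obtain ⟨a, rfl⟩ := hEl v hv
        exact ⟨a, (hm a).2 hv, rfl⟩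
    · right
      push Not at hl
      have htouch : ∀ P' : Finset X, (∀ q ∈ F, q.2 ∉ P') → touch F (Sum.inr P') = ∅ := by
        intro P' h
        exact Finset.filter_eq_empty_iff.2 fun q hq => h q hq
      obtain ⟨v, hv⟩ := hP.1.nonempty
      rcases v with v | v | v
      · exact (hl v hv).elim
      · left
        obtain ⟨P', h1, h2, h3⟩ := exists_eq_map_inX hC hP hl hv
        exact Finset.mem_image.2 ⟨P', Finset.mem_filter.2 ⟨mem_liveSets.2 h1, htouch _ h2⟩, h3.symm⟩
      · right
        obtain ⟨P', h1, h2, h3⟩ := exists_eq_map_inY hC hP hl hv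
        exact Finset.mem_image.2 ⟨P', Finset.mem_filter.2 ⟨mem_liveSets.2 h1, htouch _ h2⟩, h3.symm⟩
  have h1 := Finset.card_le_card hsub
  have h2 := Finset.card_union_le ((liveSets C HL).image fun P =>
    P.map (Function.Embedding.inl : L ↪ L ⊕ (X ⊕ X)))
    (Z.image (fun P => P.map (inX : X ↪ L ⊕ (X ⊕ X))) ∪ Z.image (fun P => P.map inY))
  have h3 := Finset.card_union_le (Z.image (fun P => P.map (inX : X ↪ L ⊕ (X ⊕ X))))
    (Z.image (fun P => P.map inY))
  have h4 := Finset.card_image_le (s := liveSets C HL)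
    (f := fun P => P.map (Function.Embedding.inl : L ↪ L ⊕ (X ⊕ X)))
  have h5 := Finset.card_image_le (s := Z) (f := fun P => P.map (inX : X ↪ L ⊕ (X ⊕ X)))
  have h6 := Finset.card_image_le (s := Z) (f := fun P => P.map (inY : X ↪ L ⊕ (X ⊕ X)))
  unfold numLive
  omega

theorem numDarts_cut_singleton [Fintype L] [DecidableEq L] (l : L) (N : Finset L)
    (hN : ∀ v, v ∈ N ↔ HL.Adj l v) : numDarts HL = numDarts (cut HL {l}) + 2 * N.card := by
  classical
  have h1 : ∀ a b : L, (if HL.Adj a b then 1 else 0) = (if (cut HL {l}).Adj a b then 1 else 0)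
      + ((if a = l then (if b ∈ N then 1 else 0) else 0)
        + (if b = l then (if a ∈ N then 1 else 0) else 0)) := by
    intro a b
    simp only [cut_adj, Finset.mem_singleton, hN]
    by_cases ha : a = l <;> by_cases hb : b = l
    · subst ha; subst hb; simp
    · subst ha; simp [hb]
    · subst hb; simp [ha, HL.adj_comm]
    · simp [ha, hb]
  unfold numDarts dartsIn
  simp_rw [h1, Finset.sum_add_distrib]
  have h2 : (∑ a, ∑ b, if a = l then (if b ∈ N then 1 else 0) else 0) = N.card := by
    rw [Finset.sum_comm]
    simp
  have h3 : (∑ a, ∑ b, if b = l then (if a ∈ N then 1 else 0) else 0) = N.card := by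
    simp
  omega

/-- Bound for the cost of a doubled graph in terms of the excesses of families of live sets. -/
theorem cost_double_le [Fintype L] [Fintype X] [Fintype κ] [Nonempty κ] [DecidableEq L]
    [DecidableEq X] {p : ℕ} (hC : C.Connected) (hs : SwapTrivial C) (h2 : 2 ≤ Fintype.card κ)
    (hp : ∀ i, ∃ s : Finset κ, p ≤ s.card ∧ ∀ j ∈ s, C.Adj i j) :
    ∀ (N : ℕ) (HL : SimpleGraph L) (F : Finset (L × X)), F.card = N → ∀ T : ℤ,
      (∀ S ⊆ members C HL HX, excess F S ≤ T) →
      (cost p C (tri HL HX HX F F) : ℤ) ≤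
        numDarts (tri HL HX HX F F) + 2 * T - numLive C HL := by
  intro N
  induction N using Nat.strong_induction_on with
  | _ N IH =>
  intro HL F hFN T hT
  by_cases hF : ∀ P, Live C HL P → touch F (Sum.inl P) = ∅
  · have h3 := numLive_double_le (HX := HX) hC hs hF
    set Z := (liveSets C HX).filter fun P => touch F (Sum.inr P) = ∅ with hZ
    -- No edge of `F` touches this family, so its excess is its size, and `T` is at least `numLive C
    -- HL + Z.card`. Then `2 * T - numLive C HL` dominates the bound for the live sets of the
    -- doubled graph, and nothing has to be deleted.
    have h4 := hT ((liveSets C HL).disjSum Z) (Finset.disjSum_mono subset_rfl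
      (Finset.filter_subset _ _))
    have h5 : ((liveSets C HL).disjSum Z).biUnion (touch F) = ∅ := by
      ext q
      simp only [Finset.mem_biUnion, Finset.notMem_empty, iff_false, not_exists, not_and]
      rintro (P | P) hP
      · rw [Finset.inl_mem_disjSum, mem_liveSets] at hP
        rw [hF P hP]
        simp
      · rw [Finset.inr_mem_disjSum, hZ, Finset.mem_filter] at hP
        rw [hP.2]
        simp
    have h6 := cost_le (p := p) (C := C) (G := tri HL HX HX F F)
    unfold excess at h4
    rw [h5, Finset.card_disjSum, Finset.card_empty] at h4
    have h7 : (liveSets C HL).card = numLive C HL := rfl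
    omega
  · push Not at hF
    obtain ⟨P, hP, htP⟩ := hF
    have hPm : Sum.inl P ∈ members C HL HX := by
      simpa [members, mem_liveSets] using hP
    -- Some live set `P` of `HL` is touched. The parts of its touching edges are those at a single
    -- vertex of `P`; supermodularity yields a vertex `l` whose deletion raises the maximal excess
    -- of the remaining members only a little.
    obtain ⟨l, hlP, hAne, hl⟩ := exists_part_excess_le (N := touch F) hT hPm htP
      (I := P) (A := fun l => F.filter fun q => q.1 = l) (by
        intro q hq
        obtain ⟨h1, h2⟩ := Finset.mem_filter.1 hq
        exact ⟨q.1, h2, Finset.mem_filter.2 ⟨h1, rfl⟩⟩)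
    set A := F.filter fun q => q.1 = l with hA
    set F' := F.filter fun q => q.1 ≠ l with hF'
    set HL' := cut HL {l} with hHL'
    have hFc : A.card + F'.card = F.card := Finset.card_filter_add_card_filter_not _
    have hA1 : 1 ≤ A.card := hAne.card_pos
    obtain ⟨Q, hQP, hQl, hQp, hQm⟩ := hP.1.exists_neighbors hC hp l hlP
    classical
    set B := (Finset.univ : Finset L).filter fun v => HL.Adj l v with hB
    have hBm : ∀ v, v ∈ B ↔ HL.Adj l v := fun v => by simp [hB]
    have hQB : Q ⊆ B := fun v hv => (hBm v).2 (hQl v hv)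
    have hdarts := numDarts_cut_singleton l B hBm
    rw [← hHL'] at hdarts
    have hpq : p ≤ B.card := hQp.trans (Finset.card_le_card hQB)
    have hlnot : ∀ P', Live C HL' P' → l ∉ P' := by
      intro P' hP' hlP'
      obtain ⟨w, -, hw⟩ := Live.exists_mem_adj hC h2 hP'.1 hlP'
      simp [hHL'] at hw
    -- Live sets not contained in `P` existed before the deletion of the edges at `l`.
    have hout : ∀ P', Live C HL' P' → ¬ P' ⊆ P → P' ∈ (liveSets C HL).erase P := by
      intro P' hP' hsub
      have hdisj : ∀ v ∈ P', v ∉ P := by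
        intro v hv hvP
        refine hsub (hP'.1.subset_of_closed hC (fun a ha b hab => hP.2 a ha b hab.1) hv hvP)
      rw [Finset.mem_erase, mem_liveSets]
      refine ⟨fun h => hsub h.subset, hP'.1.congr_graph fun a ha b hb => ?_, fun a ha b hab => ?_⟩
      · simp only [hHL', cut_adj, Finset.mem_singleton]
        refine ⟨fun h => h.1, fun h => ⟨h, ?_, ?_⟩⟩
        · rintro rfl
          exact hlnot P' hP' ha
        · rintro rfl
          exact hlnot P' hP' hb
      · refine hP'.2 a ha b ?_
        simp only [hHL', cut_adj, Finset.mem_singleton]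
        refine ⟨hab, ?_, ?_⟩
        · rintro rfl
          exact hlnot P' hP' ha
        · rintro rfl
          exact hdisj a ha (hP.2 _ hlP _ hab.symm)
    have hm0 : numLive C HL ≤ numLive C HL' + 1 := by
      have : (liveSets C HL).erase P ⊆ liveSets C HL' := by
        intro P' hP'
        rw [Finset.mem_erase, mem_liveSets] at hP'
        have hlP' : l ∉ P' := fun h => hP'.1 (hP'.2.eq_of_mem hC hP h hlP)
        rw [mem_liveSets]
        refine ⟨hP'.2.1.congr_graph fun a ha b hb => ?_, fun a ha b hab => hP'.2.2 a ha b hab.1⟩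
        simp only [hHL', cut_adj, Finset.mem_singleton]
        refine ⟨fun h => ⟨h, ?_, ?_⟩, fun h => h.1⟩
        · rintro rfl
          exact hlP' ha
        · rintro rfl
          exact hlP' hb
      have h8 := Finset.card_le_card this
      have h9 := Finset.card_erase_add_one (mem_liveSets.2 hP)
      unfold numLive
      omega
    -- The old members are bounded by the choice of `l`. At most `B.card - p` new live sets can
    -- arise inside `P`.
    have hT' : ∀ S ⊆ members C HL' HX, excess F' S ≤ T + A.card - 1 + (B.card - p) := by
      intro S hS
      have hSL : ∀ P', Sum.inl P' ∈ S → Live C HL' P' := fun P' h => by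
        simpa [members, mem_liveSets] using hS h
      set S2 := S.filter fun e => ∃ P', e = Sum.inl P' ∧ P' ⊆ P with hS2
      set S1 := S.filter fun e => ¬ ∃ P', e = Sum.inl P' ∧ P' ⊆ P with hS1
      have hSc : S2.card + S1.card = S.card := Finset.card_filter_add_card_filter_not _
      have hS1m : S1 ⊆ (members C HL HX).erase (Sum.inl P) := by
        rintro (P' | P') hP'
        · obtain ⟨h8, h9⟩ := Finset.mem_filter.1 hP'
          have := hout P' (hSL P' h8) fun h => h9 ⟨P', rfl, h⟩
          rw [Finset.mem_erase] at this ⊢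
          exact ⟨fun h => this.1 (Sum.inl_injective h), by simpa [members] using this.2⟩
        · have := hS (Finset.mem_filter.1 hP').1
          rw [Finset.mem_erase]
          exact ⟨Sum.inr_ne_inl, by simpa [members] using this⟩
      -- `P` is connected, so each new live set in it contains a neighbor of `l`. That neighbor is
      -- not in `Q`, since `Q` is reached only from parts whose size is not divisible by that of
      -- `C`. Disjointness makes the assignment injective.
      have hS2c : S2.card ≤ (B \ Q).card := by
        refine Finset.card_le_card_of_forall_subsingleton
          (fun e v => ∀ P', e = Sum.inl P' → v ∈ P') ?_ ?_
        · intro e he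
          obtain ⟨heS, P', rfl, hP'P⟩ := Finset.mem_filter.1 he
          have hP' := hSL P' heS
          have hl' := hlnot P' hP'
          obtain ⟨w, hw⟩ := hP'.1.nonempty
          obtain ⟨a, -, b, hb, haP', hbP', hab⟩ := hP.1.exists_adj hC (Q := fun v => v ∈ P')
            ⟨w, hP'P hw, hw⟩ ⟨l, hlP, hl'⟩
          have hcl : ∀ a ∈ P', ∀ b ∈ P, b ≠ l → HL.Adj a b → b ∈ P' := by
            intro a ha b _ hbl hab
            refine hP'.2 a ha b ?_
            simp only [hHL', cut_adj, Finset.mem_singleton]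
            exact ⟨hab, fun h => hl' (h ▸ ha), hbl⟩
          have hbl : b = l := by
            by_contra hbl
            exact hbP' (hcl a haP' b hb hbl hab)
          subst hbl
          refine ⟨a, Finset.mem_sdiff.2 ⟨(hBm a).2 hab.symm, fun haQ => ?_⟩, fun P'' h => ?_⟩
          · exact hQm P' hP'P hl' hcl ⟨a, haP', haQ⟩ hP'.1.dvd_card
          · rw [← Sum.inl_injective h]
            exact haP'
        · rintro v - e ⟨he, hve⟩ e' ⟨he', hve'⟩
          obtain ⟨heS, P', rfl, -⟩ := Finset.mem_filter.1 he
          obtain ⟨heS', P'', rfl, -⟩ := Finset.mem_filter.1 he'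
          rw [(hSL P' heS).eq_of_mem hC (hSL P'' heS') (hve P' rfl) (hve' P'' rfl)]
      have hBQ : (B \ Q).card + Q.card = B.card := Finset.card_sdiff_add_card_eq_card hQB
      have h10 := hl S1 hS1m
      have h11 : (S1.biUnion (touch F) \ A).card ≤ (S.biUnion (touch F')).card := by
        refine Finset.card_le_card fun q hq => ?_
        obtain ⟨hq1, hq2⟩ := Finset.mem_sdiff.1 hq
        obtain ⟨e, he, hqe⟩ := Finset.mem_biUnion.1 hq1
        refine Finset.mem_biUnion.2 ⟨e, (Finset.mem_filter.1 he).1, ?_⟩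
        have hql : q ∈ F → q.1 ≠ l := fun h1 h2 => hq2 (Finset.mem_filter.2 ⟨h1, h2⟩)
        rcases e with e | e
        · obtain ⟨h1, h2⟩ := Finset.mem_filter.1 hqe
          exact Finset.mem_filter.2 ⟨Finset.mem_filter.2 ⟨h1, hql h1⟩, h2⟩
        · obtain ⟨h1, h2⟩ := Finset.mem_filter.1 hqe
          exact Finset.mem_filter.2 ⟨Finset.mem_filter.2 ⟨h1, hql h1⟩, h2⟩
      unfold excess
      omega
    have hIH := IH F'.card (by omega) HL' F' rfl _ hT'
    have hcut : cut (tri HL HX HX F F) {Sum.inl l} = tri HL' HX HX F' F' := by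
      ext a b
      rcases a with a | a | a <;> rcases b with b | b | b <;>
        simp [hHL', hF', Finset.mem_filter]
    -- Deleting at `l` costs `2p + 3` and removes `2|B|` darts in `HL` and `4|A|` darts from the two
    -- copies of `F`. The bound on the excess, which counts twice, grows by `|A| - 1 + |B| - p`, and
    -- at most one live set of `HL` is lost. The net change is at most `2 - 2|A|`, which is not
    -- positive because `A` is nonempty. This is where `2p + 3` is just small enough.
    have hc := cost_le_cut (p := p) (C := C) (G := tri HL HX HX F F) {Sum.inl l}
    rw [hcut, Finset.card_singleton] at hc
    rw [numDarts_tri] at hIH ⊢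
    push_cast at hIH ⊢
    omega

end Doubling

/-! ### Cauchy-Schwarz for the cost -/

section Glue

variable {L X Y κ : Type*}

/-- Glue two graphs along the common part `L` of their vertex sets. -/
def glue (A : SimpleGraph (L ⊕ X)) (B : SimpleGraph (L ⊕ Y)) : SimpleGraph (L ⊕ (X ⊕ Y)) :=
  A.map (Sum.map id Sum.inl) ⊔ B.map (Sum.map id Sum.inr)

section
variable (A : SimpleGraph (L ⊕ X)) (B : SimpleGraph (L ⊕ Y))

@[simp] theorem glue_ll {l l' : L} : (glue A B).Adj (Sum.inl l) (Sum.inl l') ↔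
    A.Adj (Sum.inl l) (Sum.inl l') ∨ B.Adj (Sum.inl l) (Sum.inl l') := by
  simp only [glue, sup_adj, map_adj', Sum.exists, Sum.map_inl, Sum.map_inr, id]
  have h1 := A.ne_of_adj (a := Sum.inl l) (b := Sum.inl l')
  have h2 := B.ne_of_adj (a := Sum.inl l) (b := Sum.inl l')
  simp
  aesop
@[simp] theorem glue_lx {l : L} {x : X} : (glue A B).Adj (Sum.inl l) (Sum.inr (Sum.inl x)) ↔
    A.Adj (Sum.inl l) (Sum.inr x) := by
  simp [glue, map_adj', Sum.exists]
@[simp] theorem glue_ly {l : L} {y : Y} : (glue A B).Adj (Sum.inl l) (Sum.inr (Sum.inr y)) ↔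
    B.Adj (Sum.inl l) (Sum.inr y) := by
  simp [glue, map_adj', Sum.exists]
@[simp] theorem glue_xl {l : L} {x : X} : (glue A B).Adj (Sum.inr (Sum.inl x)) (Sum.inl l) ↔
    A.Adj (Sum.inr x) (Sum.inl l) := by
  simp [glue, map_adj', Sum.exists]
@[simp] theorem glue_yl {l : L} {y : Y} : (glue A B).Adj (Sum.inr (Sum.inr y)) (Sum.inl l) ↔
    B.Adj (Sum.inr y) (Sum.inl l) := by
  simp [glue, map_adj', Sum.exists]
@[simp] theorem glue_xx {x x' : X} :
    (glue A B).Adj (Sum.inr (Sum.inl x)) (Sum.inr (Sum.inl x')) ↔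
    A.Adj (Sum.inr x) (Sum.inr x') := by
  have h1 := A.ne_of_adj (a := Sum.inr x) (b := Sum.inr x')
  simp [glue, map_adj', Sum.exists]
  aesop
@[simp] theorem glue_yy {y y' : Y} :
    (glue A B).Adj (Sum.inr (Sum.inr y)) (Sum.inr (Sum.inr y')) ↔
    B.Adj (Sum.inr y) (Sum.inr y') := by
  have h1 := B.ne_of_adj (a := Sum.inr y) (b := Sum.inr y')
  simp [glue, map_adj', Sum.exists]
  aesop
@[simp] theorem glue_xy {x : X} {y : Y} :
    (glue A B).Adj (Sum.inr (Sum.inl x)) (Sum.inr (Sum.inr y)) ↔ False := by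
  simp [glue, map_adj', Sum.exists]
@[simp] theorem glue_yx {x : X} {y : Y} :
    (glue A B).Adj (Sum.inr (Sum.inr y)) (Sum.inr (Sum.inl x)) ↔ False := by
  simp [glue, map_adj', Sum.exists]

end

variable [Fintype L] [Fintype X] [Fintype Y] [Fintype κ] {C : SimpleGraph κ} {p : ℕ}

theorem cut_tri [DecidableEq L] [DecidableEq X] [DecidableEq Y] (HL : SimpleGraph L)
    (HX : SimpleGraph X) (HY : SimpleGraph Y) (FA : Finset (L × X)) (FB : Finset (L × Y))
    (UL : Finset L) (UX : Finset X) (UY : Finset Y) :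
    cut (tri HL HX HY FA FB) (UL.disjSum (UX.disjSum UY)) =
      tri (cut HL UL) (cut HX UX) (cut HY UY) (FA.filter fun q => q.1 ∉ UL ∧ q.2 ∉ UX)
        (FB.filter fun q => q.1 ∉ UL ∧ q.2 ∉ UY) := by
  ext a b
  rcases a with a | a | a <;> rcases b with b | b | b <;> simp [Finset.mem_filter]
  all_goals tauto

theorem exists_excess_max [DecidableEq L] [DecidableEq X] (C : SimpleGraph κ) (HL : SimpleGraph L)
    (HX : SimpleGraph X) (F : Finset (L × X)) :
    ∃ S ⊆ members C HL HX, ∀ S' ⊆ members C HL HX, excess F S' ≤ excess F S := by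
  obtain ⟨S, hS, hmax⟩ := Finset.exists_max_image (members C HL HX).powerset (excess F)
    ⟨∅, Finset.empty_mem_powerset _⟩
  exact ⟨S, Finset.mem_powerset.1 hS, fun S' h => hmax S' (Finset.mem_powerset.2 h)⟩

/-- The conditions on the graph `C` under which the cost is feasible. -/
structure Admissible (p : ℕ) (C : SimpleGraph κ) : Prop where
  connected : C.Connected
  swapTrivial : SwapTrivial C
  two_le : 2 ≤ Fintype.card κ
  le_degree : ∀ i, ∃ s : Finset κ, p ≤ s.card ∧ ∀ j ∈ s, C.Adj i j

/-- Apply an optimal deletion set for the mixed graph to both doubled graphs. The darts balance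
exactly. With maximal excesses `T_A` and `T_B`, the doubled graphs contribute `2(T_A + T_B)` minus
twice `numLive C HL`, which is at most twice the number of live sets of the mixed graph. -/
theorem cost_tri [DecidableEq L] [DecidableEq X] [DecidableEq Y] (hC : Admissible p C)
    (HL : SimpleGraph L) (HX : SimpleGraph X) (HY : SimpleGraph Y) (FA : Finset (L × X))
    (FB : Finset (L × Y)) :
    cost p C (tri HL HX HX FA FA) + cost p C (tri HL HY HY FB FB) ≤
      2 * cost p C (tri HL HX HY FA FB) := by
  obtain ⟨hc, hs, h2, hp⟩ := hC
  have : Nonempty κ := hc.nonempty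
  obtain ⟨U, hU⟩ := exists_cost_eq p C (tri HL HX HY FA FB)
  obtain ⟨UL, UX, UY, rfl⟩ : ∃ (UL : Finset L) (UX : Finset X) (UY : Finset Y),
      U = UL.disjSum (UX.disjSum UY) :=
    ⟨U.toLeft, U.toRight.toLeft, U.toRight.toRight, by
      rw [Finset.toLeft_disjSum_toRight, Finset.toLeft_disjSum_toRight]⟩
  have hA := cost_le_cut (p := p) (C := C) (G := tri HL HX HX FA FA) (UL.disjSum (UX.disjSum UX))
  have hB := cost_le_cut (p := p) (C := C) (G := tri HL HY HY FB FB) (UL.disjSum (UY.disjSum UY))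
  unfold costAt at hU
  rw [cut_tri] at hU hA hB
  set HL' := cut HL UL
  set HX' := cut HX UX
  set HY' := cut HY UY
  set FA' := FA.filter fun q => q.1 ∉ UL ∧ q.2 ∉ UX
  set FB' := FB.filter fun q => q.1 ∉ UL ∧ q.2 ∉ UY
  obtain ⟨SA, hSA, hmA⟩ := exists_excess_max C HL' HX' FA'
  obtain ⟨SB, hSB, hmB⟩ := exists_excess_max C HL' HY' FB'
  have h3 := excess_add_excess_le (FA := FA') (FB := FB') hc hSA hSB
  have h4 := cost_double_le hc hs h2 hp _ HL' FA' rfl _ hmA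
  have h5 := cost_double_le hc hs h2 hp _ HL' FB' rfl _ hmB
  rw [numDarts_tri] at hU h4 h5
  rw [Finset.card_disjSum, Finset.card_disjSum] at hU hA hB
  rw [← hU]
  push_cast at h4 h5
  simp only [mul_add] at hU hA hB ⊢
  omega

/-- On the labels, `glue A A` carries only the edges of `A`, whereas the mixed graph carries those
of both. Adding the missing edges reduces this to `cost_tri`, by monotonicity of the cost. -/
theorem cost_glue (hC : Admissible p C) (A : SimpleGraph (L ⊕ X)) (B : SimpleGraph (L ⊕ Y)) :
    cost p C (glue A A) + cost p C (glue B B) ≤ 2 * cost p C (glue A B) := by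
  classical
  have : Nonempty κ := hC.connected.nonempty
  set HL := A.comap Sum.inl ⊔ B.comap Sum.inl
  set FA := (Finset.univ : Finset (L × X)).filter fun q => A.Adj (Sum.inl q.1) (Sum.inr q.2)
  set FB := (Finset.univ : Finset (L × Y)).filter fun q => B.Adj (Sum.inl q.1) (Sum.inr q.2)
  have e : glue A B = tri HL (A.comap Sum.inr) (B.comap Sum.inr) FA FB := by
    ext a b
    rcases a with a | a | a <;> rcases b with b | b | b <;>
      simp [HL, FA, FB, adj_comm]
  have eA : glue A A ≤ tri HL (A.comap Sum.inr) (A.comap Sum.inr) FA FA := by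
    intro a b
    rcases a with a | a | a <;> rcases b with b | b | b <;>
      simp [HL, FA, adj_comm]
    exact Or.inl
  have eB : glue B B ≤ tri HL (B.comap Sum.inr) (B.comap Sum.inr) FB FB := by
    intro a b
    rcases a with a | a | a <;> rcases b with b | b | b <;>
      simp [HL, FB, adj_comm]
    exact Or.inr
  rw [e]
  exact (Nat.add_le_add (cost_mono hC.connected eA) (cost_mono hC.connected eB)).trans
    (cost_tri hC _ _ _ _ _)

end Glue

/-! ### The exponent -/

section Expo

variable {V W κ : Type*}

/-- No edge joins `D` to its complement. -/
def IsClosedIn (G : SimpleGraph V) (D : Finset V) : Prop := ∀ a ∈ D, ∀ b, G.Adj a b → b ∈ D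

open Classical in
/-- The number of non-isolated vertices in `D`. -/
noncomputable def suppCard (G : SimpleGraph V) (D : Finset V) : ℕ :=
  ∑ v ∈ D, if ∃ w, G.Adj v w then 1 else 0

variable [Fintype V] [Fintype W] [Fintype κ]

/-- The exponent when the cost is used outside the closed set `D`, and inside it the number of
vertices. -/
noncomputable def expoAt (p : ℕ) (C : SimpleGraph κ) (G : SimpleGraph V) (D : Finset V) : ℕ :=
  Fintype.card κ * cost p C (cut G D) + (numDarts C + 1) * suppCard G D

/-- The exponent of a graph. -/
noncomputable def expo (p : ℕ) (C : SimpleGraph κ) (G : SimpleGraph V) : ℕ :=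
  ⨅ D : {D : Finset V // IsClosedIn G D}, expoAt p C G D

variable {p : ℕ} {C : SimpleGraph κ} {G G' : SimpleGraph V}

theorem expo_le {D : Finset V} (h : IsClosedIn G D) : expo p C G ≤ expoAt p C G D :=
  ciInf_le (OrderBot.bddBelow _) (⟨D, h⟩ : {D : Finset V // IsClosedIn G D})

theorem exists_expo_eq (p : ℕ) (C : SimpleGraph κ) (G : SimpleGraph V) :
    ∃ D, IsClosedIn G D ∧ expoAt p C G D = expo p C G := by
  have : Nonempty {D : Finset V // IsClosedIn G D} := ⟨⟨∅, fun a ha => by simp at ha⟩⟩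
  obtain ⟨⟨D, hD⟩, h⟩ := Nat.sInf_mem
    (Set.range_nonempty fun D : {D : Finset V // IsClosedIn G D} => expoAt p C G D)
  exact ⟨D, hD, h⟩

variable {L X Y : Type*} [Fintype L] [Fintype X] [Fintype Y]

theorem cut_glue (A : SimpleGraph (L ⊕ X)) (B : SimpleGraph (L ⊕ Y)) (DL : Finset L)
    (DX : Finset X) (DY : Finset Y) :
    cut (glue A B) (DL.disjSum (DX.disjSum DY)) =
      glue (cut A (DL.disjSum DX)) (cut B (DL.disjSum DY)) := by
  ext a b
  rcases a with a | a | a <;> rcases b with b | b | b <;> simp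
  all_goals tauto

/-- An optimal closed set of the mixed graph, with its unlabeled half doubled, is closed in each
doubled graph. Outside it `cost_glue` applies. Inside it, a label that is non-isolated in one factor
is non-isolated in the mixed graph, and each unlabeled vertex is counted twice on both sides. -/
theorem expo_glue (hC : Admissible p C) (A : SimpleGraph (L ⊕ X)) (B : SimpleGraph (L ⊕ Y)) :
    expo p C (glue A A) + expo p C (glue B B) ≤ 2 * expo p C (glue A B) := by
  classical
  obtain ⟨D, hD, hDe⟩ := exists_expo_eq p C (glue A B)
  obtain ⟨DL, DX, DY, rfl⟩ : ∃ (DL : Finset L) (DX : Finset X) (DY : Finset Y),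
      D = DL.disjSum (DX.disjSum DY) :=
    ⟨D.toLeft, D.toRight.toLeft, D.toRight.toRight, by
      rw [Finset.toLeft_disjSum_toRight, Finset.toLeft_disjSum_toRight]⟩
  have hA : IsClosedIn (glue A A) (DL.disjSum (DX.disjSum DX)) := by
    rintro (a | a | a) ha (b | b | b) hab
    all_goals
      simp only [glue_ll, glue_lx, glue_ly, glue_xl, glue_yl, glue_xx, glue_yy, glue_xy, glue_yx,
        Finset.inl_mem_disjSum, Finset.inr_mem_disjSum, or_self] at ha hab ⊢
    · simpa using hD (Sum.inl a) (by simpa) (Sum.inl b) (by simp [hab])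
    · simpa using hD (Sum.inl a) (by simpa) (Sum.inr (Sum.inl b)) (by simp [hab])
    · simpa using hD (Sum.inl a) (by simpa) (Sum.inr (Sum.inl b)) (by simp [hab])
    · simpa using hD (Sum.inr (Sum.inl a)) (by simpa) (Sum.inl b) (by simp [hab])
    · simpa using hD (Sum.inr (Sum.inl a)) (by simpa) (Sum.inr (Sum.inl b)) (by simp [hab])
    · simpa using hD (Sum.inr (Sum.inl a)) (by simpa) (Sum.inl b) (by simp [hab])
    · simpa using hD (Sum.inr (Sum.inl a)) (by simpa) (Sum.inr (Sum.inl b)) (by simp [hab])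
  have hB : IsClosedIn (glue B B) (DL.disjSum (DY.disjSum DY)) := by
    rintro (a | a | a) ha (b | b | b) hab
    all_goals
      simp only [glue_ll, glue_lx, glue_ly, glue_xl, glue_yl, glue_xx, glue_yy, glue_xy, glue_yx,
        Finset.inl_mem_disjSum, Finset.inr_mem_disjSum, or_self] at ha hab ⊢
    · simpa using hD (Sum.inl a) (by simpa) (Sum.inl b) (by simp [hab])
    · simpa using hD (Sum.inl a) (by simpa) (Sum.inr (Sum.inr b)) (by simp [hab])
    · simpa using hD (Sum.inl a) (by simpa) (Sum.inr (Sum.inr b)) (by simp [hab])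
    · simpa using hD (Sum.inr (Sum.inr a)) (by simpa) (Sum.inl b) (by simp [hab])
    · simpa using hD (Sum.inr (Sum.inr a)) (by simpa) (Sum.inr (Sum.inr b)) (by simp [hab])
    · simpa using hD (Sum.inr (Sum.inr a)) (by simpa) (Sum.inl b) (by simp [hab])
    · simpa using hD (Sum.inr (Sum.inr a)) (by simpa) (Sum.inr (Sum.inr b)) (by simp [hab])
  have h1 := expo_le (p := p) (C := C) hA
  have h2 := expo_le (p := p) (C := C) hB
  unfold expoAt at h1 h2 hDe
  rw [cut_glue] at h1 h2 hDe
  have h3 := Nat.mul_le_mul_left (Fintype.card κ)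
    (cost_glue hC (cut A (DL.disjSum DX)) (cut B (DL.disjSum DY)))
  have h4 : suppCard (glue A A) (DL.disjSum (DX.disjSum DX)) +
      suppCard (glue B B) (DL.disjSum (DY.disjSum DY)) ≤
      2 * suppCard (glue A B) (DL.disjSum (DX.disjSum DY)) := by
    unfold suppCard
    simp only [Finset.sum_disjSum, Sum.exists, glue_ll, glue_lx, glue_ly, glue_xl, glue_yl,
      glue_xx, glue_yy, glue_xy, glue_yx, exists_false, or_false, false_or, or_self]
    have k1 : ∑ x ∈ DL, (if (∃ a, A.Adj (Sum.inl x) (Sum.inl a)) ∨ ∃ a, A.Adj (Sum.inl x) (Sum.inr a)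
        then 1 else 0) ≤ ∑ x ∈ DL, (if (∃ a, A.Adj (Sum.inl x) (Sum.inl a) ∨ B.Adj (Sum.inl x)
          (Sum.inl a)) ∨ (∃ a, A.Adj (Sum.inl x) (Sum.inr a)) ∨ ∃ b, B.Adj (Sum.inl x) (Sum.inr b)
          then 1 else 0) := by
      refine Finset.sum_le_sum fun x _ => ?_
      split_ifs with c1 c2
      · exact le_rfl
      · exact (c2 (c1.imp (fun ⟨a, h⟩ => ⟨a, Or.inl h⟩) Or.inl)).elim
      · exact Nat.zero_le _
      · exact le_rfl
    have k2 : ∑ x ∈ DL, (if (∃ a, B.Adj (Sum.inl x) (Sum.inl a)) ∨ ∃ a, B.Adj (Sum.inl x) (Sum.inr a)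
        then 1 else 0) ≤ ∑ x ∈ DL, (if (∃ a, A.Adj (Sum.inl x) (Sum.inl a) ∨ B.Adj (Sum.inl x)
          (Sum.inl a)) ∨ (∃ a, A.Adj (Sum.inl x) (Sum.inr a)) ∨ ∃ b, B.Adj (Sum.inl x) (Sum.inr b)
          then 1 else 0) := by
      refine Finset.sum_le_sum fun x _ => ?_
      split_ifs with c1 c2
      · exact le_rfl
      · exact (c2 (c1.imp (fun ⟨a, h⟩ => ⟨a, Or.inr h⟩) Or.inr)).elim
      · exact Nat.zero_le _
      · exact le_rfl
    omega
  have h5 := Nat.mul_le_mul_left (numDarts C + 1) h4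
  rw [← hDe]
  refine (Nat.add_le_add h1 h2).trans ?_
  simp only [mul_add, Nat.mul_left_comm _ 2] at h3 h5 ⊢
  omega

end Expo

/-! ### Isolated vertices -/

section Core

variable {V W κ : Type*}

/-- `G'` consists of a copy of `G`, embedded by `e`, and isolated vertices. -/
structure IsCore (e : V ↪ W) (G : SimpleGraph V) (G' : SimpleGraph W) : Prop where
  adj_iff : ∀ a b, G'.Adj (e a) (e b) ↔ G.Adj a b
  mem_range : ∀ a b, G'.Adj a b → ∃ v, e v = a

variable {e : V ↪ W} {G : SimpleGraph V} {G' : SimpleGraph W} {C : SimpleGraph κ} {p : ℕ}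

theorem IsCore.of_iso (f : G ≃g G') : IsCore f.toEquiv.toEmbedding G G' :=
  ⟨fun _ _ => f.map_adj_iff, fun a _ _ => f.surjective a⟩

theorem IsCore.exists_of_adj (h : IsCore e G G') {a b : W} (hab : G'.Adj a b) :
    ∃ u v, G.Adj u v ∧ e u = a ∧ e v = b := by
  obtain ⟨u, rfl⟩ := h.mem_range a b hab
  obtain ⟨v, rfl⟩ := h.mem_range b _ hab.symm
  exact ⟨u, v, (h.adj_iff u v).1 hab, rfl, rfl⟩

theorem IsCore.cut_map (h : IsCore e G G') (U : Finset V) :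
    IsCore e (cut G U) (cut G' (U.map e)) :=
  ⟨fun a b => by simp [h.adj_iff], fun a b hab => h.mem_range a b hab.1⟩

theorem IsCore.cut_preimage (h : IsCore e G G') {U : Finset V} {U' : Finset W}
    (hU : ∀ v, v ∈ U ↔ e v ∈ U') : IsCore e (cut G U) (cut G' U') :=
  ⟨fun a b => by simp [h.adj_iff, hU], fun a b hab => h.mem_range a b hab.1⟩

variable [Fintype V] [Fintype W] [Fintype κ]

theorem IsCore.numDarts_eq (h : IsCore e G G') : numDarts G' = numDarts G := by
  classical
  rw [numDarts_eq_card, numDarts_eq_card, ← Finset.card_map (e.prodMap e)]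
  congr 1
  ext ⟨a, b⟩
  simp only [Finset.mem_filter, Finset.mem_univ, true_and, Finset.mem_map, Prod.exists]
  constructor
  · intro hab
    obtain ⟨u, v, huv, rfl, rfl⟩ := h.exists_of_adj hab
    exact ⟨u, v, huv, rfl⟩
  · rintro ⟨u, v, huv, hab⟩
    obtain ⟨rfl, rfl⟩ := Prod.mk.inj hab
    exact (h.adj_iff u v).2 huv

/-- A tree of copies of a connected graph with at least two vertices has no isolated vertex, so live
sets stay inside the core. -/
theorem IsCore.numLive_eq (h : IsCore e G G') (hC : C.Connected) (h2 : 2 ≤ Fintype.card κ) :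
    numLive C G' = numLive C G := by
  classical
  unfold numLive
  rw [← Finset.card_map (Finset.mapEmbedding e).toEmbedding]
  congr 1
  ext P'
  simp only [mem_liveSets, Finset.mem_map, RelEmbedding.coe_toEmbedding, Finset.mapEmbedding_apply]
  constructor
  · intro hP'
    have hr : ∀ v ∈ P', ∃ u, e u = v := by
      intro v hv
      obtain ⟨w, -, hw⟩ := Live.exists_mem_adj hC h2 hP'.1 hv
      exact h.mem_range v w hw
    have : Nonempty κ := hC.nonempty
    obtain ⟨v0, hv0⟩ := hP'.1.nonempty
    obtain ⟨u0, -⟩ := hr v0 hv0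
    have : Nonempty V := ⟨u0⟩
    set g := Function.invFun e with hg
    have hge : ∀ v, g (e v) = v := fun v => Function.leftInverse_invFun e.injective v
    have heg : ∀ v ∈ P', e (g v) = v := by
      intro v hv
      obtain ⟨u, rfl⟩ := hr v hv
      rw [hge]
    have hm : ∀ v, v ∈ P'.image g ↔ e v ∈ P' := by
      intro v
      rw [Finset.mem_image]
      constructor
      · rintro ⟨w, hw, rfl⟩
        rwa [heg w hw]
      · exact fun hv => ⟨_, hv, hge v⟩
    refine ⟨P'.image g, ⟨hP'.1.transport g ?_ ?_ fun w => Finset.mem_image, ?_⟩, ?_⟩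
    · intro a ha b hb hab
      rw [← heg a ha, hab, heg b hb]
    · intro a ha b hb
      rw [← h.adj_iff, heg a ha, heg b hb]
    · intro a ha b hab
      rw [hm] at ha ⊢
      exact hP'.2 _ ha _ ((h.adj_iff a b).2 hab)
    · ext v
      rw [Finset.mem_map]
      constructor
      · rintro ⟨a, ha, rfl⟩
        exact (hm a).1 ha
      · intro hv
        exact ⟨g v, (hm _).2 (by rwa [heg v hv]), heg v hv⟩
  · rintro ⟨P, hP, rfl⟩
    refine ⟨hP.1.transport e (fun a _ b _ h => e.injective h) (fun a _ b _ => (h.adj_iff a b).symm)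
      (by simp), ?_⟩
    intro a ha b hab
    obtain ⟨u, hu, rfl⟩ := Finset.mem_map.1 ha
    obtain ⟨v, rfl⟩ := h.mem_range b _ hab.symm
    exact Finset.mem_map_of_mem _ (hP.2 u hu v ((h.adj_iff u v).1 hab))

theorem card_preimage_le {U : Finset V} {U' : Finset W} (hU : ∀ v, v ∈ U ↔ e v ∈ U') :
    U.card ≤ U'.card := by
  rw [← Finset.card_map e]
  refine Finset.card_le_card fun v hv => ?_
  obtain ⟨u, hu, rfl⟩ := Finset.mem_map.1 hv
  exact (hU u).1 hu

theorem IsCore.cost_eq (h : IsCore e G G') (hC : C.Connected) (h2 : 2 ≤ Fintype.card κ) :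
    cost p C G' = cost p C G := by
  classical
  apply le_antisymm
  · obtain ⟨U, hU⟩ := exists_cost_eq p C G
    rw [← hU]
    refine (cost_le_costAt (U.map e)).trans (le_of_eq ?_)
    unfold costAt
    rw [(h.cut_map U).numDarts_eq, (h.cut_map U).numLive_eq hC h2, Finset.card_map]
  · obtain ⟨U', hU'⟩ := exists_cost_eq p C G'
    rw [← hU']
    set U := (Finset.univ : Finset V).filter fun v => e v ∈ U' with hUdef
    have hU : ∀ v, v ∈ U ↔ e v ∈ U' := fun v => by simp [hUdef]
    refine (cost_le_costAt U).trans ?_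
    unfold costAt
    rw [(h.cut_preimage hU).numDarts_eq, (h.cut_preimage hU).numLive_eq hC h2]
    exact Nat.add_le_add_right (Nat.mul_le_mul_left _ (card_preimage_le hU)) _

theorem IsCore.suppCard_eq (h : IsCore e G G') {D : Finset V} {D' : Finset W}
    (hD : ∀ v, v ∈ D ↔ e v ∈ D') : suppCard G' D' = suppCard G D := by
  classical
  unfold suppCard
  have h1 : ∀ v, (∃ w, G'.Adj (e v) w) ↔ ∃ w, G.Adj v w := by
    refine fun v => ⟨fun ⟨w, hw⟩ => ?_, fun ⟨w, hw⟩ => ⟨e w, (h.adj_iff v w).2 hw⟩⟩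
    obtain ⟨u, rfl⟩ := h.mem_range w _ hw.symm
    exact ⟨u, (h.adj_iff v u).1 hw⟩
  rw [← Finset.sum_subset (s₁ := D.map e) (fun v hv => ?_) fun v hv hv' => ?_,
    Finset.sum_map]
  · refine Finset.sum_congr rfl fun v _ => ?_
    simp only [h1]
    congr!
  · obtain ⟨u, hu, rfl⟩ := Finset.mem_map.1 hv
    exact (hD u).1 hu
  · refine if_neg ?_
    rintro ⟨w, hw⟩
    obtain ⟨u, rfl⟩ := h.mem_range v w hw
    exact hv' (Finset.mem_map_of_mem e ((hD u).2 hv))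

theorem IsCore.expo_eq (h : IsCore e G G') (hC : C.Connected) (h2 : 2 ≤ Fintype.card κ) :
    expo p C G' = expo p C G := by
  classical
  apply le_antisymm
  · obtain ⟨D, hD, hDe⟩ := exists_expo_eq p C G
    rw [← hDe]
    refine (expo_le (D := D.map e) ?_).trans (le_of_eq ?_)
    · intro a ha b hab
      obtain ⟨u, hu, rfl⟩ := Finset.mem_map.1 ha
      obtain ⟨v, rfl⟩ := h.mem_range b _ hab.symm
      exact Finset.mem_map_of_mem _ (hD u hu v ((h.adj_iff u v).1 hab))
    · unfold expoAt
      rw [(h.cut_map D).cost_eq hC h2, h.suppCard_eq (D := D) (by simp)]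
  · obtain ⟨D', hD', hDe⟩ := exists_expo_eq p C G'
    rw [← hDe]
    set D := (Finset.univ : Finset V).filter fun v => e v ∈ D' with hDdef
    have hD : ∀ v, v ∈ D ↔ e v ∈ D' := fun v => by simp [hDdef]
    refine (expo_le (D := D) ?_).trans (le_of_eq ?_)
    · intro a ha b hab
      rw [hD] at ha ⊢
      exact hD' _ ha _ ((h.adj_iff a b).2 hab)
    · unfold expoAt
      rw [(h.cut_preimage hD).cost_eq hC h2, h.suppCard_eq hD]

end Core

/-! ### Additivity over disjoint unions -/

section Sum

variable {V W κ : Type*} {G : SimpleGraph V} {H : SimpleGraph W} {C : SimpleGraph κ} {p : ℕ}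

theorem not_adj_sum_inr_inl (w : W) (v : V) : ¬ (G ⊕g H).Adj (Sum.inr w) (Sum.inl v) := by
  simp

theorem cut_sum (U : Finset V) (U' : Finset W) :
    cut (G ⊕g H) (U.disjSum U') = cut G U ⊕g cut H U' := by
  ext a b
  rcases a with a | a <;> rcases b with b | b <;> simp

variable [Fintype V] [Fintype W] [Fintype κ]

theorem numDarts_sum : numDarts (G ⊕g H) = numDarts G + numDarts H := by
  classical
  simp only [numDarts, dartsIn, Fintype.sum_sum_type, sum_adj_inl, sum_adj_inr,
    not_adj_sum_inl_inr, not_adj_sum_inr_inl, if_false, Finset.sum_const_zero, add_zero, zero_add]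

theorem numLive_sum (hC : C.Connected) : numLive C (G ⊕g H) = numLive C G + numLive C H := by
  classical
  have : Nonempty κ := hC.nonempty
  have key : liveSets C (G ⊕g H) = ((liveSets C G).image fun P => P.map Function.Embedding.inl) ∪
      ((liveSets C H).image fun P => P.map Function.Embedding.inr) := by
    ext P
    simp only [Finset.mem_union, Finset.mem_image, mem_liveSets]
    constructor
    · intro hP
      have hadj : ∀ a b : V ⊕ W, (G ⊕g H).Adj a b ↔
          (tri (⊥ : SimpleGraph Empty) G H ∅ ∅).Adj (Sum.inr a) (Sum.inr b) := by
        rintro (a | a) (b | b) <;> simp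
      -- A disjoint union is a gluing along the empty set, so a live set lies in one of the two
      -- summands.
      have hP2 : Live C (tri (⊥ : SimpleGraph Empty) G H ∅ ∅) (P.map Function.Embedding.inr) := by
        refine ⟨hP.1.transport Sum.inr (fun a _ b _ h => Sum.inr_injective h)
          (fun a _ b _ => hadj a b) (by simp), ?_⟩
        intro a ha b hab
        obtain ⟨a, ha', rfl⟩ := Finset.mem_map.1 ha
        rcases b with b | b
        · exact b.elim
        · exact Finset.mem_map_of_mem _ (hP.2 a ha' b ((hadj a b).2 hab))
      obtain ⟨v, hv⟩ := hP.1.nonempty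
      rcases v with v | v
      · left
        obtain ⟨P', h1, -, h3⟩ := exists_eq_map_inX hC hP2 (fun l => l.elim) (x := v)
          (Finset.mem_map_of_mem _ hv)
        refine ⟨P', h1, Finset.map_injective (Function.Embedding.inr : V ⊕ W ↪ Empty ⊕ (V ⊕ W)) ?_⟩
        rw [Finset.map_map]
        exact h3.symm
      · right
        obtain ⟨P', h1, -, h3⟩ := exists_eq_map_inY hC hP2 (fun l => l.elim) (x := v)
          (Finset.mem_map_of_mem _ hv)
        refine ⟨P', h1, Finset.map_injective (Function.Embedding.inr : V ⊕ W ↪ Empty ⊕ (V ⊕ W)) ?_⟩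
        rw [Finset.map_map]
        exact h3.symm
    · rintro (⟨P, hP, rfl⟩ | ⟨P, hP, rfl⟩)
      · refine ⟨hP.1.transport Sum.inl (fun a _ b _ h => Sum.inl_injective h)
          (fun a _ b _ => by simp) (by simp), ?_⟩
        intro a ha b hab
        obtain ⟨a, ha', rfl⟩ := Finset.mem_map.1 ha
        rcases b with b | b
        · exact Finset.mem_map_of_mem _ (hP.2 a ha' b (by simpa using hab))
        · simp at hab
      · refine ⟨hP.1.transport Sum.inr (fun a _ b _ h => Sum.inr_injective h)
          (fun a _ b _ => by simp) (by simp), ?_⟩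
        intro a ha b hab
        obtain ⟨a, ha', rfl⟩ := Finset.mem_map.1 ha
        rcases b with b | b
        · simp at hab
        · exact Finset.mem_map_of_mem _ (hP.2 a ha' b (by simpa using hab))
  unfold numLive
  rw [key, Finset.card_union_of_disjoint, Finset.card_image_of_injective _ (Finset.map_injective _),
    Finset.card_image_of_injective _ (Finset.map_injective _)]
  rw [Finset.disjoint_left]
  intro P hP hP'
  obtain ⟨Q, hQ, rfl⟩ := Finset.mem_image.1 hP
  obtain ⟨Q', -, hQQ⟩ := Finset.mem_image.1 hP'
  obtain ⟨v, hv⟩ := (mem_liveSets.1 hQ).1.nonempty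
  have : Sum.inl v ∈ Q'.map Function.Embedding.inr := by
    rw [hQQ]
    exact Finset.mem_map_of_mem _ hv
  obtain ⟨w, -, hw⟩ := Finset.mem_map.1 this
  exact Sum.inr_ne_inl hw

theorem costAt_sum (hC : C.Connected) (U : Finset V) (U' : Finset W) :
    costAt p C (G ⊕g H) (U.disjSum U') = costAt p C G U + costAt p C H U' := by
  unfold costAt
  rw [cut_sum, numDarts_sum, numLive_sum hC, Finset.card_disjSum]
  ring

theorem cost_sum (hC : C.Connected) : cost p C (G ⊕g H) = cost p C G + cost p C H := by
  apply le_antisymm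
  · obtain ⟨U, hU⟩ := exists_cost_eq p C G
    obtain ⟨U', hU'⟩ := exists_cost_eq p C H
    rw [← hU, ← hU', ← costAt_sum hC]
    exact cost_le_costAt _
  · obtain ⟨U, hU⟩ := exists_cost_eq p C (G ⊕g H)
    rw [← hU, ← Finset.toLeft_disjSum_toRight (u := U), costAt_sum hC]
    exact Nat.add_le_add (cost_le_costAt _) (cost_le_costAt _)

theorem expoAt_sum (hC : C.Connected) (D : Finset V) (D' : Finset W) :
    expoAt p C (G ⊕g H) (D.disjSum D') = expoAt p C G D + expoAt p C H D' := by
  classical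
  have : suppCard (G ⊕g H) (D.disjSum D') = suppCard G D + suppCard H D' := by
    simp only [suppCard, Finset.sum_disjSum, Sum.exists, sum_adj_inl, sum_adj_inr,
      not_adj_sum_inl_inr, not_adj_sum_inr_inl, exists_false, or_false, false_or]
    congr!
  unfold expoAt
  rw [cut_sum, cost_sum hC, this]
  ring

theorem expo_sum (hC : C.Connected) : expo p C (G ⊕g H) = expo p C G + expo p C H := by
  apply le_antisymm
  · obtain ⟨D, hD, hDe⟩ := exists_expo_eq p C G
    obtain ⟨D', hD', hDe'⟩ := exists_expo_eq p C H
    rw [← hDe, ← hDe', ← expoAt_sum hC]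
    refine expo_le ?_
    rintro (a | a) ha (b | b) hab
    · simpa using hD a (by simpa using ha) b (by simpa using hab)
    · simp at hab
    · simp at hab
    · simpa using hD' a (by simpa using ha) b (by simpa using hab)
  · obtain ⟨D, hD, hDe⟩ := exists_expo_eq p C (G ⊕g H)
    rw [← Finset.toLeft_disjSum_toRight (u := D)] at hDe hD
    rw [← hDe, expoAt_sum hC]
    refine Nat.add_le_add (expo_le fun a ha b hab => ?_) (expo_le fun a ha b hab => ?_)
    · simpa using hD (Sum.inl a) (by simpa using ha) (Sum.inl b) (by simpa using hab)
    · simpa using hD (Sum.inr a) (by simpa using ha) (Sum.inr b) (by simpa using hab)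

end Sum

/-! ### The exponent of connected graphs -/

section Values

variable {V κ : Type*} [Fintype V] [Fintype κ] {C : SimpleGraph κ} {G : SimpleGraph V} {p : ℕ}

theorem numDarts_le_cut (hdeg : ∀ v, ∃ s : Finset V, s.card ≤ p + 1 ∧ ∀ w, G.Adj v w → w ∈ s)
    (U : Finset V) : numDarts G ≤ numDarts (cut G U) + (2 * p + 2) * U.card := by
  classical
  induction U using Finset.induction_on with
  | empty => simp
  | insert u U hu ih =>
    set N := (Finset.univ : Finset V).filter fun v => (cut G U).Adj u v with hN
    have h1 := numDarts_cut_singleton (HL := cut G U) u N (fun v => by simp [hN])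
    rw [cut_cut, Finset.union_comm, ← Finset.insert_eq] at h1
    obtain ⟨s, hs, hs'⟩ := hdeg u
    have h2 : N.card ≤ s.card := Finset.card_le_card fun v hv => by
      simp only [hN, Finset.mem_filter, cut_adj] at hv
      exact hs' v hv.2.1
    rw [Finset.card_insert_of_notMem hu, mul_add]
    omega

/-- With degrees at most `p + 1`, a deletion at one vertex removes at most `2p + 2` darts but costs
`2p + 3`. -/
theorem numDarts_le_cost (hdeg : ∀ v, ∃ s : Finset V, s.card ≤ p + 1 ∧ ∀ w, G.Adj v w → w ∈ s) :
    numDarts G ≤ cost p C G := by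
  obtain ⟨U, hU⟩ := exists_cost_eq p C G
  rw [← hU]
  have := numDarts_le_cut hdeg U
  have h2 : (2 * p + 2) * U.card ≤ (2 * p + 3) * U.card := Nat.mul_le_mul_right _ (by omega)
  unfold costAt
  omega

theorem eq_empty_or_eq_univ (hG : G.Connected) {D : Finset V} (hD : IsClosedIn G D) :
    D = ∅ ∨ D = Finset.univ := by
  rcases D.eq_empty_or_nonempty with h | ⟨v, hv⟩
  · exact Or.inl h
  · right
    have h1 : CTree G G Finset.univ := CTree.base (Embedding.refl) (by simp)
    exact (Finset.subset_univ D).antisymm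
      (h1.subset_of_closed hG hD (Finset.mem_univ v) hv)

theorem suppCard_univ (hG : NoIsolated G) : suppCard G Finset.univ = Fintype.card V := by
  classical
  have : ∀ v, ∃ w, G.Adj v w := hG
  simp [suppCard, this]

/-- In a connected graph, only the empty set and the whole vertex set are closed. For the former use
`numDarts_le_cost`, for the latter the assumption that `(darts + 1) / vertices` is at most its value
for `C`. -/
theorem mul_numDarts_le_expo (hG : G.Connected) (hG' : NoIsolated G)
    (hdeg : ∀ v, ∃ s : Finset V, s.card ≤ p + 1 ∧ ∀ w, G.Adj v w → w ∈ s)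
    (hmax : (numDarts G + 1) * Fintype.card κ ≤ (numDarts C + 1) * Fintype.card V) :
    Fintype.card κ * numDarts G ≤ expo p C G := by
  obtain ⟨D, hD, hDe⟩ := exists_expo_eq p C G
  rw [← hDe]
  unfold expoAt
  rcases eq_empty_or_eq_univ hG hD with rfl | rfl
  · rw [cut_empty]
    exact (Nat.mul_le_mul_left _ (numDarts_le_cost hdeg)).trans (Nat.le_add_right _ _)
  · rw [suppCard_univ hG']
    rw [add_mul, mul_comm (numDarts G)] at hmax
    omega

/-- `C` gains 1 over its darts in every case: with nothing deleted it is itself a live set, a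
deletion costs at least one more than the darts removed, and the closed set of all vertices has
exactly this value. -/
theorem mul_succ_le_expo_self (hG : C.Connected) (hG' : NoIsolated C)
    (hdeg : ∀ v, ∃ s : Finset κ, s.card ≤ p + 1 ∧ ∀ w, C.Adj v w → w ∈ s) :
    Fintype.card κ * (numDarts C + 1) ≤ expo p C C := by
  obtain ⟨D, hD, hDe⟩ := exists_expo_eq p C C
  rw [← hDe]
  unfold expoAt
  rcases eq_empty_or_eq_univ hG hD with rfl | rfl
  · rw [cut_empty]
    refine (Nat.mul_le_mul_left _ ?_).trans (Nat.le_add_right _ _)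
    obtain ⟨U, hU⟩ := exists_cost_eq p C C
    rw [← hU]
    unfold costAt
    rcases U.eq_empty_or_nonempty with rfl | hne
    · rw [cut_empty]
      have h1 : (Finset.univ : Finset κ) ∈ liveSets C C :=
        mem_liveSets.2 ⟨CTree.base Embedding.refl (by simp), fun _ _ b _ => Finset.mem_univ b⟩
      have : 1 ≤ numLive C C := Finset.card_pos.2 ⟨_, h1⟩
      omega
    · have := numDarts_le_cut hdeg U
      have h2 := hne.card_pos
      have h3 : (2 * p + 2) * U.card + U.card = (2 * p + 3) * U.card := by ring
      omega
  · rw [suppCard_univ hG', mul_comm (Fintype.card κ) (numDarts C + 1)]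
    omega

/-- If there is no live set, delete nothing. Otherwise the whole graph is a tree of `m` copies with
`m ≥ 2`, as it is not isomorphic to `C`. Taking all vertices as the closed set gives `m * (darts C +
1)` per vertex of `C`, at most the number of darts since the `m - 1` joints supply `2 * (m - 1) ≥
m`. -/
theorem expo_le_mul_numDarts (hC : C.Connected) (h2 : 2 ≤ Fintype.card κ) (hG : G.Connected) (hG' : NoIsolated G)
    (hne : IsEmpty (C ≃g G)) : expo p C G ≤ Fintype.card κ * numDarts G := by
  classical
  have : Nonempty κ := hC.nonempty
  by_cases hlive : ∃ P, Live C G P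
  · obtain ⟨P, hP⟩ := hlive
    obtain rfl : P = Finset.univ := by
      rcases eq_empty_or_eq_univ hG hP.2 with rfl | h
      · simpa using hP.1.nonempty
      · exact h
    obtain ⟨m, hm1, hmc, hmd, hm⟩ := hP.1.count
    have hm2 : m ≠ 1 := by
      intro h
      obtain ⟨f, hf⟩ := hm h
      exact hne.elim ⟨Equiv.ofBijective f ⟨f.injective, fun v => (hf v).1 (Finset.mem_univ v)⟩,
        f.map_adj_iff⟩
    refine (expo_le (D := Finset.univ) fun _ _ b _ => Finset.mem_univ b).trans ?_
    have hzero : cost p C (cut G Finset.univ) = 0 := by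
      have hcb : cut G Finset.univ = ⊥ := by
        ext a b
        simp
      have h1 := cost_le (p := p) (C := C) (G := cut G Finset.univ)
      have h4 : numDarts (cut G Finset.univ) = 0 := by
        rw [hcb]
        simp [numDarts, dartsIn]
      have h3 : numLive C (cut G Finset.univ) = 0 := by
        rw [hcb]
        unfold numLive
        rw [Finset.card_eq_zero, Finset.eq_empty_iff_forall_notMem]
        intro Q hQ
        rw [mem_liveSets] at hQ
        obtain ⟨v, hv⟩ := hQ.1.nonempty
        obtain ⟨w, -, hw⟩ := Live.exists_mem_adj hC h2 hQ.1 hv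
        exact hw
      omega
    unfold expoAt
    rw [Finset.card_univ] at hmc
    rw [hzero, suppCard_univ hG', hmc, mul_zero, zero_add,
      ← mul_assoc, mul_comm _ (Fintype.card κ)]
    refine Nat.mul_le_mul_left _ (le_trans ?_ hmd)
    rw [add_mul, mul_comm m]
    omega
  · have h0 : numLive C G = 0 := by
      unfold numLive
      rw [Finset.card_eq_zero, Finset.eq_empty_iff_forall_notMem]
      intro P hP
      exact hlive ⟨P, mem_liveSets.1 hP⟩
    refine (expo_le (D := ∅) fun a ha => by simp at ha).trans ?_
    unfold expoAt suppCard
    rw [cut_empty, Finset.sum_empty, mul_zero, add_zero]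
    have := cost_le (p := p) (C := C) (G := G)
    rw [h0] at this
    exact Nat.mul_le_mul_left _ this

end Values

/-! ### Homomorphism densities and strict Cauchy-Schwarz -/

section Target

/-- A finite graph with loops allowed, at least one loop, and positive vertex weights of sum 1. -/
structure Target where
  carrier : Type
  [fintype : Fintype carrier]
  rel : carrier → carrier → Prop
  symm : ∀ a b, rel a b → rel b a
  loop : ∃ a, rel a a
  weight : carrier → ℝ
  pos : ∀ a, 0 < weight a
  sum_eq : ∑ a, weight a = 1

attribute [instance] Target.fintype

variable {V W L X Y Z : Type*}

/-- The map `f` takes edges of `G` to related pairs. -/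
def IsHomTo {τ : Type*} (R : τ → τ → Prop) (G : SimpleGraph V) (f : V → τ) : Prop :=
  ∀ a b, G.Adj a b → R (f a) (f b)

open Classical in
/-- The homomorphism density of `G` in a target. -/
noncomputable def homDensity [Fintype V] (T : Target) (G : SimpleGraph V) : ℝ :=
  ∑ f : V → T.carrier, if IsHomTo T.rel G f then ∏ v, T.weight (f v) else 0

open Classical in
/-- The density of extensions of `φ` to a homomorphism. -/
noncomputable def extDensity [Fintype X] (T : Target) (A : SimpleGraph (L ⊕ X))
    (φ : L → T.carrier) : ℝ :=
  ∑ f : X → T.carrier, if IsHomTo T.rel A (Sum.elim φ f) then ∏ x, T.weight (f x) else 0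

theorem sum_fun_sum {A B τ : Type*} {_ : Fintype (A ⊕ B → τ)} {_ : Fintype (A → τ)}
    {_ : Fintype (B → τ)}
    (F : (A ⊕ B → τ) → ℝ) : ∑ f, F f = ∑ φ : A → τ, ∑ χ : B → τ, F (Sum.elim φ χ) := by
  rw [← Fintype.sum_prod_type' (f := fun φ χ => F (Sum.elim φ χ))]
  refine Fintype.sum_equiv (Equiv.sumArrowEquivProdArrow A B τ) _ _ fun f => ?_
  congr 1
  ext x
  rcases x with x | x <;> rfl

variable (T : Target)

/-- The constant map to a vertex with a loop is a homomorphism. -/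
theorem homDensity_pos [Fintype V] (G : SimpleGraph V) : 0 < homDensity T G := by
  classical
  obtain ⟨a, ha⟩ := T.loop
  refine Finset.sum_pos' (fun f _ => ?_) ⟨fun _ => a, Finset.mem_univ _, ?_⟩
  · split_ifs
    · exact Finset.prod_nonneg fun v _ => (T.pos _).le
    · exact le_rfl
  · rw [if_pos (show IsHomTo T.rel G fun _ => a from fun _ _ _ => ha)]
    exact Finset.prod_pos fun v _ => T.pos _

open Classical in
theorem homDensity_eq_sum [Fintype L] [Fintype X] (A : SimpleGraph (L ⊕ X)) :
    homDensity T A = ∑ φ : L → T.carrier, (∏ l, T.weight (φ l)) * extDensity T A φ := by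
  unfold homDensity
  rw [sum_fun_sum]
  refine Finset.sum_congr rfl fun φ _ => ?_
  unfold extDensity
  rw [Finset.mul_sum]
  refine Finset.sum_congr rfl fun f _ => ?_
  rw [Fintype.prod_sum_type, mul_ite, mul_zero]
  rfl

theorem isHomTo_glue {τ : Type*} (R : τ → τ → Prop) (A : SimpleGraph (L ⊕ X))
    (B : SimpleGraph (L ⊕ Y)) (φ : L → τ) (f : X → τ) (g : Y → τ) :
    IsHomTo R (glue A B) (Sum.elim φ (Sum.elim f g)) ↔
      IsHomTo R A (Sum.elim φ f) ∧ IsHomTo R B (Sum.elim φ g) := by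
  constructor
  · refine fun h => ⟨?_, ?_⟩
    · rintro (a | a) (b | b) hab
      · exact h (Sum.inl a) (Sum.inl b) (by simp [hab])
      · exact h (Sum.inl a) (Sum.inr (Sum.inl b)) (by simp [hab])
      · exact h (Sum.inr (Sum.inl a)) (Sum.inl b) (by simp [hab])
      · exact h (Sum.inr (Sum.inl a)) (Sum.inr (Sum.inl b)) (by simp [hab])
    · rintro (a | a) (b | b) hab
      · exact h (Sum.inl a) (Sum.inl b) (by simp [hab])
      · exact h (Sum.inl a) (Sum.inr (Sum.inr b)) (by simp [hab])
      · exact h (Sum.inr (Sum.inr a)) (Sum.inl b) (by simp [hab])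
      · exact h (Sum.inr (Sum.inr a)) (Sum.inr (Sum.inr b)) (by simp [hab])
  · rintro ⟨h1, h2⟩ (a | a | a) (b | b | b) hab
    · rw [glue_ll] at hab
      exact hab.elim (h1 _ _) (h2 _ _)
    · exact h1 (Sum.inl a) (Sum.inr b) (by simpa using hab)
    · exact h2 (Sum.inl a) (Sum.inr b) (by simpa using hab)
    · exact h1 (Sum.inr a) (Sum.inl b) (by simpa using hab)
    · exact h1 (Sum.inr a) (Sum.inr b) (by simpa using hab)
    · simp at hab
    · exact h2 (Sum.inr a) (Sum.inl b) (by simpa using hab)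
    · simp at hab
    · exact h2 (Sum.inr a) (Sum.inr b) (by simpa using hab)

/-- Once the labels are placed, the two unlabeled parts are mapped independently. -/
theorem extDensity_glue [Fintype X] [Fintype Y] (A : SimpleGraph (L ⊕ X))
    (B : SimpleGraph (L ⊕ Y)) (φ : L → T.carrier) :
    extDensity T (glue A B) φ = extDensity T A φ * extDensity T B φ := by
  classical
  unfold extDensity
  rw [sum_fun_sum, Finset.sum_mul_sum]
  refine Finset.sum_congr rfl fun f _ => Finset.sum_congr rfl fun g _ => ?_
  rw [Fintype.prod_sum_type, ite_zero_mul_ite_zero]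
  exact if_congr (isHomTo_glue _ A B φ f g) rfl rfl

/-- Lagrange's identity: the defect in the Cauchy-Schwarz inequality is half a weighted sum of
squares of the 2×2 minors. -/
theorem sum_mul_sq_lt {ι : Type*} (s : Finset ι) (w a b : ι → ℝ) (hw : ∀ i ∈ s, 0 < w i) :
    (∑ i ∈ s, w i * (a i * b i)) ^ 2 ≤
        (∑ i ∈ s, w i * (a i * a i)) * ∑ i ∈ s, w i * (b i * b i) ∧
      ∀ i ∈ s, ∀ j ∈ s, a i * b j ≠ a j * b i →
        (∑ i ∈ s, w i * (a i * b i)) ^ 2 <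
          (∑ i ∈ s, w i * (a i * a i)) * ∑ i ∈ s, w i * (b i * b i) := by
  have key : ∑ i ∈ s, ∑ j ∈ s, w i * w j * (a i * b j - a j * b i) ^ 2 =
      2 * ((∑ i ∈ s, w i * (a i * a i)) * (∑ i ∈ s, w i * (b i * b i)) -
        (∑ i ∈ s, w i * (a i * b i)) ^ 2) := by
    have e1 : (∑ i ∈ s, w i * (a i * a i)) * (∑ i ∈ s, w i * (b i * b i)) =
        ∑ i ∈ s, ∑ j ∈ s, (w i * (a i * a i)) * (w j * (b j * b j)) := Finset.sum_mul_sum _ _ _ _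
    have e2 : (∑ i ∈ s, w i * (a i * a i)) * (∑ i ∈ s, w i * (b i * b i)) =
        ∑ i ∈ s, ∑ j ∈ s, (w i * (b i * b i)) * (w j * (a j * a j)) := by
      rw [mul_comm]
      exact Finset.sum_mul_sum _ _ _ _
    have e3 : (∑ i ∈ s, w i * (a i * b i)) ^ 2 =
        ∑ i ∈ s, ∑ j ∈ s, (w i * (a i * b i)) * (w j * (a j * b j)) := by
      rw [sq]
      exact Finset.sum_mul_sum _ _ _ _
    have : ∑ i ∈ s, ∑ j ∈ s, w i * w j * (a i * b j - a j * b i) ^ 2 =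
        (∑ i ∈ s, ∑ j ∈ s, (w i * (a i * a i)) * (w j * (b j * b j))) +
        (∑ i ∈ s, ∑ j ∈ s, (w i * (b i * b i)) * (w j * (a j * a j))) -
        2 * ∑ i ∈ s, ∑ j ∈ s, (w i * (a i * b i)) * (w j * (a j * b j)) := by
      simp only [Finset.mul_sum, ← Finset.sum_add_distrib, ← Finset.sum_sub_distrib]
      refine Finset.sum_congr rfl fun i _ => Finset.sum_congr rfl fun j _ => ?_
      ring
    rw [this, ← e1, ← e2, ← e3]
    ring
  have hnn : ∀ i ∈ s, ∀ j ∈ s, 0 ≤ w i * w j * (a i * b j - a j * b i) ^ 2 := fun i hi j hj =>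
    mul_nonneg (mul_pos (hw i hi) (hw j hj)).le (sq_nonneg _)
  constructor
  · have : 0 ≤ ∑ i ∈ s, ∑ j ∈ s, w i * w j * (a i * b j - a j * b i) ^ 2 :=
      Finset.sum_nonneg fun i hi => Finset.sum_nonneg fun j hj => hnn i hi j hj
    linarith
  · intro i hi j hj hij
    have : 0 < ∑ i ∈ s, ∑ j ∈ s, w i * w j * (a i * b j - a j * b i) ^ 2 := by
      refine Finset.sum_pos' (fun i hi => Finset.sum_nonneg fun j hj => hnn i hi j hj) ⟨i, hi, ?_⟩
      refine Finset.sum_pos' (fun j hj => hnn i hi j hj) ⟨j, hj, ?_⟩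
      exact mul_pos (mul_pos (hw i hi) (hw j hj)) (sq_pos_of_ne_zero (sub_ne_zero.2 hij))
    linarith

theorem homDensity_glue [Fintype L] [Fintype X] [Fintype Y] (A : SimpleGraph (L ⊕ X))
    (B : SimpleGraph (L ⊕ Y)) :
    homDensity T (glue A B) ^ 2 ≤ homDensity T (glue A A) * homDensity T (glue B B) ∧
      ∀ φ φ' : L → T.carrier,
        extDensity T A φ * extDensity T B φ' ≠ extDensity T A φ' * extDensity T B φ →
        homDensity T (glue A B) ^ 2 < homDensity T (glue A A) * homDensity T (glue B B) := by
  classical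
  simp only [homDensity_eq_sum, extDensity_glue]
  obtain ⟨h1, h2⟩ := sum_mul_sq_lt (Finset.univ : Finset (L → T.carrier))
    (fun φ => ∏ l, T.weight (φ l)) (extDensity T A) (extDensity T B)
    (fun φ _ => Finset.prod_pos fun l _ => T.pos _)
  exact ⟨h1, fun φ φ' h => h2 φ (Finset.mem_univ _) φ' (Finset.mem_univ _) h⟩

theorem sum_prod_weight [Fintype V] [Fintype (V → T.carrier)] :
    ∑ f : V → T.carrier, ∏ v, T.weight (f v) = 1 := by
  classical
  have := Finset.prod_univ_sum (fun _ : V => (Finset.univ : Finset T.carrier))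
    (fun _ a => T.weight a)
  simp only [T.sum_eq, Finset.prod_const_one, Fintype.piFinset_univ] at this
  convert this.symm

theorem homDensity_sum [Fintype V] [Fintype W] (G : SimpleGraph V) (H : SimpleGraph W) :
    homDensity T (G ⊕g H) = homDensity T G * homDensity T H := by
  classical
  unfold homDensity
  rw [sum_fun_sum, Finset.sum_mul_sum]
  refine Finset.sum_congr rfl fun f _ => Finset.sum_congr rfl fun g _ => ?_
  rw [Fintype.prod_sum_type, ite_zero_mul_ite_zero]
  refine if_congr ⟨fun h => ⟨fun a b hab => ?_, fun a b hab => ?_⟩, ?_⟩ rfl rfl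
  · exact h (Sum.inl a) (Sum.inl b) (by simpa using hab)
  · exact h (Sum.inr a) (Sum.inr b) (by simpa using hab)
  · rintro ⟨h1, h2⟩ (a | a) (b | b) hab
    · exact h1 a b (by simpa using hab)
    · simp at hab
    · simp at hab
    · exact h2 a b (by simpa using hab)

theorem homDensity_iso [Fintype V] [Fintype W] {G : SimpleGraph V} {H : SimpleGraph W}
    (e : G ≃g H) : homDensity T H = homDensity T G := by
  classical
  unfold homDensity
  refine Fintype.sum_equiv (e.toEquiv.arrowCongr (Equiv.refl T.carrier)).symm _ _ fun f => ?_
  refine if_congr ?_ ?_ rfl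
  · constructor
    · intro h a b hab
      exact h _ _ (e.map_adj_iff.2 hab)
    · intro h a b hab
      have := h (e.symm a) (e.symm b) (e.symm.map_adj_iff.2 hab)
      simpa [Equiv.arrowCongr] using this
  · exact (Fintype.prod_equiv e.toEquiv _ _ fun v => rfl).symm

theorem homDensity_core [Fintype V] [Fintype W] {e : V ↪ W} {G : SimpleGraph V}
    {G' : SimpleGraph W} (h : IsCore e G G') : homDensity T G' = homDensity T G := by
  classical
  set B := {w : W // w ∉ Set.range e}
  let E : V ⊕ B ≃ W := (Equiv.sumCongr (Equiv.ofInjective e e.injective) (Equiv.refl _)).trans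
    (Equiv.sumCompl (· ∈ Set.range e))
  have hEl : ∀ v, E (Sum.inl v) = e v := fun v => rfl
  have hEr : ∀ b, E (Sum.inr b) = b.1 := fun v => rfl
  have iso : (G ⊕g (⊥ : SimpleGraph B)) ≃g G' := by
    refine ⟨E, ?_⟩
    rintro (a | a) (b | b)
    · rw [hEl, hEl, h.adj_iff]
      simp
    · rw [hEl, hEr]
      simp only [not_adj_sum_inl_inr, iff_false]
      exact fun hab => b.2 (h.mem_range _ _ hab.symm)
    · rw [hEl, hEr]
      simp only [not_adj_sum_inr_inl, iff_false]
      exact fun hab => a.2 (h.mem_range _ _ hab)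
    · rw [hEr, hEr]
      simp only [sum_adj_inr, bot_adj, iff_false]
      exact fun hab => a.2 (h.mem_range _ _ hab)
  have hbot : homDensity T (⊥ : SimpleGraph B) = 1 := by
    have hall : ∀ f : B → T.carrier, IsHomTo T.rel (⊥ : SimpleGraph B) f :=
      fun f a b hab => hab.elim
    unfold homDensity
    simp only [hall, if_true]
    convert sum_prod_weight T (V := B)
  rw [homDensity_iso T iso, homDensity_sum, hbot, mul_one]

end Target

/-! ### Targets with an apex determine labeled graphs -/

section Apex

variable {L X Y Z : Type}

/-- Two finite families of maps have a common multiset of values if the corresponding polynomials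
agree at all positive points. -/
theorem exists_same_fibers {U τ : Type*} [Fintype U] [Fintype τ] (F1 F2 : Finset (U → τ))
    (h : ∀ x : τ → ℝ, (∀ t, 0 < x t) → ∑ f ∈ F1, ∏ u, x (f u) = ∑ f ∈ F2, ∏ u, x (f u))
    {f : U → τ} (hf : f ∈ F1) :
    ∃ g ∈ F2, ∑ u, Finsupp.single (g u) (1 : ℕ) = ∑ u, Finsupp.single (f u) 1 := by
  classical
  have heq : (∑ f ∈ F1, ∏ u, (MvPolynomial.X (f u) : MvPolynomial τ ℝ)) =
      ∑ f ∈ F2, ∏ u, MvPolynomial.X (f u) := by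
    refine MvPolynomial.funext_set (fun _ => Set.Ioi 0) (fun _ => Set.Ioi_infinite 0) ?_
    intro x hx
    simpa using h x fun t => hx t (Set.mem_univ t)
  have hmon : ∀ f : U → τ, (∏ u, (MvPolynomial.X (f u) : MvPolynomial τ ℝ)) =
      MvPolynomial.monomial (∑ u, Finsupp.single (f u) 1) 1 := fun f => by
    rw [MvPolynomial.monomial_sum_one]
    rfl
  by_contra hcon
  push Not at hcon
  -- Compare the coefficients at the monomial of `f`. All coefficients are nonnegative, so nothing
  -- cancels on the side of `F1`.
  have hc := congrArg (MvPolynomial.coeff (∑ u, Finsupp.single (f u) 1)) heq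
  simp only [hmon, MvPolynomial.coeff_sum, MvPolynomial.coeff_monomial] at hc
  rw [Finset.sum_eq_zero (s := F2) fun g hg => if_neg (hcon g hg)] at hc
  have : (0 : ℝ) < ∑ g ∈ F1, if ∑ u, Finsupp.single (g u) (1 : ℕ) = ∑ u, Finsupp.single (f u) 1
      then 1 else 0 := by
    refine Finset.sum_pos' (fun g _ => by split_ifs <;> norm_num) ⟨f, hf, ?_⟩
    rw [if_pos rfl]
    exact one_pos
  exact this.ne' hc

/-- Adjacency in `S`, extended to a new vertex `none` related to all vertices. -/
def apexRel {U : Type} (S : SimpleGraph U) : Option U → Option U → Prop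
  | some a, some b => S.Adj a b
  | none, _ => True
  | some _, none => True

/-- The graph `S` with an apex, with given positive weights. -/
noncomputable def apexTarget {U : Type} [Fintype U] (S : SimpleGraph U) (x : Option U → ℝ)
    (hx : ∀ t, 0 < x t) : Target where
  carrier := Option U
  rel := apexRel S
  symm := by
    rintro (_ | a) (_ | b) h
    exacts [trivial, trivial, trivial, S.adj_symm h]
  loop := ⟨none, trivial⟩
  weight t := x t / ∑ s, x s
  pos t := div_pos (hx t) (Finset.sum_pos (fun s _ => hx s) ⟨none, Finset.mem_univ _⟩)
  sum_eq := by
    rw [← Finset.sum_div]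
    exact div_self (Finset.sum_pos (fun s _ => hx s) ⟨none, Finset.mem_univ _⟩).ne'

/-- The graph without the edges at labeled vertices. -/
def dropL (B : SimpleGraph (L ⊕ Y)) : SimpleGraph (L ⊕ Y) where
  Adj a b := B.Adj a b ∧ a.isRight ∧ b.isRight
  symm := ⟨fun _ _ h => ⟨h.1.symm, h.2.2, h.2.1⟩⟩
  loopless := ⟨fun _ h => B.loopless.irrefl _ h.1⟩

@[simp] theorem dropL_adj (B : SimpleGraph (L ⊕ Y)) (a b : L ⊕ Y) :
    (dropL B).Adj a b ↔ B.Adj a b ∧ a.isRight ∧ b.isRight := Iff.rfl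

variable [Fintype L] [Fintype X] [Fintype Y]

/-- The inclusion of the labels in the apex target. -/
noncomputable def apexIncl (S : SimpleGraph (L ⊕ X)) (x : Option (L ⊕ X) → ℝ)
    (hx : ∀ t, 0 < x t) : L → (apexTarget S x hx).carrier :=
  fun l => (some (Sum.inl l) : Option (L ⊕ X))

/-- The map taking all labels to the apex. -/
noncomputable def apexConst (S : SimpleGraph (L ⊕ X)) (x : Option (L ⊕ X) → ℝ)
    (hx : ∀ t, 0 < x t) : L → (apexTarget S x hx).carrier :=
  fun _ => (none : Option (L ⊕ X))

/-- The apex is related to everything, so edges at labeled vertices impose no condition when all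
labels are sent there. -/
theorem extDensity_apexConst (S : SimpleGraph (L ⊕ X)) (x : Option (L ⊕ X) → ℝ)
    (hx : ∀ t, 0 < x t) (B : SimpleGraph (L ⊕ Y)) (φ : L → (apexTarget S x hx).carrier) :
    extDensity (apexTarget S x hx) B (apexConst S x hx) =
      extDensity (apexTarget S x hx) (dropL B) φ := by
  classical
  unfold extDensity
  refine Finset.sum_congr rfl fun f _ => if_congr ?_ rfl rfl
  constructor
  · rintro h (a | a) (b | b) ⟨hab, h1, h2⟩
    · simp at h1
    · simp at h1
    · simp at h2
    · exact h (Sum.inr a) (Sum.inr b) hab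
  · rintro h (a | a) (b | b) hab
    · exact trivial
    · exact trivial
    · exact (apexTarget S x hx).symm none _ trivial
    · exact h (Sum.inr a) (Sum.inr b) ⟨hab, rfl, rfl⟩

/-- As functions of the weights, the densities are polynomials over a common denominator. The
inclusion of `X` contributes a squarefree monomial for `S`. The same monomial must come from some
map for `S'`, which therefore hits every vertex of `X` once and neither the apex nor a label. -/
theorem exists_bijective_hom (S S' : SimpleGraph (L ⊕ X))
    (h : ∀ x hx, extDensity (apexTarget S x hx) S (apexIncl S x hx) =
      extDensity (apexTarget S x hx) S' (apexIncl S x hx)) :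
    ∃ π : X ≃ X, ∀ a b, S'.Adj a b → S.Adj (Sum.map id π a) (Sum.map id π b) := by
  classical
  set φ : L → Option (L ⊕ X) := fun l => some (Sum.inl l) with hφ
  set F : SimpleGraph (L ⊕ X) → Finset (X → Option (L ⊕ X)) := fun S' =>
    Finset.univ.filter fun f => IsHomTo (apexRel S) S' (Sum.elim φ f) with hF
  have hF' : ∀ (S' : SimpleGraph (L ⊕ X)) x hx, extDensity (apexTarget S x hx) S' (apexIncl S x hx) =
      (∑ f ∈ F S', ∏ u, x (f u)) / (∑ s, x s) ^ Fintype.card X := by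
    intro S' x hx
    unfold extDensity
    show (∑ f : X → Option (L ⊕ X),
      if IsHomTo (apexRel S) S' (Sum.elim φ f) then ∏ u, x (f u) / ∑ s, x s else 0) = _
    rw [Finset.sum_filter, Finset.sum_div]
    refine Finset.sum_congr rfl fun f _ => ?_
    rw [ite_div, zero_div, Finset.prod_div_distrib, Finset.prod_const, Finset.card_univ]
  have hid : (fun u => some (Sum.inr u)) ∈ F S := by
    rw [hF, Finset.mem_filter]
    refine ⟨Finset.mem_univ _, ?_⟩
    rintro (a | a) (b | b) hab <;> exact hab
  obtain ⟨g, hg, hfib⟩ := exists_same_fibers (F S) (F S') (fun x hx => by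
    have hs : (0 : ℝ) < (∑ s, x s) ^ Fintype.card X :=
      pow_pos (Finset.sum_pos (fun s _ => hx s) ⟨none, Finset.mem_univ _⟩) _
    have := h x hx
    rw [hF', hF'] at this
    exact (div_left_inj' hs.ne').1 this) hid
  have hfib' : ∀ t, (∑ u, if g u = t then 1 else 0) =
      ∑ u : X, if (some (Sum.inr u) : Option (L ⊕ X)) = t then 1 else 0 := by
    intro t
    have := DFunLike.congr_fun hfib t
    simpa [Finsupp.single_apply, Finsupp.finsetSum_apply] using this
  have h1 : ∀ u, ∃ v, g u = some (Sum.inr v) := by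
    intro u
    by_contra hcon
    push Not at hcon
    have h2 := hfib' (g u)
    rw [Finset.sum_eq_zero (f := fun v : X => if (some (Sum.inr v) : Option (L ⊕ X)) = g u
      then 1 else 0) fun v _ => if_neg fun h => hcon v h.symm] at h2
    have := Finset.sum_eq_zero_iff.1 h2 u (Finset.mem_univ u)
    simp at this
  choose π hπ using h1
  have hsurj : Function.Surjective π := by
    intro v
    by_contra hcon
    push Not at hcon
    have h2 := hfib' (some (Sum.inr v))
    rw [Finset.sum_eq_zero (f := fun u : X => if g u = some (Sum.inr v) then 1 else 0)
      fun u _ => if_neg fun h => hcon u (by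
        rw [hπ] at h
        exact Sum.inr_injective (Option.some_injective _ h))] at h2
    have := Finset.sum_eq_zero_iff.1 h2.symm v (Finset.mem_univ v)
    simp at this
  refine ⟨Equiv.ofBijective π (Finite.injective_iff_surjective.2 hsurj |> fun h => ⟨h, hsurj⟩), ?_⟩
  have hg' := (Finset.mem_filter.1 hg).2
  rintro (a | a) (b | b) hab
  · exact hg' _ _ hab
  · have := hg' _ _ hab
    rwa [Sum.elim_inl, Sum.elim_inr, hπ] at this
  · have := hg' _ _ hab
    rwa [Sum.elim_inl, Sum.elim_inr, hπ] at this
  · have := hg' _ _ hab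
    rwa [Sum.elim_inr, Sum.elim_inr, hπ, hπ] at this

/-- If homomorphism densities do not separate `A` and `B` strictly, then `A` with the unlabeled
part of `B` added is isomorphic to `B` with the unlabeled part of `A` added, the isomorphism
fixing the labels. -/
theorem exists_strict_or_iso (A : SimpleGraph (L ⊕ X)) (B : SimpleGraph (L ⊕ Y)) :
    (∃ T : Target, homDensity T (glue A B) ^ 2 <
      homDensity T (glue A A) * homDensity T (glue B B)) ∨
    ∃ π : X ⊕ Y ≃ X ⊕ Y, ∀ a b, (glue A (dropL B)).Adj (Sum.map id π a) (Sum.map id π b) ↔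
      (glue (dropL A) B).Adj a b := by
  classical
  by_cases hT : ∃ T : Target, homDensity T (glue A B) ^ 2 <
      homDensity T (glue A A) * homDensity T (glue B B)
  · exact Or.inl hT
  · right
    push Not at hT
    have key : ∀ (U : SimpleGraph (L ⊕ (X ⊕ Y))) x hx,
        extDensity (apexTarget U x hx) (glue A (dropL B)) (apexIncl U x hx) =
        extDensity (apexTarget U x hx) (glue (dropL A) B) (apexIncl U x hx) := by
      intro U x hx
      by_contra hne
      -- Compare the labels in their own places with all labels at the apex. Equality in
      -- Cauchy-Schwarz forces the corresponding 2×2 minor to vanish.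
      refine (hT (apexTarget U x hx)).not_gt ((homDensity_glue (apexTarget U x hx) A B).2
        (apexIncl U x hx) (apexConst U x hx) ?_)
      rw [extDensity_glue, extDensity_glue] at hne
      rw [extDensity_apexConst U x hx B (apexIncl U x hx),
        extDensity_apexConst U x hx A (apexIncl U x hx)]
      exact hne
    obtain ⟨π, hπ⟩ := exists_bijective_hom (glue A (dropL B)) (glue (dropL A) B) (key _)
    obtain ⟨ρ, hρ⟩ := exists_bijective_hom (glue (dropL A) B) (glue A (dropL B))
      fun x hx => (key _ x hx).symm
    refine ⟨π, fun a b => ⟨fun hab => ?_, hπ a b⟩⟩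
    set D : SimpleGraph (L ⊕ (X ⊕ Y)) → Finset ((L ⊕ (X ⊕ Y)) × (L ⊕ (X ⊕ Y))) := fun G =>
      Finset.univ.filter fun q => G.Adj q.1 q.2 with hD
    have hcard : ∀ (G G' : SimpleGraph (L ⊕ (X ⊕ Y))) (σ : X ⊕ Y ≃ X ⊕ Y),
        (∀ a b, G.Adj a b → G'.Adj (Sum.map id σ a) (Sum.map id σ b)) →
        ((D G).image (Prod.map (Sum.map id σ) (Sum.map id σ))).card = (D G).card ∧
        (D G).image (Prod.map (Sum.map id σ) (Sum.map id σ)) ⊆ D G' := by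
      intro G G' σ h
      have hinj : Function.Injective (Sum.map (id : L → L) σ) :=
        Function.injective_id.sumMap σ.injective
      refine ⟨Finset.card_image_of_injective _ (hinj.prodMap hinj), ?_⟩
      intro q hq
      obtain ⟨⟨a, b⟩, hab, rfl⟩ := Finset.mem_image.1 hq
      exact Finset.mem_filter.2 ⟨Finset.mem_univ _, h a b (Finset.mem_filter.1 hab).2⟩
    obtain ⟨c1, s1⟩ := hcard _ _ π hπ
    obtain ⟨c2, s2⟩ := hcard _ _ ρ hρ
    -- Bijective homomorphisms in both directions force equal numbers of darts, so `π` also reflects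
    -- adjacency.
    have e1 := Finset.eq_of_subset_of_card_le s1 (by
      rw [c1, ← c2]
      exact Finset.card_le_card s2)
    have hmem : (Sum.map id π a, Sum.map id π b) ∈ D (glue A (dropL B)) :=
      Finset.mem_filter.2 ⟨Finset.mem_univ _, hab⟩
    rw [← e1] at hmem
    obtain ⟨⟨a', b'⟩, hab', heq⟩ := Finset.mem_image.1 hmem
    have hinj : Function.Injective (Sum.map (id : L → L) π) :=
      Function.injective_id.sumMap π.injective
    obtain ⟨h1, h2⟩ := Prod.mk.inj heq
    rw [← hinj h1, ← hinj h2]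
    exact (Finset.mem_filter.1 hab').2

end Apex

/-! ### Isomorphisms behind proportional rows -/

section Proportional

variable {L X Y Z : Type}

/-- The isomorphism between `A D` with the unlabeled part of `B` added, and the product of `D` with
`A` and the unlabeled part of `B`. -/
def glueDropIso (A : SimpleGraph (L ⊕ X)) (B : SimpleGraph (L ⊕ Y)) (D : SimpleGraph (L ⊕ Z)) :
    (glue A D ⊕g B.comap Sum.inr) ≃g glue (glue A (dropL B)) D where
  toFun := Sum.elim (Sum.map id (Sum.map Sum.inl id)) fun y => Sum.inr (Sum.inl (Sum.inr y))
  invFun := Sum.elim (fun l => Sum.inl (Sum.inl l)) (Sum.elim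
    (Sum.elim (fun x => Sum.inl (Sum.inr (Sum.inl x))) Sum.inr)
    fun z => Sum.inl (Sum.inr (Sum.inr z)))
  left_inv := by rintro ((a | a | a) | a) <;> rfl
  right_inv := by rintro (a | (a | a) | a) <;> rfl
  map_rel_iff' := by
    rintro ((a | a | a) | a) ((b | b | b) | b) <;> simp

/-- The isomorphism between `B D` with the unlabeled part of `A` added, and the product of `D` with
`B` and the unlabeled part of `A`. -/
def glueDropIso' (A : SimpleGraph (L ⊕ X)) (B : SimpleGraph (L ⊕ Y)) (D : SimpleGraph (L ⊕ Z)) :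
    (glue B D ⊕g A.comap Sum.inr) ≃g glue (glue (dropL A) B) D where
  toFun := Sum.elim (Sum.map id (Sum.map Sum.inr id)) fun y => Sum.inr (Sum.inl (Sum.inl y))
  invFun := Sum.elim (fun l => Sum.inl (Sum.inl l)) (Sum.elim
    (Sum.elim Sum.inr (fun x => Sum.inl (Sum.inr (Sum.inl x))))
    fun z => Sum.inl (Sum.inr (Sum.inr z)))
  left_inv := by rintro ((a | a | a) | a) <;> rfl
  right_inv := by rintro (a | (a | a) | a) <;> rfl
  map_rel_iff' := by
    rintro ((a | a | a) | a) ((b | b | b) | b) <;> simp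

/-- Gluing respects isomorphisms fixing the labels. -/
def glueCongrIso {S S' : SimpleGraph (L ⊕ X)} (π : X ≃ X)
    (hπ : ∀ a b, S.Adj (Sum.map id π a) (Sum.map id π b) ↔ S'.Adj a b) (D : SimpleGraph (L ⊕ Z)) :
    glue S' D ≃g glue S D where
  toEquiv := Equiv.sumCongr (Equiv.refl L) (Equiv.sumCongr π (Equiv.refl Z))
  map_rel_iff' := by
    have h1 : ∀ a b, S.Adj (Sum.inl a) (Sum.inl b) ↔ S'.Adj (Sum.inl a) (Sum.inl b) :=
      fun a b => hπ (Sum.inl a) (Sum.inl b)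
    have h2 : ∀ a b, S.Adj (Sum.inl a) (Sum.inr (π b)) ↔ S'.Adj (Sum.inl a) (Sum.inr b) :=
      fun a b => hπ (Sum.inl a) (Sum.inr b)
    have h3 : ∀ a b, S.Adj (Sum.inr (π a)) (Sum.inl b) ↔ S'.Adj (Sum.inr a) (Sum.inl b) :=
      fun a b => hπ (Sum.inr a) (Sum.inl b)
    have h4 : ∀ a b, S.Adj (Sum.inr (π a)) (Sum.inr (π b)) ↔ S'.Adj (Sum.inr a) (Sum.inr b) :=
      fun a b => hπ (Sum.inr a) (Sum.inr b)
    rintro (a | a | a) (b | b | b) <;> simp [h1, h2, h3, h4]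

end Proportional

/-! ### Unlabeled graphs up to isolated vertices, components, and representatives -/

section UClass

variable {V W U : Type} [Finite V] [Finite W] [Finite U]

theorem noIsolated_induce_support (G : SimpleGraph V) : NoIsolated (G.induce G.support) := by
  rintro ⟨v, hv⟩
  obtain ⟨w, hw⟩ := G.mem_support.1 hv
  exact ⟨⟨w, G.mem_support.2 ⟨v, hw.symm⟩⟩, hw⟩

/-- The unlabeled graph obtained by dropping the isolated vertices. -/
noncomputable def uclass (G : SimpleGraph V) : UGraph :=
  UGraph.mk (G.induce G.support) (noIsolated_induce_support G)

theorem uclass_eq_of_isCore {e : V ↪ W} {G : SimpleGraph V} {G' : SimpleGraph W}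
    (h : IsCore e G G') : uclass G' = uclass G := by
  refine ((UGraph.mk_eq_mk_iff _ _).2 ⟨?_⟩).symm
  have hmem : ∀ v, v ∈ G.support → e v ∈ G'.support := fun v hv => by
    obtain ⟨w, hw⟩ := G.mem_support.1 hv
    exact G'.mem_support.2 ⟨e w, (h.adj_iff v w).2 hw⟩
  refine ⟨Equiv.ofBijective (fun v : G.support => (⟨e v.1, hmem v.1 v.2⟩ : G'.support))
    ⟨fun a b hab => Subtype.ext (e.injective (congrArg Subtype.val hab)), ?_⟩, ?_⟩
  · rintro ⟨w, hw⟩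
    obtain ⟨w', hw'⟩ := G'.mem_support.1 hw
    obtain ⟨a, b, hab, rfl, rfl⟩ := h.exists_of_adj hw'
    exact ⟨⟨a, G.mem_support.2 ⟨b, hab⟩⟩, rfl⟩
  · intro a b
    exact h.adj_iff a.1 b.1

theorem isCore_induce_support (G : SimpleGraph V) :
    IsCore (Function.Embedding.subtype (· ∈ G.support)) (G.induce G.support) G :=
  ⟨fun _ _ => Iff.rfl, fun a b hab => ⟨⟨a, G.mem_support.2 ⟨b, hab⟩⟩, rfl⟩⟩

theorem uclass_eq_mk {G : SimpleGraph V} (h : NoIsolated G) : uclass G = UGraph.mk G h := by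
  refine (UGraph.mk_eq_mk_iff _ _).2 ⟨⟨Equiv.ofBijective Subtype.val
    ⟨Subtype.val_injective, fun v => ⟨⟨v, G.mem_support.2 (h v)⟩, rfl⟩⟩, ?_⟩⟩
  intro a b
  exact Iff.rfl

/-- The unlabeled graph obtained by identifying vertices of `A` and `B` depends only on which
vertices are identified. -/
theorem uclass_sup_map_congr {VA VB : Type} (A : SimpleGraph VA) (B : SimpleGraph VB)
    {α : VA → V} {β : VB → V} {α' : VA → W} {β' : VB → W}
    (hα : Function.Injective α) (hβ : Function.Injective β) (hα' : Function.Injective α')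
    (hβ' : Function.Injective β') (h : ∀ a b, α a = β b ↔ α' a = β' b) :
    uclass (A.map α ⊔ B.map β) = uclass (A.map α' ⊔ B.map β') := by
  have hex : ∀ w : {w : V // (∃ a, α a = w) ∨ ∃ b, β b = w},
      ∃ w', (∀ a, α a = w.1 → α' a = w') ∧ ∀ b, β b = w.1 → β' b = w' := by
    rintro ⟨w, ⟨a, rfl⟩ | ⟨b, rfl⟩⟩
    · exact ⟨α' a, fun a' ha' => by rw [hα ha'], fun b hb => ((h a b).1 hb.symm).symm⟩
    · exact ⟨β' b, fun a ha => (h a b).1 ha, fun b' hb' => by rw [hβ hb']⟩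
  choose f hfα hfβ using hex
  have hinj : Function.Injective f := by
    rintro ⟨w, hw⟩ ⟨w', hw'⟩ hff
    rcases id hw with ⟨a, rfl⟩ | ⟨b, rfl⟩ <;> rcases id hw' with ⟨a', rfl⟩ | ⟨b', rfl⟩
    · rw [← hfα ⟨_, hw⟩ a rfl, ← hfα ⟨_, hw'⟩ a' rfl] at hff
      rw [Subtype.mk.injEq, hα' hff]
    · rw [← hfα ⟨_, hw⟩ a rfl, ← hfβ ⟨_, hw'⟩ b' rfl] at hff
      rw [Subtype.mk.injEq, (h a b').2 hff]
    · rw [← hfβ ⟨_, hw⟩ b rfl, ← hfα ⟨_, hw'⟩ a' rfl] at hff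
      rw [Subtype.mk.injEq, (h a' b).2 hff.symm]
    · rw [← hfβ ⟨_, hw⟩ b rfl, ← hfβ ⟨_, hw'⟩ b' rfl] at hff
      rw [Subtype.mk.injEq, hβ' hff]
  have h1 : IsCore (Function.Embedding.subtype _)
      ((A.map α ⊔ B.map β).comap (Subtype.val : {w : V // (∃ a, α a = w) ∨ ∃ b, β b = w} → V))
      (A.map α ⊔ B.map β) := by
    refine ⟨fun _ _ => Iff.rfl, fun a b hab => ?_⟩
    rcases hab with hab | hab
    · obtain ⟨-, u, v, -, rfl, rfl⟩ := (map_adj' _ _ _ _).1 hab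
      exact ⟨⟨α u, Or.inl ⟨u, rfl⟩⟩, rfl⟩
    · obtain ⟨-, u, v, -, rfl, rfl⟩ := (map_adj' _ _ _ _).1 hab
      exact ⟨⟨β u, Or.inr ⟨u, rfl⟩⟩, rfl⟩
  have h2 : IsCore ⟨f, hinj⟩
      ((A.map α ⊔ B.map β).comap (Subtype.val : {w : V // (∃ a, α a = w) ∨ ∃ b, β b = w} → V))
      (A.map α' ⊔ B.map β') := by
    constructor
    · rintro x y
      simp only [Function.Embedding.coeFn_mk, sup_adj, comap_adj, map_adj', ne_eq]
      constructor
      · rintro (⟨hne, u, v, huv, hu, hv⟩ | ⟨hne, u, v, huv, hu, hv⟩)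
        · left
          have hu' : f ⟨α u, Or.inl ⟨u, rfl⟩⟩ = f x := by rw [← hfα _ u rfl, hu]
          have hv' : f ⟨α v, Or.inl ⟨v, rfl⟩⟩ = f y := by rw [← hfα _ v rfl, hv]
          rw [← hinj hu', ← hinj hv']
          exact ⟨fun h => huv.ne (hα h), u, v, huv, rfl, rfl⟩
        · right
          have hu' : f ⟨β u, Or.inr ⟨u, rfl⟩⟩ = f x := by rw [← hfβ _ u rfl, hu]
          have hv' : f ⟨β v, Or.inr ⟨v, rfl⟩⟩ = f y := by rw [← hfβ _ v rfl, hv]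
          rw [← hinj hu', ← hinj hv']
          exact ⟨fun h => huv.ne (hβ h), u, v, huv, rfl, rfl⟩
      · rintro (⟨hne, u, v, huv, hu, hv⟩ | ⟨hne, u, v, huv, hu, hv⟩)
        · left
          rw [← hfα x u hu, ← hfα y v hv]
          exact ⟨fun h => huv.ne (hα' h), u, v, huv, rfl, rfl⟩
        · right
          rw [← hfβ x u hu, ← hfβ y v hv]
          exact ⟨fun h => huv.ne (hβ' h), u, v, huv, rfl, rfl⟩
    · rintro a b (hab | hab)
      · obtain ⟨-, u, v, -, rfl, rfl⟩ := (map_adj' _ _ _ _).1 hab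
        exact ⟨⟨α u, Or.inl ⟨u, rfl⟩⟩, (hfα _ u rfl).symm⟩
      · obtain ⟨-, u, v, -, rfl, rfl⟩ := (map_adj' _ _ _ _).1 hab
        exact ⟨⟨β u, Or.inr ⟨u, rfl⟩⟩, (hfβ _ u rfl).symm⟩
  rw [uclass_eq_of_isCore h1, uclass_eq_of_isCore h2]

theorem uclass_sup_of_disjoint {G H : SimpleGraph V} (h : Disjoint G.support H.support) :
    uclass (G ⊔ H) = uclass G * uclass H := by
  have hd : ∀ v, v ∈ G.support → v ∉ H.support := fun v hv => Set.disjoint_left.1 h hv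
  have hinj : Function.Injective (Sum.elim (Subtype.val : G.support → V)
      (Subtype.val : H.support → V)) :=
    Function.Injective.sumElim Subtype.val_injective Subtype.val_injective
      fun a b hab => hd a.1 a.2 (hab ▸ b.2)
  have hc : IsCore ⟨_, hinj⟩ (G.induce G.support ⊕g H.induce H.support) (G ⊔ H) := by
    constructor
    · rintro (⟨a, ha⟩ | ⟨a, ha⟩) (⟨b, hb⟩ | ⟨b, hb⟩)
      · simp only [Function.Embedding.coeFn_mk, Sum.elim_inl, sup_adj, sum_adj_inl]
        refine ⟨fun hab => hab.resolve_right fun h' => ?_, fun hab => Or.inl hab⟩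
        exact hd a ha (H.mem_support.2 ⟨b, h'⟩)
      · simp only [Function.Embedding.coeFn_mk, Sum.elim_inl, Sum.elim_inr, sup_adj,
          not_adj_sum_inl_inr, iff_false]
        rintro (h' | h')
        · exact hd b (G.mem_support.2 ⟨a, h'.symm⟩) hb
        · exact hd a ha (H.mem_support.2 ⟨b, h'⟩)
      · simp only [Function.Embedding.coeFn_mk, Sum.elim_inl, Sum.elim_inr, sup_adj,
          not_adj_sum_inr_inl, iff_false]
        rintro (h' | h')
        · exact hd a (G.mem_support.2 ⟨b, h'⟩) ha
        · exact hd b hb (H.mem_support.2 ⟨a, h'.symm⟩)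
      · simp only [Function.Embedding.coeFn_mk, Sum.elim_inr, sup_adj, sum_adj_inr]
        refine ⟨fun hab => hab.resolve_left fun h' => ?_, fun hab => Or.inr hab⟩
        exact hd a (G.mem_support.2 ⟨b, h'⟩) ha
    · rintro a b (hab | hab)
      · exact ⟨Sum.inl ⟨a, G.mem_support.2 ⟨b, hab⟩⟩, rfl⟩
      · exact ⟨Sum.inr ⟨a, H.mem_support.2 ⟨b, hab⟩⟩, rfl⟩
  rw [uclass_eq_of_isCore hc, uclass_eq_mk ((noIsolated_induce_support G).sum
    (noIsolated_induce_support H)), ← UGraph.mk_mul_mk]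
  rfl

theorem uclass_bot : uclass (⊥ : SimpleGraph V) = 1 := by
  have : IsCore (⟨fun v : Fin 0 => v.elim0, fun v => v.elim0⟩ : Fin 0 ↪ V)
      (⊥ : SimpleGraph (Fin 0)) (⊥ : SimpleGraph V) :=
    ⟨fun v => v.elim0, fun a b hab => hab.elim⟩
  rw [uclass_eq_of_isCore this]
  exact uclass_eq_mk _

end UClass

section Components

/-- An unlabeled graph is the product of its connected components. -/
theorem FinGraph.prod_components (G : FinGraph) :
    G.components.prod = UGraph.mk G.graph G.noIsolated := by
  classical
  set H : Finset G.graph.ConnectedComponent → SimpleGraph (Fin G.n) := fun s =>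
    { Adj := fun a b => G.graph.Adj a b ∧ G.graph.connectedComponentMk a ∈ s
      symm := ⟨fun a b h => ⟨h.1.symm, by
        rw [ConnectedComponent.sound h.1.symm.reachable]
        exact h.2⟩⟩
      loopless := ⟨fun a h => G.graph.loopless.irrefl _ h.1⟩ } with hH
  have key : ∀ s : Finset G.graph.ConnectedComponent,
      ∏ c ∈ s, UGraph.mk c.toSimpleGraph (G.noIsolated.component c) = uclass (H s) := by
    intro s
    induction s using Finset.induction_on with
    | empty =>
      rw [Finset.prod_empty, ← uclass_bot (V := Fin G.n)]
      congr 1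
      ext a b
      simp [hH]
    | insert c s hc ih =>
      rw [Finset.prod_insert hc, ih]
      have h1 : H (insert c s) = H {c} ⊔ H s := by
        ext a b
        simp only [hH, Finset.mem_insert, Finset.mem_singleton, sup_adj]
        tauto
      have hd : Disjoint (H {c}).support (H s).support := by
        rw [Set.disjoint_left]
        intro v hv hv'
        obtain ⟨w, hw⟩ := (H {c}).mem_support.1 hv
        obtain ⟨w', hw'⟩ := (H s).mem_support.1 hv'
        have h2 := Finset.mem_singleton.1 hw.2
        exact hc (h2 ▸ hw'.2)
      have h3 : IsCore (Function.Embedding.subtype (· ∈ c)) c.toSimpleGraph (H {c}) := by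
        constructor
        · rintro ⟨a, ha⟩ ⟨b, hb⟩
          rw [ConnectedComponent.toSimpleGraph_adj c ha hb]
          exact ⟨fun h => h.1, fun h => ⟨h, Finset.mem_singleton.2 ha⟩⟩
        · intro a b hab
          exact ⟨⟨a, Finset.mem_singleton.1 hab.2⟩, rfl⟩
      rw [h1, uclass_sup_of_disjoint hd, uclass_eq_of_isCore h3,
        uclass_eq_mk (G.noIsolated.component c)]
  have h4 : H Finset.univ = G.graph := by
    ext a b
    simp [hH]
  have := key Finset.univ
  rw [h4, uclass_eq_mk G.noIsolated] at this
  rw [← this]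
  rfl

theorem UGraph.prod_components (x : UGraph) : x.components.prod = x := by
  obtain ⟨G, rfl⟩ := Quotient.exists_rep x
  exact G.prod_components.trans G.toUGraph_eq_mk.symm

theorem UGraph.connected_mk {V : Type} [Finite V] {G : SimpleGraph V} (h : NoIsolated G)
    (hG : G.Connected) : (UGraph.mk G h).Connected :=
  ⟨FinGraph.ofGraph G h, rfl, (Iso.connected_iff (Iso.map (Finite.equivFin V) G)).1 hG⟩

theorem UGraph.connected_of_mem_components {x C : UGraph} (h : C ∈ x.components) :
    C.Connected := by
  obtain ⟨G, rfl⟩ := Quotient.exists_rep x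
  change C ∈ G.components at h
  unfold FinGraph.components at h
  obtain ⟨c, -, rfl⟩ := Multiset.mem_map.1 h
  exact UGraph.connected_mk _ c.connected_toSimpleGraph

end Components

section Rep

/-- A representative of an unlabeled graph. -/
noncomputable def UGraph.rep (x : UGraph) : FinGraph := Quotient.out x

theorem UGraph.toUGraph_rep (x : UGraph) : x.rep.toUGraph = x := Quotient.out_eq x

theorem UGraph.mk_rep (x : UGraph) : UGraph.mk x.rep.graph x.rep.noIsolated = x := by
  rw [← FinGraph.toUGraph_eq_mk, x.toUGraph_rep]

theorem UGraph.exists_iso_rep {V : Type} [Finite V] {G : SimpleGraph V} (h : NoIsolated G) :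
    Nonempty ((UGraph.mk G h).rep.graph ≃g G) :=
  (UGraph.mk_eq_mk_iff (UGraph.mk G h).rep.noIsolated h).1 (UGraph.mk_rep _)

theorem exists_isCore_rep {V : Type} [Finite V] (G : SimpleGraph V) :
    ∃ e, IsCore e (uclass G).rep.graph G := by
  obtain ⟨f⟩ := UGraph.exists_iso_rep (noIsolated_induce_support G)
  refine ⟨f.toEquiv.toEmbedding.trans (Function.Embedding.subtype _), ?_⟩
  have h1 := IsCore.of_iso f
  have h2 := isCore_induce_support G
  refine ⟨fun a b => (h2.adj_iff _ _).trans (h1.adj_iff a b), fun a b hab => ?_⟩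
  obtain ⟨v, rfl⟩ := h2.mem_range a b hab
  exact ⟨f.symm v, congrArg Subtype.val (f.apply_symm_apply v)⟩

theorem numDarts_eq_two_mul {V : Type*} [Fintype V] (G : SimpleGraph V) :
    numDarts G = 2 * G.edgeSet.ncard := by
  classical
  rw [← coe_edgeFinset, Set.ncard_coe_finset, ← G.dart_card_eq_twice_card_edges, numDarts_eq_card]
  refine (Finset.card_bij' (s := (Finset.univ : Finset G.Dart)) (fun d _ => (d.fst, d.snd))
    (fun q hq => ⟨q, (Finset.mem_filter.1 hq).2⟩) ?_ ?_ ?_ ?_).symm <;> simp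

/-- The number of ordered pairs of adjacent vertices of an unlabeled graph. -/
noncomputable def UGraph.darts (x : UGraph) : ℕ := numDarts x.rep.graph

theorem UGraph.darts_mk {V : Type} [Fintype V] {G : SimpleGraph V} (h : NoIsolated G) :
    (UGraph.mk G h).darts = numDarts G := by
  obtain ⟨f⟩ := UGraph.exists_iso_rep h
  exact (IsCore.of_iso f).numDarts_eq.symm

theorem UGraph.darts_mul (x y : UGraph) : (x * y).darts = x.darts + y.darts := by
  rw [← x.mk_rep, ← y.mk_rep, UGraph.mk_mul_mk, UGraph.darts_mk, UGraph.darts_mk, UGraph.darts_mk,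
    numDarts_sum]

theorem UGraph.darts_one : (1 : UGraph).darts = 0 := by
  have hN : NoIsolated (⊥ : SimpleGraph (Fin 0)) := fun v => v.elim0
  have h : (1 : UGraph) = UGraph.mk (⊥ : SimpleGraph (Fin 0)) hN := rfl
  rw [h, UGraph.darts_mk]
  simp [numDarts, dartsIn]

theorem UGraph.darts_prod (s : Multiset UGraph) : s.prod.darts = (s.map UGraph.darts).sum := by
  induction s using Multiset.induction_on with
  | empty => simp [UGraph.darts_one]
  | cons a s ih => simp [UGraph.darts_mul, ih]

theorem UGraph.darts_le_of_mem_components {x C : UGraph} (h : C ∈ x.components) :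
    C.darts ≤ x.darts := by
  conv_rhs => rw [← x.prod_components, UGraph.darts_prod]
  exact Multiset.le_sum_of_mem (Multiset.mem_map_of_mem _ h)

end Rep

/-! ### Coordinates of the sos-profile -/

section ConnGraphs

theorem IsCore.map_eq {V W : Type*} {e : V ↪ W} {G : SimpleGraph V} {G' : SimpleGraph W}
    (h : IsCore e G G') : G.map e = G' := by
  ext a b
  rw [map_adj']
  constructor
  · rintro ⟨-, u, v, huv, rfl, rfl⟩
    exact (h.adj_iff u v).2 huv
  · intro hab
    obtain ⟨u, v, huv, rfl, rfl⟩ := h.exists_of_adj hab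
    exact ⟨hab.ne, u, v, huv, rfl, rfl⟩

theorem exists_labeled_copy {n : ℕ} (G : SimpleGraph (Fin n)) :
    ∃ (A : PLGraph) (e : A.labels ⊕ Fin A.unl ↪ Fin n), IsCore e A.graph G ∧ A.unl = 0 ∧
      ∀ l, (e (Sum.inl l)).val = l.1 := by
  classical
  set S : Finset ℕ := (Finset.univ.filter fun v => v ∈ G.support).map Fin.valEmbedding with hS
  have hmem : ∀ l ∈ S, ∃ v : Fin n, v.val = l ∧ v ∈ G.support := by
    intro l hl
    obtain ⟨v, hv, rfl⟩ := Finset.mem_map.1 hl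
    exact ⟨v, rfl, (Finset.mem_filter.1 hv).2⟩
  have hS' : ∀ v ∈ G.support, v.val ∈ S := fun v hv =>
    Finset.mem_map.2 ⟨v, Finset.mem_filter.2 ⟨Finset.mem_univ _, hv⟩, rfl⟩
  choose f hf1 hf2 using hmem
  set e : S ⊕ Fin 0 → Fin n := Sum.elim (fun l => f l.1 l.2) (fun i => i.elim0) with he
  have hinj : Function.Injective e := by
    rintro (⟨a, ha⟩ | a) (⟨b, hb⟩ | b) hab
    · have : a = b := by
        rw [← hf1 a ha, ← hf1 b hb]
        exact congrArg Fin.val hab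
      subst this
      rfl
    · exact b.elim0
    · exact a.elim0
    · exact a.elim0
  have hrange : ∀ v ∈ G.support, ∃ x, e x = v := fun v hv =>
    ⟨Sum.inl ⟨v.val, hS' v hv⟩, Fin.ext (hf1 _ _)⟩
  refine ⟨⟨S, 0, G.comap e, ?_⟩, ⟨e, hinj⟩, ⟨fun _ _ => Iff.rfl, fun a b hab =>
    hrange a (G.mem_support.2 ⟨b, hab⟩)⟩, rfl, fun l => hf1 _ _⟩
  rintro (⟨l, hl⟩ | i)
  · obtain ⟨w, hw⟩ := G.mem_support.1 (hf2 l hl)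
    obtain ⟨x, rfl⟩ := hrange w (G.mem_support.2 ⟨_, hw.symm⟩)
    exact ⟨x, hw⟩
  · exact i.elim0

theorem PLGraph.unlabel_mul (A B : PLGraph) : (A * B).unlabel =
    uclass (A.graph.map (PLGraph.inLeft A B) ⊔ B.graph.map (PLGraph.inRight A B)) :=
  (uclass_eq_mk (A * B).noIsolated).symm

/-- Gluing two fully labeled graphs is taking the union of the underlying graphs. -/
theorem unlabel_mul_labeled {n : ℕ} {G H : SimpleGraph (Fin n)} {A B : PLGraph}
    {eA : A.labels ⊕ Fin A.unl ↪ Fin n} {eB : B.labels ⊕ Fin B.unl ↪ Fin n}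
    (hA : IsCore eA A.graph G) (hB : IsCore eB B.graph H) (hA0 : A.unl = 0) (hB0 : B.unl = 0)
    (hAl : ∀ l, (eA (Sum.inl l)).val = l.1) (hBl : ∀ l, (eB (Sum.inl l)).val = l.1) :
    (A * B).unlabel = uclass (G ⊔ H) := by
  rw [PLGraph.unlabel_mul, ← hA.map_eq, ← hB.map_eq]
  refine uclass_sup_map_congr _ _ (PLGraph.inLeft_injective A B) (PLGraph.inRight_injective A B)
    eA.injective eB.injective ?_
  rintro (a | a) (b | b)
  · simp only [PLGraph.inLeft, PLGraph.inRight, Sum.map_inl, Sum.inl.injEq, Subtype.mk.injEq]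
    rw [← hAl, ← hBl, Fin.val_inj]
  · exact (b.cast hB0).elim0
  · exact (a.cast hA0).elim0
  · exact (a.cast hA0).elim0

theorem PLGraph.numDarts_graph (A : PLGraph) : numDarts A.graph = 2 * A.numEdges :=
  numDarts_eq_two_mul _

/-- Label all vertices and distribute the at most `2d` edges over two graphs with at most `d` edges
each. -/
theorem mem_connGraphs {d : ℕ} {C : UGraph} (hC : C.Connected) (h : C.darts ≤ 4 * d) :
    C ∈ connGraphs d := by
  classical
  refine ⟨hC, ?_⟩
  set G := C.rep.graph with hG
  have hE : G.edgeFinset.card ≤ 2 * d := by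
    have h1 : numDarts G ≤ 4 * d := h
    rw [numDarts_eq_two_mul, ← coe_edgeFinset, Set.ncard_coe_finset] at h1
    omega
  obtain ⟨E, hEs, hEc⟩ := Finset.exists_subset_card_eq (min_le_right d G.edgeFinset.card)
  have hnd : ∀ E' ⊆ G.edgeFinset, numDarts (fromEdgeSet (E' : Set (Sym2 (Fin C.rep.n)))) =
      2 * E'.card := by
    intro E' hE'
    rw [numDarts_eq_two_mul, edgeSet_fromEdgeSet, ← Set.ncard_coe_finset E']
    congr 2
    rw [sdiff_eq_left, Set.disjoint_left]
    intro e he hd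
    exact G.not_isDiag_of_mem_edgeSet (mem_edgeFinset.1 (hE' he)) hd
  obtain ⟨A, eA, hA, hA0, hAl⟩ :=
    exists_labeled_copy (fromEdgeSet (E : Set (Sym2 (Fin C.rep.n))))
  obtain ⟨B, eB, hB, hB0, hBl⟩ :=
    exists_labeled_copy (fromEdgeSet ((G.edgeFinset \ E : Finset _) : Set (Sym2 (Fin C.rep.n))))
  refine ⟨A, B, ?_, ?_, ?_⟩
  · have := hnd E hEs
    rw [hA.numDarts_eq, A.numDarts_graph] at this
    omega
  · have := hnd _ (Finset.sdiff_subset : G.edgeFinset \ E ⊆ G.edgeFinset)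
    rw [hB.numDarts_eq, B.numDarts_graph, Finset.card_sdiff_of_subset hEs] at this
    omega
  · have hun : fromEdgeSet (E : Set (Sym2 (Fin C.rep.n))) ⊔
        fromEdgeSet ((G.edgeFinset \ E : Finset _) : Set (Sym2 (Fin C.rep.n))) = G := by
      rw [← fromEdgeSet_union, ← Finset.coe_union, Finset.union_sdiff_of_subset hEs, coe_edgeFinset,
        fromEdgeSet_edgeSet]
    rw [unlabel_mul_labeled hA hB hA0 hB0 hAl hBl, hun, uclass_eq_mk C.rep.noIsolated, C.mk_rep]

theorem numDarts_map {V W : Type*} [Fintype V] [Fintype W] {f : V → W}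
    (hf : Function.Injective f) (G : SimpleGraph V) : numDarts (G.map f) = numDarts G := by
  refine IsCore.numDarts_eq (e := ⟨f, hf⟩) ⟨fun a b => ?_, fun a b hab => ?_⟩
  · rw [map_adj']
    constructor
    · rintro ⟨-, u, v, huv, hu, hv⟩
      rwa [← hf hu, ← hf hv]
    · exact fun hab => ⟨fun h => hab.ne (hf h), a, b, hab, rfl, rfl⟩
  · obtain ⟨-, u, v, -, rfl, -⟩ := (map_adj' _ _ _ _).1 hab
    exact ⟨u, rfl⟩

theorem numDarts_sup_le {V : Type*} [Fintype V] (G H : SimpleGraph V) :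
    numDarts (G ⊔ H) ≤ numDarts G + numDarts H := by
  classical
  rw [numDarts_eq_card, numDarts_eq_card, numDarts_eq_card]
  refine le_trans (Finset.card_le_card fun q hq => ?_) (Finset.card_union_le _ _)
  simpa using hq

theorem components_subset_connGraphs {d : ℕ} {A B : PLGraph} (hA : A.numEdges ≤ d)
    (hB : B.numEdges ≤ d) : ∀ C ∈ (A * B).unlabel.components, C ∈ connGraphs d := by
  intro C hC
  refine mem_connGraphs (UGraph.connected_of_mem_components hC)
    ((UGraph.darts_le_of_mem_components hC).trans ?_)
  have h1 : (A * B).unlabel.darts = numDarts (A * B).graph := UGraph.darts_mk _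
  have h2 : numDarts (A * B).graph ≤ numDarts (A.graph.map (PLGraph.inLeft A B)) +
      numDarts (B.graph.map (PLGraph.inRight A B)) := numDarts_sup_le _ _
  rw [numDarts_map (PLGraph.inLeft_injective A B), numDarts_map (PLGraph.inRight_injective A B),
    A.numDarts_graph, B.numDarts_graph] at h2
  omega

/-- Each vertex is the start of a dart, since none is isolated. So graphs with at most `d` edges fit
on `2d` points. -/
theorem PLGraph.card_le (A : PLGraph) : A.labels.card + A.unl ≤ 2 * A.numEdges := by
  classical
  rw [← A.numDarts_graph, numDarts_eq_card]
  have h1 : Fintype.card (A.labels ⊕ Fin A.unl) = A.labels.card + A.unl := by simp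
  rw [← h1, ← Finset.card_univ]
  choose f hf using A.noIsolated
  exact Finset.card_le_card_of_injOn (fun v => (v, f v))
    (fun v _ => by simpa using hf v) (fun a _ b _ hab => congrArg Prod.fst hab)

end ConnGraphs

/-! ### Entrywise powers of matrices, and inclusion-exclusion -/

section Form

/-- A form is nonnegative if its matrix has ones on the diagonal between equal rows and is small
off the diagonal between different rows. -/
theorem form_nonneg_of_rep {ι : Type*} [Fintype ι] [DecidableEq ι] (N : ι → ι → ℝ)
    (rep : ι → ι) (s : ℕ) (hrep : ∀ a b, N a b = N (rep a) (rep b)) (hone : ∀ a, N a a = 1)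
    (hnn : ∀ a b, 0 ≤ N a b)
    (hs : ∀ a b, rep a ≠ rep b → Fintype.card ι * N (rep a) (rep b) ^ s ≤ 1) (c : ι → ℝ) :
    0 ≤ ∑ a, ∑ b, c a * c b * N a b ^ s := by
  classical
  -- Coefficients of equal rows are collected at their representative. Afterwards the diagonal
  -- entries are 1 and the other relevant entries are at most `1 / |ι|`.
  set c' : ι → ℝ := fun P => ∑ a ∈ Finset.univ.filter (fun a => rep a = P), c a with hc'
  have h1 : ∑ a, ∑ b, c a * c b * N a b ^ s = ∑ P, ∑ Q, c' P * c' Q * N P Q ^ s := by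
    have e1 : ∀ P Q, c' P * c' Q * N P Q ^ s =
        ∑ a, ∑ b, if rep a = P then (if rep b = Q then c a * c b * N P Q ^ s else 0) else 0 := by
      intro P Q
      simp only [hc']
      rw [Finset.sum_filter, Finset.sum_filter, Finset.sum_mul_sum, Finset.sum_mul]
      refine Finset.sum_congr rfl fun a _ => ?_
      rw [Finset.sum_mul]
      refine Finset.sum_congr rfl fun b _ => ?_
      split_ifs <;> simp
    symm
    calc ∑ P, ∑ Q, c' P * c' Q * N P Q ^ s
        = ∑ P, ∑ a, ∑ Q, ∑ b, (if rep a = P then (if rep b = Q then c a * c b * N P Q ^ s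
          else 0) else 0) := by
          simp_rw [e1]
          exact Finset.sum_congr rfl fun P _ => Finset.sum_comm
      _ = ∑ a, ∑ P, ∑ b, ∑ Q, (if rep a = P then (if rep b = Q then c a * c b * N P Q ^ s
          else 0) else 0) := by
          rw [Finset.sum_comm]
          exact Finset.sum_congr rfl fun a _ => Finset.sum_congr rfl fun P _ => Finset.sum_comm
      _ = ∑ a, ∑ b, ∑ P, ∑ Q, (if rep a = P then (if rep b = Q then c a * c b * N P Q ^ s
          else 0) else 0) := Finset.sum_congr rfl fun a _ => Finset.sum_comm
      _ = ∑ a, ∑ b, c a * c b * N a b ^ s := by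
          refine Finset.sum_congr rfl fun a _ => Finset.sum_congr rfl fun b _ => ?_
          rw [Finset.sum_eq_single (rep a) (fun P _ hP => by simp [hP.symm]) (by simp)]
          rw [Finset.sum_eq_single (rep b) (fun P _ hP => by simp [hP.symm]) (by simp)]
          rw [if_pos rfl, if_pos rfl, ← hrep]
  rw [h1]
  have hk : (0 : ℝ) ≤ Fintype.card ι := Nat.cast_nonneg _
  rcases isEmpty_or_nonempty ι with hemp | hne
  · simp
  have hk' : (0 : ℝ) < Fintype.card ι := Nat.cast_pos.2 Fintype.card_pos
  have hzero : ∀ P, c' P ≠ 0 → ∃ a, rep a = P := by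
    intro P hP
    by_contra hcon
    push Not at hcon
    exact hP (Finset.sum_eq_zero fun a ha => (hcon a (Finset.mem_filter.1 ha).2).elim)
  have hterm : ∀ P Q, (if P = Q then c' P ^ 2 else 0) - |c' P| * |c' Q| / Fintype.card ι ≤
      c' P * c' Q * N P Q ^ s := by
    intro P Q
    have habs : 0 ≤ |c' P| * |c' Q| := mul_nonneg (abs_nonneg _) (abs_nonneg _)
    by_cases hPQ : P = Q
    · subst hPQ
      rw [if_pos rfl, hone, one_pow, mul_one, sq]
      linarith [div_nonneg habs hk]
    · rw [if_neg hPQ, zero_sub]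
      by_cases h0 : c' P = 0
      · simp [h0]
      by_cases h0' : c' Q = 0
      · simp [h0']
      obtain ⟨a, rfl⟩ := hzero P h0
      obtain ⟨b, rfl⟩ := hzero Q h0'
      have h2 := hs a b hPQ
      have h3 : N (rep a) (rep b) ^ s ≤ 1 / Fintype.card ι := by
        rw [le_div_iff₀ hk', mul_comm]
        exact h2
      have h4 : -(|c' (rep a)| * |c' (rep b)|) ≤ c' (rep a) * c' (rep b) := by
        rw [← abs_mul]
        exact neg_abs_le _
      have h5 : 0 ≤ N (rep a) (rep b) ^ s := pow_nonneg (hnn _ _) _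
      calc -(|c' (rep a)| * |c' (rep b)| / Fintype.card ι)
          = -(|c' (rep a)| * |c' (rep b)|) * (1 / Fintype.card ι) := by ring
        _ ≤ -(|c' (rep a)| * |c' (rep b)|) * N (rep a) (rep b) ^ s := by
          apply mul_le_mul_of_nonpos_left h3
          linarith
        _ ≤ _ := mul_le_mul_of_nonneg_right h4 h5
  refine le_trans ?_ (Finset.sum_le_sum fun P _ => Finset.sum_le_sum fun Q _ => hterm P Q)
  simp only [Finset.sum_sub_distrib, Finset.sum_ite_eq, Finset.mem_univ, if_true]
  have h6 : ∑ P, ∑ Q, |c' P| * |c' Q| / Fintype.card ι = (∑ P, |c' P|) ^ 2 / Fintype.card ι := by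
    rw [sq, Finset.sum_mul_sum, Finset.sum_div]
    exact Finset.sum_congr rfl fun P _ => (Finset.sum_div _ _ _).symm
  rw [h6, sub_nonneg, div_le_iff₀ hk', mul_comm]
  -- The diagonal dominates: `(∑ |c' P|)² ≤ |ι| ∑ |c' P|²`.
  have h7 := sq_sum_le_card_mul_sum_sq (s := (Finset.univ : Finset ι)) (f := fun P => |c' P|)
  simpa using h7

/-- A positive symmetric matrix satisfying the Cauchy-Schwarz inequalities, with equality only
between proportional rows, has a positive semidefinite entrywise power. -/
theorem exists_pow_form_nonneg {ι : Type*} [Fintype ι] (f : ι → ι → ℝ) (hpos : ∀ a b, 0 < f a b)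
    (hsymm : ∀ a b, f a b = f b a) (hcs : ∀ a b, f a b ^ 2 ≤ f a a * f b b)
    (heq : ∀ a b, f a b ^ 2 = f a a * f b b → ∃ c, ∀ d, f a d = c * f b d) :
    ∃ s : ℕ, 1 ≤ s ∧ ∀ c : ι → ℝ, 0 ≤ ∑ a, ∑ b, c a * c b * f a b ^ s := by
  classical
  rcases isEmpty_or_nonempty ι with hemp | hne
  · exact ⟨1, le_rfl, fun c => by simp⟩
  set r : ι → ℝ := fun a => Real.sqrt (f a a) with hr
  have hrpos : ∀ a, 0 < r a := fun a => Real.sqrt_pos.2 (hpos a a)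
  have hrr : ∀ a, r a * r a = f a a := fun a => Real.mul_self_sqrt (hpos a a).le
  set N : ι → ι → ℝ := fun a b => f a b / (r a * r b) with hN
  have hNpos : ∀ a b, 0 < N a b := fun a b => div_pos (hpos a b) (mul_pos (hrpos a) (hrpos b))
  have hNsymm : ∀ a b, N a b = N b a := fun a b => by
    simp only [hN]
    rw [hsymm, mul_comm]
  have hNone : ∀ a, N a a = 1 := fun a => by
    simp only [hN]
    rw [hrr, div_self (hpos a a).ne']
  have hle : ∀ a b, f a b ≤ r a * r b := by
    intro a b
    refine abs_le_of_sq_le_sq' ?_ (mul_pos (hrpos a) (hrpos b)).le |>.2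
    rw [mul_pow, sq (r a), sq (r b), hrr, hrr]
    exact hcs a b
  have hNle : ∀ a b, N a b ≤ 1 := fun a b =>
    (div_le_one (mul_pos (hrpos a) (hrpos b))).2 (hle a b)
  -- An entry 1 is a case of equality in Cauchy-Schwarz, so the rows are proportional. After
  -- normalization, proportional rows coincide.
  have hNeq : ∀ a b, N a b = 1 → N a = N b := by
    intro a b hab
    have h1 : f a b = r a * r b := (div_eq_one_iff_eq (mul_pos (hrpos a) (hrpos b)).ne').1 hab
    obtain ⟨c, hc⟩ := heq a b (by rw [h1, mul_pow, sq (r a), sq (r b), hrr, hrr])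
    have h2 : r a = c * r b := by
      have h3 := hc b
      rw [h1, ← hrr b] at h3
      have := (hrpos b).ne'
      field_simp at h3
      rw [h3, mul_comm]
    have hcne : c ≠ 0 := by
      rintro rfl
      rw [zero_mul] at h2
      exact (hrpos a).ne' h2
    funext d
    simp only [hN]
    rw [hc d, h2, mul_assoc, mul_div_mul_left _ _ hcne]
  set rep : ι → ι := fun a => Function.invFun N (N a) with hrepdef
  have hrep : ∀ a, N (rep a) = N a := fun a => Function.invFun_eq ⟨a, rfl⟩
  have hNrep : ∀ a b, N a b = N (rep a) (rep b) := fun a b => by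
    rw [← hrep a, hNsymm, ← hrep b, hNsymm]
  have hev : ∀ᶠ s : ℕ in Filter.atTop, ∀ a b, rep a ≠ rep b →
      (Fintype.card ι : ℝ) * N (rep a) (rep b) ^ s ≤ 1 := by
    rw [Filter.eventually_all]
    intro a
    rw [Filter.eventually_all]
    intro b
    by_cases hab : rep a = rep b
    · exact Filter.Eventually.of_forall fun s h => (h hab).elim
    · have hlt : N (rep a) (rep b) < 1 := by
        refine lt_of_le_of_ne (hNle _ _) fun h => hab ?_
        have := hNeq _ _ h
        rw [hrep, hrep] at this
        simp only [hrepdef]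
        rw [this]
      have ht := (tendsto_pow_atTop_nhds_zero_of_lt_one (hNpos _ _).le hlt).const_mul
        (Fintype.card ι : ℝ)
      rw [mul_zero] at ht
      filter_upwards [ht.eventually (ge_mem_nhds (zero_lt_one' ℝ))] with s hs _
      exact hs
  obtain ⟨s, hs, hs1⟩ := (hev.and (Filter.eventually_ge_atTop 1)).exists
  refine ⟨s, hs1, fun c => ?_⟩
  have := form_nonneg_of_rep N rep s hNrep hNone (fun a b => (hNpos a b).le) hs
    (fun a => c a * r a ^ s)
  refine le_of_le_of_eq this (Finset.sum_congr rfl fun a _ => Finset.sum_congr rfl fun b _ => ?_)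
  have h1 : f a b = r a * r b * N a b := by
    simp only [hN]
    rw [mul_div_cancel₀ _ (mul_pos (hrpos a) (hrpos b)).ne']
  rw [h1, mul_pow, mul_pow]
  ring

theorem form_nonneg_pushforward {ι J : Type*} [Fintype ι] {F : ι → ι → ℝ}
    (hF : ∀ c : ι → ℝ, 0 ≤ ∑ a, ∑ b, c a * c b * F a b) (s : Finset J) (φ : J → ι) (c : J → ℝ) :
    0 ≤ ∑ i ∈ s, ∑ j ∈ s, c i * c j * F (φ i) (φ j) := by
  classical
  refine le_of_le_of_eq (hF fun a => ∑ i ∈ s, if φ i = a then c i else 0) ?_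
  have h1 : ∀ a b, (∑ i ∈ s, if φ i = a then c i else 0) * (∑ j ∈ s, if φ j = b then c j else 0) *
      F a b = ∑ i ∈ s, ∑ j ∈ s, if φ i = a then (if φ j = b then c i * c j * F a b else 0) else 0 := by
    intro a b
    rw [Finset.sum_mul_sum, Finset.sum_mul]
    refine Finset.sum_congr rfl fun i _ => ?_
    rw [Finset.sum_mul]
    refine Finset.sum_congr rfl fun j _ => ?_
    split_ifs <;> simp
  simp_rw [h1]
  calc _ = ∑ a, ∑ i ∈ s, ∑ j ∈ s, ∑ b,
        (if φ i = a then (if φ j = b then c i * c j * F a b else 0) else 0) := by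
        refine Finset.sum_congr rfl fun a _ => ?_
        rw [Finset.sum_comm]
        refine Finset.sum_congr rfl fun i _ => ?_
        rw [Finset.sum_comm]
    _ = ∑ i ∈ s, ∑ j ∈ s, ∑ a, ∑ b,
        (if φ i = a then (if φ j = b then c i * c j * F a b else 0) else 0) := by
        rw [Finset.sum_comm]
        refine Finset.sum_congr rfl fun i _ => ?_
        rw [Finset.sum_comm]
    _ = _ := by
        refine Finset.sum_congr rfl fun i _ => Finset.sum_congr rfl fun j _ => ?_
        rw [Finset.sum_eq_single (φ i) (fun P _ hP => by simp [hP.symm]) (by simp)]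
        rw [Finset.sum_eq_single (φ j) (fun P _ hP => by simp [hP.symm]) (by simp)]
        rw [if_pos rfl, if_pos rfl]

/-- Inclusion-exclusion for functions of the intersection of two subsets. -/
theorem sum_powerset_inter {α : Type*} [DecidableEq α] (l : Finset α) :
    ∀ f : Finset α → ℝ, ∑ S ∈ l.powerset, ∑ T ∈ S.powerset, ∑ T' ∈ S.powerset,
      (-1 : ℝ) ^ T.card * (-1) ^ T'.card * f (T ∩ T') = f l := by
  induction l using Finset.induction_on with
  | empty => simp
  | insert a l ha ih =>
    intro f
    rw [Finset.sum_powerset_insert ha, ih, add_comm]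
    -- Of the four cases for `a` in `T` and in `T'`, only membership in both adds `a` to the
    -- intersection. The others contribute `-1 - 1 + 1 = -1` times the value without `a`.
    have : ∀ S ∈ l.powerset, ∑ T ∈ (insert a S).powerset, ∑ T' ∈ (insert a S).powerset,
        (-1 : ℝ) ^ T.card * (-1) ^ T'.card * f (T ∩ T') =
        ∑ T ∈ S.powerset, ∑ T' ∈ S.powerset,
          (-1 : ℝ) ^ T.card * (-1) ^ T'.card * f (insert a (T ∩ T')) -
        ∑ T ∈ S.powerset, ∑ T' ∈ S.powerset,
          (-1 : ℝ) ^ T.card * (-1) ^ T'.card * f (T ∩ T') := by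
      intro S hS
      have haS : a ∉ S := fun h => ha (Finset.mem_powerset.1 hS h)
      rw [Finset.sum_powerset_insert haS]
      simp_rw [Finset.sum_powerset_insert haS]
      rw [← Finset.sum_add_distrib, ← Finset.sum_sub_distrib]
      refine Finset.sum_congr rfl fun T hT => ?_
      have haT : a ∉ T := fun h => haS (Finset.mem_powerset.1 hT h)
      rw [← Finset.sum_add_distrib, ← Finset.sum_add_distrib, ← Finset.sum_add_distrib,
        ← Finset.sum_sub_distrib]
      refine Finset.sum_congr rfl fun T' hT' => ?_
      have haT' : a ∉ T' := fun h => haS (Finset.mem_powerset.1 hT' h)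
      rw [Finset.card_insert_of_notMem haT, Finset.card_insert_of_notMem haT',
        Finset.insert_inter_of_notMem haT', Finset.inter_insert_of_notMem haT,
        ← Finset.insert_inter_distrib, pow_succ, pow_succ]
      ring
    rw [Finset.sum_congr rfl this, Finset.sum_sub_distrib, ih, ih fun S => f (insert a S)]
    ring

end Form

/-! ### Partially labeled graphs on a fixed vertex set -/

section Canonical

/-- The label of a vertex, if it has one. -/
def PLGraph.lab (A : PLGraph) : A.labels ⊕ Fin A.unl → Option ℕ :=
  Sum.elim (fun l => some l.1) fun _ => none

theorem PLGraph.lab_mem {A : PLGraph} {v : A.labels ⊕ Fin A.unl} {l : ℕ} (h : A.lab v = some l) :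
    l ∈ A.labels := by
  rcases v with ⟨k, hk⟩ | i
  · obtain rfl : k = l := Option.some.inj h
    exact hk
  · exact absurd h (by simp [PLGraph.lab])

theorem PLGraph.lab_inj {A : PLGraph} {v w : A.labels ⊕ Fin A.unl} {l : ℕ}
    (hv : A.lab v = some l) (hw : A.lab w = some l) : v = w := by
  rcases v with ⟨k, hk⟩ | i
  · rcases w with ⟨k', hk'⟩ | i
    · obtain rfl : k = l := Option.some.inj hv
      obtain rfl : k' = k := Option.some.inj hw
      rfl
    · exact absurd hw (by simp [PLGraph.lab])
  · exact absurd hv (by simp [PLGraph.lab])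

theorem PLGraph.inLeft_eq_inRight_iff {A B : PLGraph} (a : A.labels ⊕ Fin A.unl)
    (b : B.labels ⊕ Fin B.unl) : PLGraph.inLeft A B a = PLGraph.inRight A B b ↔
      ∃ l, A.lab a = some l ∧ B.lab b = some l := by
  rcases a with ⟨k, hk⟩ | i <;> rcases b with ⟨k', hk'⟩ | j
  · simp only [PLGraph.inLeft, PLGraph.inRight, PLGraph.lab, Sum.map_inl, Sum.inl.injEq,
      Subtype.mk.injEq, Sum.elim_inl, Option.some.injEq]
    constructor
    · rintro rfl
      exact ⟨k, rfl, rfl⟩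
    · rintro ⟨l, rfl, rfl⟩
      rfl
  · simp [PLGraph.inLeft, PLGraph.inRight, PLGraph.lab]
  · simp [PLGraph.inLeft, PLGraph.inRight, PLGraph.lab]
  · simp only [PLGraph.inLeft, PLGraph.inRight, PLGraph.lab, Sum.map_inr, Sum.inr.injEq,
      Sum.elim_inr, reduceCtorEq, false_and, exists_false, iff_false]
    intro h
    have := congrArg Fin.val h
    have hi := i.2
    simp at this
    omega

/-- Vertices with a label in `T` are mapped to a common copy of the labels, all other vertices to a
separate copy. -/
def canonMap {m : ℕ} (A : PLGraph) (ρ : ℕ → Fin m) (code : A.labels ⊕ Fin A.unl → Fin m)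
    (T : Finset ℕ) (v : A.labels ⊕ Fin A.unl) : Fin m ⊕ Fin m :=
  match A.lab v with
  | some l => if l ∈ T then Sum.inl (ρ l) else Sum.inr (code v)
  | none => Sum.inr (code v)

variable {m : ℕ} {A B : PLGraph} {ρ : ℕ → Fin m}

theorem canonMap_eq_inl_iff {code : A.labels ⊕ Fin A.unl → Fin m} {T : Finset ℕ}
    {v : A.labels ⊕ Fin A.unl} {x : Fin m} :
    canonMap A ρ code T v = Sum.inl x ↔ ∃ l ∈ T, A.lab v = some l ∧ ρ l = x := by
  unfold canonMap
  rcases A.lab v with _ | l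
  · simp
  · by_cases hl : l ∈ T
    · simp [hl]
    · simp only [hl, if_false, reduceCtorEq, Option.some.injEq, false_iff]
      rintro ⟨l', h1, rfl, -⟩
      exact hl h1

theorem canonMap_eq_inr {code : A.labels ⊕ Fin A.unl → Fin m} {T : Finset ℕ}
    {v : A.labels ⊕ Fin A.unl} {x : Fin m} (h : canonMap A ρ code T v = Sum.inr x) :
    code v = x := by
  unfold canonMap at h
  rcases hl : A.lab v with _ | l
  · rw [hl] at h
    exact Sum.inr.inj h
  · rw [hl] at h
    simp only at h
    split_ifs at h
    exact Sum.inr.inj h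

theorem canonMap_injective {code : A.labels ⊕ Fin A.unl → Fin m} (hcode : Function.Injective code)
    {T : Finset ℕ} (hρ : Set.InjOn ρ T) : Function.Injective (canonMap A ρ code T) := by
  intro v w hvw
  rcases hv : canonMap A ρ code T v with x | x
  · obtain ⟨l, hl, h1, rfl⟩ := canonMap_eq_inl_iff.1 hv
    obtain ⟨l', hl', h1', h⟩ := canonMap_eq_inl_iff.1 (hvw ▸ hv)
    obtain rfl := hρ hl' hl h
    exact PLGraph.lab_inj h1 h1'
  · exact hcode ((canonMap_eq_inr hv).trans (canonMap_eq_inr (hvw ▸ hv)).symm)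

/-- Only labels selected on both sides end up in the common part, so the product of the canonical
copies for `T` and `T'` identifies exactly the labels in `T ∩ T'`. -/
theorem canonMap_glue_iff {cA : A.labels ⊕ Fin A.unl → Fin m} {cB : B.labels ⊕ Fin B.unl → Fin m}
    {S T T' : Finset ℕ} (hρ : Set.InjOn ρ S) (hT : T ⊆ S) (hT' : T' ⊆ S)
    (a : A.labels ⊕ Fin A.unl) (b : B.labels ⊕ Fin B.unl) :
    (Sum.map id Sum.inl (canonMap A ρ cA T a) : Fin m ⊕ (Fin m ⊕ Fin m)) =
        Sum.map id Sum.inr (canonMap B ρ cB T' b) ↔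
      ∃ l ∈ T ∩ T', A.lab a = some l ∧ B.lab b = some l := by
  rcases ha : canonMap A ρ cA T a with x | x <;> rcases hb : canonMap B ρ cB T' b with y | y
  · obtain ⟨l, hl, h1, rfl⟩ := canonMap_eq_inl_iff.1 ha
    obtain ⟨l', hl', h1', rfl⟩ := canonMap_eq_inl_iff.1 hb
    simp only [Sum.map_inl, id, Sum.inl.injEq]
    constructor
    · intro h
      obtain rfl := hρ (hT hl) (hT' hl') h
      exact ⟨l, Finset.mem_inter.2 ⟨hl, hl'⟩, h1, h1'⟩
    · rintro ⟨k, -, h2, h3⟩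
      rw [h1] at h2
      rw [h1'] at h3
      rw [Option.some.inj h2, Option.some.inj h3]
  · refine iff_of_false (by simp) ?_
    rintro ⟨l, hl, -, h2⟩
    have := canonMap_eq_inl_iff (ρ := ρ) (code := cB).2 ⟨l, (Finset.mem_inter.1 hl).2, h2, rfl⟩
    rw [hb] at this
    simp at this
  · refine iff_of_false (by simp) ?_
    rintro ⟨l, hl, h2, -⟩
    have := canonMap_eq_inl_iff (ρ := ρ) (code := cA).2 ⟨l, (Finset.mem_inter.1 hl).1, h2, rfl⟩
    rw [ha] at this
    simp at this
  · refine iff_of_false (by simp) ?_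
    rintro ⟨l, hl, h2, -⟩
    have := canonMap_eq_inl_iff (ρ := ρ) (code := cA).2 ⟨l, (Finset.mem_inter.1 hl).1, h2, rfl⟩
    rw [ha] at this
    simp at this

/-- The class of the product of canonical copies depends only on the labels that are identified. -/
theorem uclass_glue_canon_congr {cA : A.labels ⊕ Fin A.unl → Fin m}
    {cB : B.labels ⊕ Fin B.unl → Fin m} (hcA : Function.Injective cA) (hcB : Function.Injective cB)
    {V : Type} [Finite V] {α : A.labels ⊕ Fin A.unl → V} {β : B.labels ⊕ Fin B.unl → V}
    (hα : Function.Injective α) (hβ : Function.Injective β)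
    {S T T' : Finset ℕ} (hρ : Set.InjOn ρ S) (hT : T ⊆ S) (hT' : T' ⊆ S)
    (h : ∀ a b, α a = β b ↔ ∃ l ∈ T ∩ T', A.lab a = some l ∧ B.lab b = some l) :
    uclass (glue (A.graph.map (canonMap A ρ cA T)) (B.graph.map (canonMap B ρ cB T'))) =
      uclass (A.graph.map α ⊔ B.graph.map β) := by
  have hl : Function.Injective (Sum.map id Sum.inl : Fin m ⊕ Fin m → Fin m ⊕ (Fin m ⊕ Fin m)) :=
    Function.injective_id.sumMap Sum.inl_injective
  have hr : Function.Injective (Sum.map id Sum.inr : Fin m ⊕ Fin m → Fin m ⊕ (Fin m ⊕ Fin m)) :=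
    Function.injective_id.sumMap Sum.inr_injective
  unfold glue
  rw [SimpleGraph.map_map, SimpleGraph.map_map]
  refine uclass_sup_map_congr _ _ (hl.comp (canonMap_injective hcA (hρ.mono hT)))
    (hr.comp (canonMap_injective hcB (hρ.mono hT'))) hα hβ fun a b => ?_
  rw [h]
  exact canonMap_glue_iff hρ hT hT' a b

end Canonical

/-! ### Positive semidefinite parameters lie in the sos-profile -/

section Profile

theorem exists_injOn_fin {m : ℕ} (hm : 0 < m) (S : Finset ℕ) (hS : S.card ≤ m) :
    ∃ ρ : ℕ → Fin m, Set.InjOn ρ S := by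
  obtain ⟨e⟩ : Nonempty (S ↪ Fin m) :=
    Function.Embedding.nonempty_of_card_le (by simpa using hS)
  classical
  refine ⟨fun l => if h : l ∈ S then e ⟨l, h⟩ else ⟨0, hm⟩, fun a ha b hb hab => ?_⟩
  simp only [dif_pos (show a ∈ S from ha), dif_pos (show b ∈ S from hb)] at hab
  exact congrArg Subtype.val (e.injective hab)

/-- A graph is the product of its components, and the placeholder value never occurs under the
hypothesis. -/
theorem evalGraph_eq {d : ℕ} (φ : UGraph →* ℝ) {G : UGraph}
    (hG : ∀ C ∈ G.components, C ∈ connGraphs d) :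
    evalGraph d (fun C => φ C.1) G = φ G := by
  unfold evalGraph
  conv_rhs => rw [← G.prod_components, map_multiset_prod]
  congr 1
  refine Multiset.map_congr rfl fun C hC => ?_
  rw [dif_pos (hG C hC)]

/-- Evaluation of graph combinations as a linear functional. -/
noncomputable def evalLin (d : ℕ) (x : connGraphs d → ℝ) : GraphComb →ₗ[ℝ] ℝ :=
  Finsupp.linearCombination ℝ (evalGraph d x) ∘ₗ
    (MonoidAlgebra.coeffLinearEquiv ℝ : GraphComb ≃ₗ[ℝ] _).toLinearMap

theorem evalLin_apply (d : ℕ) (x : connGraphs d → ℝ) (a : GraphComb) :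
    evalLin d x a = evalComb d x a := rfl

theorem evalLin_single (d : ℕ) (x : connGraphs d → ℝ) (G : UGraph) (c : ℝ) :
    evalLin d x (MonoidAlgebra.single G c) = c * evalGraph d x G := by
  rw [evalLin_apply]
  unfold evalComb
  rw [MonoidAlgebra.coeff_single, Finsupp.sum_single_index (zero_mul _)]

theorem evalComb_sq (d : ℕ) (x : connGraphs d → ℝ) (f : PLComb) :
    evalComb d x (f * f).unlabel = ∑ A ∈ f.coeff.support, ∑ B ∈ f.coeff.support,
      f.coeff A * f.coeff B * evalGraph d x (A * B).unlabel := by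
  rw [← evalLin_apply, PLComb.unlabel, MonoidAlgebra.mul_def, MonoidAlgebra.mapDomain_sum,
    Finsupp.sum, map_sum]
  refine Finset.sum_congr rfl fun A _ => ?_
  rw [MonoidAlgebra.mapDomain_sum, Finsupp.sum, map_sum]
  refine Finset.sum_congr rfl fun B _ => ?_
  rw [MonoidAlgebra.mapDomain_single, evalLin_single]

/-- A multiplicative graph parameter whose connection matrix on bounded graphs is positive
semidefinite gives a point of the sos-profile. -/
theorem mem_sosProfile {d : ℕ} (hd : 1 ≤ d) (φ : UGraph →* ℝ) (hφ : ∀ x, 0 ≤ φ x)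
    [Fintype (SimpleGraph (Fin (2 * d) ⊕ Fin (2 * d)))]
    (hpsd : ∀ c : SimpleGraph (Fin (2 * d) ⊕ Fin (2 * d)) → ℝ,
      0 ≤ ∑ A, ∑ B, c A * c B * φ (uclass (glue A B))) :
    (fun C : connGraphs d => φ C.1) ∈ sosProfile d := by
  classical
  refine ⟨fun C => hφ _, ?_⟩
  rintro a ⟨n, f, hf, rfl⟩
  rw [← evalLin_apply, map_sum]
  refine Finset.sum_nonneg fun j _ => ?_
  rw [evalLin_apply, evalComb_sq]
  set P := (f j).coeff.support with hP
  set c := (f j).coeff with hc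
  have hcard : ∀ A ∈ P, A.labels.card + A.unl ≤ 2 * d := fun A hA =>
    A.card_le.trans (Nat.mul_le_mul_left _ (hf j A hA))
  -- The labels of all constituents together may be too many for `Fin (2 * d)`. So the injection of
  -- labels is chosen separately for each set `S`; only sets of labels of a single constituent
  -- matter.
  have hρ : ∀ S : Finset ℕ, ∃ ρ : ℕ → Fin (2 * d), S.card ≤ 2 * d → Set.InjOn ρ S := by
    intro S
    by_cases hS : S.card ≤ 2 * d
    · obtain ⟨ρ, h⟩ := exists_injOn_fin (by omega) S hS
      exact ⟨ρ, fun _ => h⟩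
    · exact ⟨fun _ => ⟨0, by omega⟩, fun h => (hS h).elim⟩
  choose ρ hρ using hρ
  have hcode : ∀ A : PLGraph, ∃ code : A.labels ⊕ Fin A.unl → Fin (2 * d),
      A ∈ P → Function.Injective code := by
    intro A
    by_cases hA : A ∈ P
    · obtain ⟨e⟩ : Nonempty (A.labels ⊕ Fin A.unl ↪ Fin (2 * d)) :=
        Function.Embedding.nonempty_of_card_le (by simpa using hcard A hA)
      exact ⟨e, fun _ => e.injective⟩
    · exact ⟨fun _ => ⟨0, by omega⟩, fun h => (hA h).elim⟩
  choose code hcode using hcode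
  set can : Finset ℕ → PLGraph → Finset ℕ → SimpleGraph (Fin (2 * d) ⊕ Fin (2 * d)) :=
    fun S A T => A.graph.map (canonMap A (ρ S) (code A) T) with hcan
  set F : PLGraph → PLGraph → Finset ℕ → ℝ :=
    fun A B R => φ (uclass (glue (can R A R) (can R B R))) with hF
  have hinj : ∀ S A, A ∈ P → S ⊆ A.labels → Set.InjOn (ρ S) S := fun S A hA hS =>
    hρ S ((Finset.card_le_card hS).trans ((Nat.le_add_right _ _).trans (hcard A hA)))
  have hFS : ∀ A ∈ P, ∀ B ∈ P, ∀ S, S ⊆ A.labels → ∀ T ⊆ S, ∀ T' ⊆ S,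
      F A B (T ∩ T') = φ (uclass (glue (can S A T) (can S B T'))) := by
    intro A hA B hB S hSA T hT T' hT'
    have hl : Function.Injective (Sum.map id Sum.inl : Fin (2 * d) ⊕ Fin (2 * d) →
      Fin (2 * d) ⊕ (Fin (2 * d) ⊕ Fin (2 * d))) := Function.injective_id.sumMap Sum.inl_injective
    have hr : Function.Injective (Sum.map id Sum.inr : Fin (2 * d) ⊕ Fin (2 * d) →
      Fin (2 * d) ⊕ (Fin (2 * d) ⊕ Fin (2 * d))) := Function.injective_id.sumMap Sum.inr_injective
    have hi := hinj S A hA hSA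
    have hi' := hinj (T ∩ T') A hA ((Finset.inter_subset_left.trans hT).trans hSA)
    simp only [hF, hcan]
    congr 1
    refine (uclass_glue_canon_congr (hcode A hA) (hcode B hB)
      (hl.comp (canonMap_injective (hcode A hA) (hi.mono hT)))
      (hr.comp (canonMap_injective (hcode B hB) (hi.mono hT'))) hi' subset_rfl subset_rfl
      fun a b => ?_).trans ?_
    · rw [Finset.inter_self]
      exact canonMap_glue_iff hi hT hT' a b
    · unfold glue
      rw [SimpleGraph.map_map, SimpleGraph.map_map]
  have hFull : ∀ A ∈ P, ∀ B ∈ P, F A B (A.labels ∩ B.labels) =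
      evalGraph d (fun C => φ C.1) (A * B).unlabel := by
    intro A hA B hB
    rw [evalGraph_eq φ (components_subset_connGraphs (hf j A hA) (hf j B hB)),
      PLGraph.unlabel_mul]
    simp only [hF, hcan]
    congr 1
    refine uclass_glue_canon_congr (hcode A hA) (hcode B hB) (PLGraph.inLeft_injective A B)
      (PLGraph.inRight_injective A B) (hinj _ A hA Finset.inter_subset_left) subset_rfl subset_rfl
      fun a b => ?_
    rw [PLGraph.inLeft_eq_inRight_iff]
    refine exists_congr fun l => ⟨fun h => ⟨?_, h⟩, fun h => h.2⟩
    simp [PLGraph.lab_mem h.1, PLGraph.lab_mem h.2]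
  -- The value at `A B` depends on the set of common labels. Inclusion-exclusion writes it as a sum
  -- over sets `S` of labels contained in both, where the sign factors as a function of `(A, T)`
  -- times a function of `(B, T')`. For each `S` the total is thus a quadratic form of the
  -- connection matrix on the fixed vertex set.
  have hexp : ∀ A ∈ P, ∀ B ∈ P, c A * c B * evalGraph d (fun C => φ C.1) (A * B).unlabel =
      ∑ S ∈ (P.biUnion PLGraph.labels).powerset, if S ⊆ A.labels then (if S ⊆ B.labels then
        ∑ T ∈ S.powerset, ∑ T' ∈ S.powerset, (c A * (-1) ^ T.card) * (c B * (-1) ^ T'.card) *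
          φ (uclass (glue (can S A T) (can S B T'))) else 0) else 0 := by
    intro A hA B hB
    rw [← hFull A hA B hB, ← sum_powerset_inter (A.labels ∩ B.labels) (F A B), Finset.mul_sum]
    have hpow : (A.labels ∩ B.labels).powerset = ((P.biUnion PLGraph.labels).powerset.filter
        fun S => S ⊆ A.labels).filter fun S => S ⊆ B.labels := by
      ext S
      simp only [Finset.mem_powerset, Finset.mem_filter, Finset.subset_inter_iff]
      exact ⟨fun h => ⟨⟨h.1.trans (Finset.subset_biUnion_of_mem PLGraph.labels hA), h.1⟩, h.2⟩,
        fun h => ⟨h.1.2, h.2⟩⟩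
    rw [hpow, Finset.sum_filter, Finset.sum_filter]
    refine Finset.sum_congr rfl fun S _ => ?_
    split_ifs with h1 h2
    · rw [Finset.mul_sum]
      refine Finset.sum_congr rfl fun T hT => ?_
      rw [Finset.mul_sum]
      refine Finset.sum_congr rfl fun T' hT' => ?_
      rw [hFS A hA B hB S h1 T (Finset.mem_powerset.1 hT) T' (Finset.mem_powerset.1 hT')]
      ring
    · rfl
    · rfl
  rw [Finset.sum_congr rfl fun A hA => Finset.sum_congr rfl fun B hB => hexp A hA B hB]
  have hcomm : ∀ G : PLGraph → PLGraph → Finset ℕ → ℝ,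
      ∑ A ∈ P, ∑ B ∈ P, ∑ S ∈ (P.biUnion PLGraph.labels).powerset, G A B S =
      ∑ S ∈ (P.biUnion PLGraph.labels).powerset, ∑ A ∈ P, ∑ B ∈ P, G A B S := by
    intro G
    rw [Finset.sum_comm]
    refine Eq.trans (Finset.sum_congr rfl fun A _ => Finset.sum_comm) ?_
    rw [Finset.sum_comm]
    exact Finset.sum_congr rfl fun S _ => Finset.sum_comm
  rw [hcomm]
  refine Finset.sum_nonneg fun S _ => ?_
  have := form_nonneg_pushforward (F := fun U V => φ (uclass (glue U V))) hpsd
    ((P.filter fun A => S ⊆ A.labels) ×ˢ S.powerset) (fun q => can S q.1 q.2)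
    (fun q => c q.1 * (-1) ^ q.2.card)
  refine le_of_le_of_eq this ?_
  rw [Finset.sum_product, Finset.sum_filter]
  refine Finset.sum_congr rfl fun A _ => ?_
  split_ifs with hSA
  · have : ∀ T ∈ S.powerset, ∑ q ∈ (P.filter fun A => S ⊆ A.labels) ×ˢ S.powerset,
        c A * (-1) ^ T.card * (c q.1 * (-1) ^ q.2.card) *
          φ (uclass (glue (can S A T) (can S q.1 q.2))) =
        ∑ B ∈ P, if S ⊆ B.labels then ∑ T' ∈ S.powerset, (c A * (-1) ^ T.card) *
          (c B * (-1) ^ T'.card) * φ (uclass (glue (can S A T) (can S B T'))) else 0 := by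
      intro T _
      rw [Finset.sum_product, Finset.sum_filter]
    refine (Finset.sum_congr rfl this).trans ?_
    rw [Finset.sum_comm]
    refine Finset.sum_congr rfl fun B _ => ?_
    split_ifs
    · rfl
    · exact Finset.sum_const_zero
  · simp

end Profile

/-! ### The graph parameter -/

section Character

variable {V W κ ι : Type*} [Fintype V] [Fintype W] [Fintype κ] [Fintype ι] {θ : ℝ} {p : ℕ}
  {C : SimpleGraph κ} {T : ι → Target}

/-- The product of homomorphism densities and a power with the exponent of the graph. -/
noncomputable def graphVal (θ : ℝ) (p : ℕ) (C : SimpleGraph κ) (T : ι → Target)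
    (G : SimpleGraph V) : ℝ :=
  θ ^ expo p C G * ∏ i, homDensity (T i) G

theorem prod_homDensity_pos (T : ι → Target) (G : SimpleGraph V) : 0 < ∏ i, homDensity (T i) G :=
  Finset.prod_pos fun i _ => homDensity_pos (T i) G

theorem graphVal_pos (hθ : 0 < θ) (G : SimpleGraph V) : 0 < graphVal θ p C T G :=
  mul_pos (pow_pos hθ _) (prod_homDensity_pos T G)

theorem graphVal_sum (hC : C.Connected) (G : SimpleGraph V) (H : SimpleGraph W) :
    graphVal θ p C T (G ⊕g H) = graphVal θ p C T G * graphVal θ p C T H := by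
  unfold graphVal
  rw [expo_sum hC, pow_add, Finset.prod_congr rfl fun i _ => homDensity_sum (T i) G H,
    Finset.prod_mul_distrib]
  ring

theorem graphVal_core {e : V ↪ W} {G : SimpleGraph V} {G' : SimpleGraph W} (h : IsCore e G G')
    (hC : C.Connected) (h2 : 2 ≤ Fintype.card κ) :
    graphVal θ p C T G' = graphVal θ p C T G := by
  unfold graphVal
  rw [h.expo_eq hC h2, Finset.prod_congr rfl fun i _ => homDensity_core (T i) h]

theorem graphVal_iso {G : SimpleGraph V} {G' : SimpleGraph W} (e : G ≃g G')
    (hC : C.Connected) (h2 : 2 ≤ Fintype.card κ) :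
    graphVal θ p C T G' = graphVal θ p C T G := graphVal_core (IsCore.of_iso e) hC h2

/-- The graph parameter as a character on unlabeled graphs. -/
noncomputable def character (hθ : 0 < θ) (hC : Admissible p C) (T : ι → Target) : UGraph →* ℝ :=
  have hmul : ∀ x y : UGraph, graphVal θ p C T (x * y).rep.graph =
      graphVal θ p C T x.rep.graph * graphVal θ p C T y.rep.graph := fun x y => by
    obtain ⟨f⟩ := UGraph.exists_iso_rep (x.rep.noIsolated.sum y.rep.noIsolated)
    rw [← UGraph.mk_mul_mk x.rep.noIsolated y.rep.noIsolated, x.mk_rep, y.mk_rep] at f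
    rw [← graphVal_iso f hC.connected hC.two_le, graphVal_sum hC.connected]
  { toFun := fun x => graphVal θ p C T x.rep.graph
    map_one' := by
      -- The value at the empty graph is idempotent and positive.
      have h := hmul 1 1
      rw [mul_one] at h
      exact (mul_eq_left₀ (graphVal_pos hθ _).ne').1 h.symm
    map_mul' := hmul }

theorem character_apply (hθ : 0 < θ) (hC : Admissible p C) (x : UGraph) :
    character hθ hC T x = graphVal θ p C T x.rep.graph := rfl

theorem character_uclass {V : Type} [Fintype V] (hθ : 0 < θ) (hC : Admissible p C)
    (G : SimpleGraph V) : character hθ hC T (uclass G) = graphVal θ p C T G := by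
  obtain ⟨e, he⟩ := exists_isCore_rep G
  rw [character_apply, graphVal_core he hC.connected hC.two_le]

instance : Nonempty Target :=
  ⟨apexTarget (⊥ : SimpleGraph (Fin 0)) (fun _ => 1) fun _ => one_pos⟩

/-- Enough targets to make the Cauchy-Schwarz inequality strict whenever this is possible. -/
noncomputable def strictTarget {L X : Type} [Fintype L] [Fintype X]
    (q : SimpleGraph (L ⊕ X) × SimpleGraph (L ⊕ X)) : Target :=
  Classical.epsilon fun T => homDensity T (glue q.1 q.2) ^ 2 <
    homDensity T (glue q.1 q.1) * homDensity T (glue q.2 q.2)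

theorem strictTarget_spec {L X : Type} [Fintype L] [Fintype X] {A B : SimpleGraph (L ⊕ X)}
    (h : ∃ T : Target, homDensity T (glue A B) ^ 2 <
      homDensity T (glue A A) * homDensity T (glue B B)) :
    homDensity (strictTarget (A, B)) (glue A B) ^ 2 <
      homDensity (strictTarget (A, B)) (glue A A) * homDensity (strictTarget (A, B)) (glue B B) :=
  Classical.epsilon_spec (p := fun T => homDensity T (glue A B) ^ 2 <
    homDensity T (glue A A) * homDensity T (glue B B)) h

/-- The power of `θ` obeys Cauchy-Schwarz by `expo_glue`, as `θ < 1`, and so does every density. All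
factors are positive, so one strict density makes the product strict. -/
theorem graphVal_glue_le {L X : Type} [Fintype L] [Fintype X] (hθ : 0 < θ) (hθ1 : θ < 1)
    (hC : Admissible p C) (A B : SimpleGraph (L ⊕ X)) :
    graphVal θ p C T (glue A B) ^ 2 ≤ graphVal θ p C T (glue A A) * graphVal θ p C T (glue B B) ∧
      ((∃ i, homDensity (T i) (glue A B) ^ 2 <
        homDensity (T i) (glue A A) * homDensity (T i) (glue B B)) →
      graphVal θ p C T (glue A B) ^ 2 <
        graphVal θ p C T (glue A A) * graphVal θ p C T (glue B B)) := by
  have h1 : (θ ^ expo p C (glue A B)) ^ 2 ≤ θ ^ (expo p C (glue A A) + expo p C (glue B B)) := by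
    rw [← pow_mul]
    refine pow_le_pow_of_le_one hθ.le hθ1.le ?_
    rw [mul_comm]
    exact expo_glue hC A B
  have h2 : graphVal θ p C T (glue A B) ^ 2 = (θ ^ expo p C (glue A B)) ^ 2 *
      ∏ i, homDensity (T i) (glue A B) ^ 2 := by
    unfold graphVal
    rw [mul_pow, Finset.prod_pow]
  have h3 : graphVal θ p C T (glue A A) * graphVal θ p C T (glue B B) =
      θ ^ (expo p C (glue A A) + expo p C (glue B B)) *
        ∏ i, homDensity (T i) (glue A A) * homDensity (T i) (glue B B) := by
    unfold graphVal
    rw [Finset.prod_mul_distrib, pow_add]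
    ring
  rw [h2, h3]
  have hpos : ∀ i, 0 < homDensity (T i) (glue A B) ^ 2 := fun i => pow_pos (homDensity_pos _ _) _
  constructor
  · exact mul_le_mul h1 (Finset.prod_le_prod (fun i _ => (hpos i).le)
      fun i _ => (homDensity_glue (T i) A B).1) (Finset.prod_nonneg fun i _ => (hpos i).le)
      (pow_pos hθ _).le
  · rintro ⟨i, hi⟩
    exact mul_lt_mul' h1 (Finset.prod_lt_prod (fun i _ => hpos i)
      (fun i _ => (homDensity_glue (T i) A B).1) ⟨i, Finset.mem_univ _, hi⟩)
      (Finset.prod_nonneg fun i _ => (hpos i).le) (pow_pos hθ _)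

theorem glue_symm_iso {L X Y : Type*} (A : SimpleGraph (L ⊕ X)) (B : SimpleGraph (L ⊕ Y)) :
    Nonempty (glue A B ≃g glue B A) := by
  refine ⟨⟨Equiv.sumCongr (Equiv.refl L) (Equiv.sumComm X Y), ?_⟩⟩
  rintro (a | a | a) (b | b | b) <;> simp [or_comm]

/-- Multiply the isomorphic graphs, `A` with the unlabeled part of `B` and `B` with the unlabeled
part of `A`, by `D`. The unlabeled parts split off as disjoint factors, and the constant of
proportionality does not depend on `D`. -/
theorem graphVal_glue_proportional {L X : Type} [Fintype L] [Fintype X]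
    (hθ : 0 < θ) (hC : Admissible p C) (A B D : SimpleGraph (L ⊕ X)) (π : X ⊕ X ≃ X ⊕ X)
    (hπ : ∀ a b, (glue A (dropL B)).Adj (Sum.map id π a) (Sum.map id π b) ↔
      (glue (dropL A) B).Adj a b) :
    graphVal θ p C T (glue A D) = graphVal θ p C T (A.comap Sum.inr) /
      graphVal θ p C T (B.comap Sum.inr) * graphVal θ p C T (glue B D) := by
  have h1 : graphVal θ p C T (glue (glue A (dropL B)) D) = _ :=
    graphVal_iso (glueDropIso A B D) hC.connected hC.two_le
  have h2 : graphVal θ p C T (glue (glue (dropL A) B) D) = _ :=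
    graphVal_iso (glueDropIso' A B D) hC.connected hC.two_le
  have h3 : graphVal θ p C T (glue (glue A (dropL B)) D) =
      graphVal θ p C T (glue (glue (dropL A) B) D) :=
    graphVal_iso (glueCongrIso π hπ D) hC.connected hC.two_le
  rw [h1, h2, graphVal_sum hC.connected, graphVal_sum hC.connected] at h3
  rw [div_mul_eq_mul_div, eq_div_iff (graphVal_pos hθ _).ne', h3, mul_comm]

theorem exists_pow_graphVal_form_nonneg {L X : Type} [Fintype L] [Fintype X]
    [Fintype (SimpleGraph (L ⊕ X))] (hθ : 0 < θ) (hθ1 : θ < 1) (hC : Admissible p C)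
    (hT : ∀ A B : SimpleGraph (L ⊕ X),
      (∃ T' : Target, homDensity T' (glue A B) ^ 2 <
        homDensity T' (glue A A) * homDensity T' (glue B B)) →
      ∃ i, homDensity (T i) (glue A B) ^ 2 <
        homDensity (T i) (glue A A) * homDensity (T i) (glue B B)) :
    ∃ s : ℕ, 1 ≤ s ∧ ∀ c : SimpleGraph (L ⊕ X) → ℝ,
      0 ≤ ∑ A, ∑ B, c A * c B * graphVal θ p C T (glue A B) ^ s := by
  refine exists_pow_form_nonneg _ (fun A B => graphVal_pos hθ _) (fun A B => ?_)
    (fun A B => (graphVal_glue_le hθ hθ1 hC A B).1) (fun A B hAB => ?_)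
  · obtain ⟨f⟩ := glue_symm_iso A B
    exact (graphVal_iso f hC.connected hC.two_le).symm
  · rcases exists_strict_or_iso A B with h | ⟨π, hπ⟩
    · exact absurd hAB ((graphVal_glue_le hθ hθ1 hC A B).2 (hT A B h)).ne
    · exact ⟨_, fun D => graphVal_glue_proportional hθ hC A B D π hπ⟩

/-- The parameter with a suitable power has positive semidefinite connection matrices, and it can
be chosen to separate two graphs with different exponents. -/
theorem exists_character (hC : Admissible p C) (m k : ℕ) (H K : UGraph)
    [Fintype (SimpleGraph (Fin m ⊕ Fin m))]
    (hlt : (k + 1) * expo p C K.rep.graph < k * expo p C H.rep.graph) :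
    ∃ φ : UGraph →* ℝ, (∀ x, 0 < φ x) ∧ φ H ^ k < φ K ^ (k + 1) ∧
      ∀ c : SimpleGraph (Fin m ⊕ Fin m) → ℝ,
        0 ≤ ∑ A, ∑ B, c A * c B * φ (uclass (glue A B)) := by
  -- One target for each pair of graphs on the finite vertex set. The targets do not depend on `θ`,
  -- which is chosen afterwards.
  set T : SimpleGraph (Fin m ⊕ Fin m) × SimpleGraph (Fin m ⊕ Fin m) → Target := strictTarget
  set a := (∏ i, homDensity (T i) H.rep.graph) ^ k with ha
  set b := (∏ i, homDensity (T i) K.rep.graph) ^ (k + 1) with hb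
  have ha0 : 0 < a := pow_pos (prod_homDensity_pos T _) _
  have hb0 : 0 < b := pow_pos (prod_homDensity_pos T _) _
  set θ := b / (a + b) with hθ
  have hθ0 : 0 < θ := div_pos hb0 (add_pos ha0 hb0)
  have hθ1 : θ < 1 := (div_lt_one (add_pos ha0 hb0)).2 (by linarith)
  have hθab : θ * a < b := by
    rw [hθ, div_mul_eq_mul_div, div_lt_iff₀ (add_pos ha0 hb0)]
    nlinarith
  have hsep : character hθ0 hC T H ^ k < character hθ0 hC T K ^ (k + 1) := by
    rw [character_apply, character_apply]
    unfold graphVal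
    rw [mul_pow, mul_pow, ← ha, ← hb, ← pow_mul, ← pow_mul]
    -- The exponents are integers, so the strict inequality `hlt` leaves a spare factor `θ`, which
    -- outweighs the ratio of the densities by `hθab`.
    have h1 : θ ^ (expo p C H.rep.graph * k) ≤ θ ^ (expo p C K.rep.graph * (k + 1) + 1) :=
      pow_le_pow_of_le_one hθ0.le hθ1.le (by
        rw [mul_comm _ k, mul_comm _ (k + 1)]
        exact hlt)
    calc _ ≤ θ ^ (expo p C K.rep.graph * (k + 1) + 1) * a := mul_le_mul_of_nonneg_right h1 ha0.le
      _ = θ ^ (expo p C K.rep.graph * (k + 1)) * (θ * a) := by ring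
      _ < _ := mul_lt_mul_of_pos_left hθab (pow_pos hθ0 _)
  obtain ⟨s, hs1, hs⟩ := exists_pow_graphVal_form_nonneg (T := T) hθ0 hθ1 hC fun A B hAB =>
    ⟨(A, B), strictTarget_spec hAB⟩
  refine ⟨character hθ0 hC T ^ s, fun x => ?_, ?_, fun c => ?_⟩
  · rw [MonoidHom.pow_apply]
    exact pow_pos (graphVal_pos hθ0 _) _
  · rw [MonoidHom.pow_apply, MonoidHom.pow_apply, pow_right_comm, pow_right_comm _ s]
    exact pow_lt_pow_left₀ hsep (pow_pos (graphVal_pos hθ0 _) _).le (by omega)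
  · simp only [MonoidHom.pow_apply, character_uclass]
    exact hs c

end Character

/-! ### Involutions and trivial squares -/

section TrivialSquare

/-- A trivial square has no involution exchanging the two parts of its non-fixed vertices without
edges in between. -/
theorem IsTrivialSquare.fixes {V : Type} [Fintype V] {G : SimpleGraph V} (hN : NoIsolated G)
    (hT : IsTrivialSquare (UGraph.mk G hN)) (τ : V → V) (D : V → Prop) (hτ : ∀ i, τ (τ i) = i)
    (hadj : ∀ i j, G.Adj (τ i) (τ j) ↔ G.Adj i j) (hD : ∀ i, τ i ≠ i → (D i ↔ ¬ D (τ i)))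
    (hsep : ∀ i j, τ i ≠ i → τ j ≠ j → D i → D j → ¬ G.Adj i (τ j)) (i : V) : τ i = i := by
  classical
  set ν : V ↪ ℕ := (Fintype.equivFin V).toEmbedding.trans Fin.valEmbedding
  set S : Finset ℕ := (Finset.univ.filter fun v => τ v = v).map ν with hS
  have hmem : ∀ l ∈ S, ∃ v, ν v = l ∧ τ v = v := by
    intro l hl
    obtain ⟨v, hv, rfl⟩ := Finset.mem_map.1 hl
    exact ⟨v, rfl, (Finset.mem_filter.1 hv).2⟩
  have hS' : ∀ v, τ v = v → ν v ∈ S := fun v hv =>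
    Finset.mem_map.2 ⟨v, Finset.mem_filter.2 ⟨Finset.mem_univ _, hv⟩, rfl⟩
  choose f hf1 hf2 using hmem
  set ε := Fintype.equivFin {v // τ v ≠ v ∧ D v}
  set g : S ⊕ Fin (Fintype.card {v // τ v ≠ v ∧ D v}) → V :=
    Sum.elim (fun l => f l.1 l.2) (fun i => (ε.symm i).1) with hg
  have hg1 : ∀ l, τ (g (Sum.inl l)) = g (Sum.inl l) := fun l => hf2 _ _
  have hg2 : ∀ i, τ (g (Sum.inr i)) ≠ g (Sum.inr i) ∧ D (g (Sum.inr i)) :=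
    fun i => (ε.symm i).2
  have hinj : Function.Injective g := by
    rintro (⟨a, ha⟩ | a) (⟨b, hb⟩ | b) hab
    · have : a = b := by
        rw [← hf1 a ha, ← hf1 b hb]
        exact congrArg ν hab
      subst this
      rfl
    · exact ((hg2 b).1 (hab ▸ hg1 ⟨a, ha⟩)).elim
    · exact ((hg2 a).1 (hab ▸ hg1 ⟨b, hb⟩)).elim
    · exact congrArg Sum.inr (ε.symm.injective (Subtype.ext hab))
  have hrange1 : ∀ v, τ v = v → ∃ x, g x = v := fun v hv =>
    ⟨Sum.inl ⟨ν v, hS' v hv⟩, ν.injective (hf1 _ _)⟩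
  have hrange2 : ∀ v, τ v ≠ v → D v → ∃ x, g x = v := fun v hv hv' =>
    ⟨Sum.inr (ε ⟨v, hv, hv'⟩), by simp [hg]⟩
  have hτne : ∀ v, τ v ≠ v → τ (τ v) ≠ τ v := fun v hv h => hv (by rw [hτ] at h; exact h.symm)
  have hτD : ∀ v, τ v ≠ v → ¬ D v → D (τ v) := fun v hv hv' => by
    by_contra h
    exact hv' ((hD v hv).2 h)
  have hnb : ∀ u v, G.Adj u v → (τ u = u ∨ D u) → (τ v = v ∨ D v) ∨ τ u = u := by
    intro u v huv hu
    by_cases h1 : τ u = u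
    · exact Or.inr h1
    left
    by_contra h2
    push Not at h2
    refine hsep u (τ v) h1 (hτne v h2.1) (hu.resolve_left h1) (hτD v h2.1 h2.2) ?_
    rwa [hτ]
  have hrange : ∀ v, τ v = v ∨ D v → ∃ x, g x = v := fun v hv => by
    by_cases h : τ v = v
    · exact hrange1 v h
    · exact hrange2 v h (hv.resolve_left h)
  have hgood : ∀ x, τ (g x) = g x ∨ D (g x) := by
    rintro (l | i)
    · exact Or.inl (hg1 l)
    · exact Or.inr (hg2 i).2
  have hNF : NoIsolated (G.comap g) := by
    intro x
    obtain ⟨w, hw⟩ := hN (g x)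
    by_cases hw' : τ w = w ∨ D w
    · obtain ⟨y, rfl⟩ := hrange w hw'
      exact ⟨y, hw⟩
    · have hx := (hnb _ _ hw (hgood x)).resolve_left hw'
      push Not at hw'
      obtain ⟨y, hy⟩ := hrange (τ w) (Or.inr (hτD w hw'.1 hw'.2))
      refine ⟨y, ?_⟩
      rw [comap_adj, hy]
      have := (hadj (g x) w).2 hw
      rwa [hx] at this
  -- `F` is induced on the fixed vertices, which are labeled, and on the half `D` of the moved
  -- vertices. Its square glues the two halves along the fixed part; since no edge joins the halves,
  -- this is `G`. A trivial square then leaves no unlabeled vertex in `F`.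
  set F : PLGraph := ⟨S, Fintype.card {v // τ v ≠ v ∧ D v}, G.comap g, hNF⟩ with hF
  have hτinj : Function.Injective τ := Function.LeftInverse.injective hτ
  have hsq : (F * F).unlabel = UGraph.mk G hN := by
    rw [PLGraph.unlabel_mul, ← uclass_eq_mk hN]
    refine (uclass_sup_map_congr (V := _) F.graph F.graph (PLGraph.inLeft_injective F F)
      (PLGraph.inRight_injective F F) hinj (hτinj.comp hinj) fun a b => ?_).trans
      (congrArg uclass ?_)
    · rw [PLGraph.inLeft_eq_inRight_iff]
      rcases b with l | b
      · constructor
        · rintro ⟨k, h1, h2⟩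
          rw [PLGraph.lab_inj h1 h2]
          exact (hg1 l).symm
        · intro h
          have h' : g a = g (Sum.inl l) := h.trans (hg1 l)
          rw [hinj h']
          exact ⟨l.1, rfl, rfl⟩
      · refine iff_of_false ?_ ?_
        · rintro ⟨k, h1, h2⟩
          simp [PLGraph.lab] at h2
        · intro h
          have h1 : g a = τ (g (Sum.inr b)) := h
          obtain ⟨h2, h3⟩ := hg2 b
          have h4 := hgood a
          rw [h1] at h4
          exact h4.elim (hτne _ h2) ((hD _ h2).1 h3)
    · ext u v
      rw [sup_adj, map_adj', map_adj']
      constructor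
      · rintro (⟨-, x, y, hxy, rfl, rfl⟩ | ⟨-, x, y, hxy, rfl, rfl⟩)
        · exact hxy
        · exact (hadj _ _).2 hxy
      · intro huv
        by_cases h : (τ u = u ∨ D u) ∧ (τ v = v ∨ D v)
        · obtain ⟨x, rfl⟩ := hrange u h.1
          obtain ⟨y, rfl⟩ := hrange v h.2
          exact Or.inl ⟨huv.ne, x, y, huv, rfl, rfl⟩
        · right
          have key : ∀ u v, G.Adj u v → ¬ (τ v = v ∨ D v) →
              ∃ x, g x = τ u := by
            intro u v huv hv
            refine hrange _ ?_
            by_cases hu : τ u = u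
            · left
              rw [hu, hu]
            · right
              refine hτD u hu fun hDu => ?_
              exact hu ((hnb u v huv (Or.inr hDu)).resolve_left hv)
          have key' : ∀ v, ¬ (τ v = v ∨ D v) → ∃ x, g x = τ v := fun v hv => by
            push Not at hv
            exact hrange _ (Or.inr (hτD v hv.1 hv.2))
          obtain ⟨⟨x, hx⟩, ⟨y, hy⟩⟩ : (∃ x, g x = τ u) ∧ ∃ y, g y = τ v := by
            rw [not_and_or] at h
            rcases h with h | h
            · exact ⟨key' u h, key v u huv.symm h⟩
            · exact ⟨key u v huv h, key' v h⟩
          refine ⟨huv.ne, x, y, ?_, ?_, ?_⟩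
          · show G.Adj (g x) (g y)
            rw [hx, hy]
            exact (hadj u v).2 huv
          · show τ (g x) = u
            rw [hx, hτ]
          · show τ (g y) = v
            rw [hy, hτ]
  have hunl : Fintype.card {v // τ v ≠ v ∧ D v} = 0 := (hT F hsq).1
  rw [Fintype.card_eq_zero_iff] at hunl
  by_contra hi
  by_cases hDi : D i
  · exact hunl.elim ⟨i, hi, hDi⟩
  · exact hunl.elim ⟨τ i, hτne i hi, hτD i hi hDi⟩

/-- An involution of a component extends by the identity to the whole graph. -/
theorem IsTrivialSquare.swapTrivial {C R : UGraph} (hT : IsTrivialSquare (C * R)) :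
    SwapTrivial C.rep.graph := by
  intro τ D hτ hadj hD hsep _ i
  rw [← C.mk_rep, ← R.mk_rep, UGraph.mk_mul_mk] at hT
  refine Sum.inl.inj (hT.fixes _ (Sum.map τ id) (Sum.elim D fun _ => True) ?_ ?_ ?_ ?_ (Sum.inl i))
  · rintro (a | a)
    · simp [hτ]
    · rfl
  · rintro (a | a) (b | b) <;> simp [hadj]
  · rintro (a | a) ha
    · exact hD a fun h => ha (congrArg Sum.inl h)
    · exact (ha rfl).elim
  · rintro (a | a) (b | b) ha hb hDa hDb
    · simpa using hsep a b (fun h => ha (congrArg Sum.inl h)) (fun h => hb (congrArg Sum.inl h))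
        hDa hDb
    · exact (hb rfl).elim
    · exact (ha rfl).elim
    · exact (ha rfl).elim

theorem UGraph.Connected.nonempty {C : UGraph} (hC : C.Connected) : Nonempty (Fin C.rep.n) := by
  obtain ⟨G, rfl, hG⟩ := hC
  obtain ⟨f⟩ : FinGraph.Isom _ _ := Quotient.exact G.toUGraph.toUGraph_rep
  have := hG.nonempty
  exact this.map f.symm

theorem UGraph.Connected.rep_connected {C : UGraph} (hC : C.Connected) :
    C.rep.graph.Connected := by
  obtain ⟨G, rfl, hG⟩ := hC
  obtain ⟨f⟩ : FinGraph.Isom _ _ := Quotient.exact G.toUGraph.toUGraph_rep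
  exact f.connected_iff.2 hG

/-- The exchange of two isomorphic components is a nontrivial involution with separated halves.
Hence the components of a trivial square are pairwise non-isomorphic. -/
theorem not_isTrivialSquare_mul_mul {C R : UGraph} (hC : C.Connected) :
    ¬ IsTrivialSquare (C * (C * R)) := by
  intro hT
  obtain ⟨v⟩ := hC.nonempty
  rw [← C.mk_rep, ← R.mk_rep, UGraph.mk_mul_mk, UGraph.mk_mul_mk] at hT
  have := hT.fixes _ (Sum.elim (fun a => Sum.inr (Sum.inl a))
    (Sum.elim Sum.inl fun b => Sum.inr (Sum.inr b))) (fun x => x.isLeft) ?_ ?_ ?_ ?_ (Sum.inl v)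
  · simp at this
  · rintro (a | a | a) <;> rfl
  · rintro (a | a | a) (b | b | b) <;> simp
  · rintro (a | a | a) ha
    · simp
    · simp
    · exact (ha rfl).elim
  · rintro (a | a | a) (b | b | b) ha hb hDa hDb <;> simp at hDa hDb ⊢

theorem exists_deg_eq {H : FinGraph} {C R : UGraph} (h : H.toUGraph = C * R) (i : Fin C.rep.n) :
    ∃ v, C.rep.deg i = H.deg v := by
  rw [H.toUGraph_eq_mk, ← C.mk_rep, ← R.mk_rep, UGraph.mk_mul_mk, UGraph.mk_eq_mk_iff] at h
  obtain ⟨f⟩ := h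
  refine ⟨f.symm (Sum.inl i), ?_⟩
  have himg : H.graph.neighborSet (f.symm (Sum.inl i)) =
      (fun a => f.symm (Sum.inl a)) '' C.rep.graph.neighborSet i := by
    ext w
    obtain ⟨w, rfl⟩ := f.symm.surjective w
    rw [mem_neighborSet, f.symm.map_adj_iff]
    constructor
    · intro hw
      rcases w with w | w
      · exact ⟨w, by simpa using hw, rfl⟩
      · simp at hw
    · rintro ⟨a, ha, hw⟩
      rw [← f.symm.injective hw]
      simpa using ha
  unfold FinGraph.deg
  rw [himg, Set.ncard_image_of_injective]
  exact f.symm.injective.comp Sum.inl_injective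

end TrivialSquare

section Exponent

variable {κ : Type*} [Fintype κ] {C : SimpleGraph κ} {p : ℕ}

/-- The exponent of an unlabeled graph. -/
noncomputable def UGraph.expo (p : ℕ) (C : SimpleGraph κ) (x : UGraph) : ℕ :=
  GraphDensity.expo p C x.rep.graph

theorem UGraph.expo_mul (hC : C.Connected) (h2 : 2 ≤ Fintype.card κ) (x y : UGraph) :
    (x * y).expo p C = x.expo p C + y.expo p C := by
  obtain ⟨f⟩ := UGraph.exists_iso_rep (x.rep.noIsolated.sum y.rep.noIsolated)
  rw [← UGraph.mk_mul_mk x.rep.noIsolated y.rep.noIsolated, x.mk_rep, y.mk_rep] at f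
  unfold UGraph.expo
  rw [← (IsCore.of_iso f).expo_eq hC h2, expo_sum hC]

theorem UGraph.expo_prod (hC : C.Connected) (h2 : 2 ≤ Fintype.card κ) (s : Multiset UGraph) :
    s.prod.expo p C = (s.map (UGraph.expo p C)).sum := by
  induction s using Multiset.induction_on with
  | empty =>
    have := UGraph.expo_mul (p := p) hC h2 1 1
    rw [mul_one] at this
    simp only [Multiset.prod_zero, Multiset.map_zero, Multiset.sum_zero]
    omega
  | cons a s ih => rw [Multiset.prod_cons, UGraph.expo_mul hC h2, ih, Multiset.map_cons,
      Multiset.sum_cons]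

end Exponent

/-! ### Choice of the component and the separation -/

section Separation

theorem UGraph.Connected.darts_pos {C : UGraph} (hC : C.Connected) : 0 < C.darts := by
  classical
  obtain ⟨v⟩ := hC.nonempty
  obtain ⟨w, hw⟩ := C.rep.noIsolated v
  unfold UGraph.darts
  rw [numDarts_eq_card]
  exact Finset.card_pos.2 ⟨(v, w), by simpa using hw⟩

theorem UGraph.Connected.two_le {C : UGraph} (hC : C.Connected) : 2 ≤ C.rep.n := by
  obtain ⟨v⟩ := hC.nonempty
  obtain ⟨w, hw⟩ := C.rep.noIsolated v
  by_contra h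
  exact hw.ne (Fin.ext (by omega))

theorem UGraph.eq_mul_of_mem_components {x C : UGraph} (h : C ∈ x.components) :
    ∃ R, x = C * R := by
  obtain ⟨s, hs⟩ := Multiset.exists_cons_of_mem h
  exact ⟨s.prod, by rw [← x.prod_components, hs, Multiset.prod_cons]⟩

/-- There is a component of `H` for which the exponent separates the two graphs. -/
theorem exists_separating_component {H : FinGraph} {K : UGraph} {p : ℕ}
    (hne : H.toUGraph ≠ K) (hd : H.toUGraph.darts = K.darts)
    (hT : IsTrivialSquare H.toUGraph) (hdeg : ∀ v, H.deg v = p ∨ H.deg v = p + 1) :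
    ∃ C : UGraph, Admissible p C.rep.graph ∧
      K.expo p C.rep.graph + C.rep.n ≤ H.toUGraph.expo p C.rep.graph ∧
      K.expo p C.rep.graph ≤ C.rep.n * K.darts := by
  classical
  set hH := H.toUGraph.components with hHdef
  set hK := K.components with hKdef
  have hHp : hH.prod = H.toUGraph := UGraph.prod_components _
  have hKp : hK.prod = K := UGraph.prod_components _
  have hsplitH : hH ∩ hK + (hH - hK) = hH := by
    rw [add_comm, Multiset.sub_add_inter]
  have hsplitK : hH ∩ hK + (hK - hH) = hK := by
    rw [add_comm, Multiset.inter_comm, Multiset.sub_add_inter]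
  have hdPQ : ((hH - hK).map UGraph.darts).sum = ((hK - hH).map UGraph.darts).sum := by
    have h1 := congrArg UGraph.darts hHp
    have h2 := congrArg UGraph.darts hKp
    rw [UGraph.darts_prod, ← hsplitH, Multiset.map_add, Multiset.sum_add] at h1
    rw [UGraph.darts_prod, ← hsplitK, Multiset.map_add, Multiset.sum_add] at h2
    omega
  -- After common components are removed, equally many darts remain on both sides, and connected
  -- graphs here have darts. If nothing remained of `H`, the two graphs would coincide.
  have hPne : hH - hK ≠ 0 := by
    intro h0
    rw [h0, Multiset.map_zero, Multiset.sum_zero] at hdPQ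
    have hQ : hK - hH = 0 := by
      refine Multiset.eq_zero_of_forall_notMem fun D hD => ?_
      have h1 := Multiset.le_sum_of_mem (Multiset.mem_map_of_mem UGraph.darts hD)
      have h2 := (UGraph.connected_of_mem_components
        (Multiset.mem_of_le (Multiset.sub_le_self hK hH) hD)).darts_pos
      omega
    rw [h0, add_zero] at hsplitH
    rw [hQ, add_zero] at hsplitK
    have heq : hH = hK := hsplitH.symm.trans hsplitK
    exact hne (hHp.symm.trans ((congrArg Multiset.prod heq).trans hKp))
  -- Maximality of this ratio is the assumption of `mul_numDarts_le_expo` for the other unmatched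
  -- components of `H`.
  obtain ⟨C, hCm, hCmax⟩ := Finset.exists_max_image (hH - hK).toFinset
    (fun C => ((C.darts : ℚ) + 1) / C.rep.n)
    (Multiset.toFinset_nonempty.2 hPne)
  rw [Multiset.mem_toFinset] at hCm
  have hPH : ∀ D ∈ hH - hK, D ∈ hH := fun D hD =>
    Multiset.mem_of_le (Multiset.sub_le_self hH hK) hD
  have hCH := hPH C hCm
  have hCc : C.Connected := UGraph.connected_of_mem_components hCH
  obtain ⟨s, hs⟩ := Multiset.exists_cons_of_mem hCH
  have hHC : H.toUGraph = C * s.prod := by rw [← hHp, hs, Multiset.prod_cons]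
  have hCs : C ∉ s := by
    intro h
    obtain ⟨t, ht⟩ := Multiset.exists_cons_of_mem h
    rw [hHC, ht, Multiset.prod_cons] at hT
    exact not_isTrivialSquare_mul_mul hCc hT
  -- `C` occurs only once in `H`, and this occurrence is not matched, so `C` is not a component of
  -- `K` at all and `expo_le_mul_numDarts` applies to every component of `K`.
  have hCK : C ∉ hK := by
    have h1 : hH.count C = 1 := by
      rw [hs, Multiset.count_cons_self, Multiset.count_eq_zero_of_notMem hCs]
    have h2 := Multiset.one_le_count_iff_mem.2 hCm
    rw [Multiset.count_sub, h1] at h2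
    intro h
    have := Multiset.one_le_count_iff_mem.2 h
    omega
  have hcard : Fintype.card (Fin C.rep.n) = C.rep.n := Fintype.card_fin _
  have hdegs : ∀ D ∈ hH, ∀ i, ∃ t : Finset (Fin D.rep.n), (∀ j, D.rep.graph.Adj i j ↔ j ∈ t) ∧
      p ≤ t.card ∧ t.card ≤ p + 1 := by
    intro D hD i
    obtain ⟨R, hR⟩ := UGraph.eq_mul_of_mem_components hD
    obtain ⟨v, hv⟩ := exists_deg_eq hR i
    have h1 : D.rep.deg i = (D.rep.graph.neighborFinset i).card :=
      Set.ncard_eq_toFinset_card' _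
    have h2 := hdeg v
    exact ⟨D.rep.graph.neighborFinset i, fun j => by simp, by omega, by omega⟩
  have hupper : ∀ D ∈ hH, ∀ i, ∃ t : Finset (Fin D.rep.n), t.card ≤ p + 1 ∧
      ∀ j, D.rep.graph.Adj i j → j ∈ t := fun D hD i => by
    obtain ⟨t, h1, -, h3⟩ := hdegs D hD i
    exact ⟨t, h3, fun j => (h1 j).1⟩
  have hadm : Admissible p C.rep.graph :=
    { connected := hCc.rep_connected
      swapTrivial := by
        rw [hHC] at hT
        exact hT.swapTrivial
      two_le := by
        rw [hcard]
        exact hCc.two_le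
      le_degree := fun i => by
        obtain ⟨t, h1, h2, -⟩ := hdegs C hCH i
        exact ⟨t, h2, fun j => (h1 j).2⟩ }
  have hlowC : C.rep.n * (C.darts + 1) ≤ C.expo p C.rep.graph := by
    have := mul_succ_le_expo_self hCc.rep_connected C.rep.noIsolated (hupper C hCH)
    rwa [hcard] at this
  have hlow : ∀ D ∈ hH - hK, C.rep.n * D.darts ≤ D.expo p C.rep.graph := by
    intro D hD
    have hDc : D.Connected := UGraph.connected_of_mem_components (hPH D hD)
    have := mul_numDarts_le_expo (p := p) (C := C.rep.graph) hDc.rep_connected D.rep.noIsolated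
      (hupper D (hPH D hD)) ?_
    · rwa [hcard] at this
    · have h1 := hCmax D (Multiset.mem_toFinset.2 hD)
      rw [div_le_div_iff₀ (Nat.cast_pos.2 (Nat.lt_of_lt_of_le two_pos hDc.two_le))
        (Nat.cast_pos.2 (Nat.lt_of_lt_of_le two_pos hCc.two_le))] at h1
      rw [hcard, Fintype.card_fin]
      exact_mod_cast h1
  have hupp : ∀ D ∈ hK, D.expo p C.rep.graph ≤ C.rep.n * D.darts := by
    intro D hD
    have hDc : D.Connected := UGraph.connected_of_mem_components hD
    have hemp : IsEmpty (C.rep.graph ≃g D.rep.graph) := by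
      refine ⟨fun f => hCK ?_⟩
      have : C = D := by
        rw [← C.mk_rep, ← D.mk_rep, UGraph.mk_eq_mk_iff]
        exact ⟨f⟩
      rwa [this]
    have := expo_le_mul_numDarts (p := p) hadm.connected hadm.two_le hDc.rep_connected
      D.rep.noIsolated hemp
    rwa [hcard] at this
  have hsum_le : ∀ t ≤ hK, (t.map (UGraph.expo p C.rep.graph)).sum ≤
      C.rep.n * (t.map UGraph.darts).sum := by
    intro t ht
    rw [← Multiset.sum_map_mul_left]
    exact Multiset.sum_map_le_sum_map _ _ fun D hD => hupp D (Multiset.mem_of_le ht hD)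
  refine ⟨C, hadm, ?_, ?_⟩
  · rw [← hHp, ← hKp, UGraph.expo_prod hadm.connected hadm.two_le,
      UGraph.expo_prod hadm.connected hadm.two_le]
    have hsH : (hH.map (UGraph.expo p C.rep.graph)).sum =
        ((hH ∩ hK).map (UGraph.expo p C.rep.graph)).sum +
          ((hH - hK).map (UGraph.expo p C.rep.graph)).sum := by
      rw [← Multiset.sum_add, ← Multiset.map_add, hsplitH]
    have hsK : (hK.map (UGraph.expo p C.rep.graph)).sum =
        ((hH ∩ hK).map (UGraph.expo p C.rep.graph)).sum +
          ((hK - hH).map (UGraph.expo p C.rep.graph)).sum := by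
      rw [← Multiset.sum_add, ← Multiset.map_add, hsplitK]
    rw [hsH, hsK]
    -- Common components contribute equally. On the rest, `K` has at most `n` times its darts, and
    -- `H` has at least `n` times the same number of darts plus `n` from `C`.
    have h1 := hsum_le (hK - hH) (Multiset.sub_le_self _ _)
    obtain ⟨t, ht⟩ := Multiset.exists_cons_of_mem hCm
    have h2 : C.rep.n * (t.map UGraph.darts).sum ≤ (t.map (UGraph.expo p C.rep.graph)).sum := by
      rw [← Multiset.sum_map_mul_left]
      refine Multiset.sum_map_le_sum_map _ _ fun D hD => hlow D ?_
      rw [ht]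
      exact Multiset.mem_cons_of_mem hD
    rw [← hdPQ, ht, Multiset.map_cons, Multiset.sum_cons, mul_add] at h1
    rw [ht, Multiset.map_cons, Multiset.sum_cons]
    rw [mul_add, mul_one] at hlowC
    omega
  · have h1 := hsum_le hK le_rfl
    rwa [← UGraph.expo_prod hadm.connected hadm.two_le, ← UGraph.darts_prod, hKp] at h1

theorem toComb_pow (G : UGraph) (k : ℕ) : G.toComb ^ k = MonoidAlgebra.single (G ^ k) 1 := by
  unfold UGraph.toComb
  rw [MonoidAlgebra.of_apply, MonoidAlgebra.single_pow, one_pow]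

theorem UGraph.darts_pow (x : UGraph) (k : ℕ) : (x ^ k).darts = k * x.darts := by
  induction k with
  | zero => simp [UGraph.darts_one]
  | succ k ih => rw [pow_succ, UGraph.darts_mul, ih, Nat.succ_mul]

theorem not_sosTestable {H : FinGraph} {K : UGraph} {p : ℕ}
    (hne : H.toUGraph ≠ K) (hd : H.toUGraph.darts = K.darts)
    (hT : IsTrivialSquare H.toUGraph) (hdeg : ∀ v, H.deg v = p ∨ H.deg v = p + 1)
    {k : ℕ} (hk : K.darts + 1 ≤ k) :
    ¬ SosTestable (H.toUGraph.toComb ^ k - K.toComb ^ (k + 1)) := by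
  classical
  obtain ⟨C, hadm, h1, h2⟩ := exists_separating_component hne hd hT hdeg
  rintro ⟨d, hd1, hcomp, hnn⟩
  have hn : 2 ≤ C.rep.n := by simpa using hadm.two_le
  -- The extra copy of `K` costs at most `n * K.darts`, while the `k` copies of `H` gain `k * n`
  -- with `k > K.darts`.
  have hlt : (k + 1) * K.expo p C.rep.graph < k * H.toUGraph.expo p C.rep.graph := by
    have h3 : k * (K.expo p C.rep.graph + C.rep.n) ≤ k * H.toUGraph.expo p C.rep.graph :=
      Nat.mul_le_mul_left _ h1
    have h4 : (K.darts + 1) * C.rep.n ≤ k * C.rep.n := Nat.mul_le_mul_right _ hk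
    nlinarith
  have : Fintype (SimpleGraph (Fin (2 * d) ⊕ Fin (2 * d))) := Fintype.ofFinite _
  obtain ⟨φ, hφ, hsep, hpsd⟩ := exists_character hadm (2 * d) k H.toUGraph K hlt
  have hmem := mem_sosProfile hd1 φ (fun x => (hφ x).le) hpsd
  have hpos : 0 < K.darts := by
    by_contra h0
    have h0' : K.darts = 0 := by omega
    rw [h0', mul_zero] at h2
    have h5 : ∀ x : UGraph, x.darts = 0 → x = 1 := by
      intro x hx
      have : x.components = 0 := Multiset.eq_zero_of_forall_notMem fun D hD => by
        have := (UGraph.connected_of_mem_components hD).darts_pos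
        have := UGraph.darts_le_of_mem_components hD
        omega
      rw [← x.prod_components, this, Multiset.prod_zero]
    exact hne (by rw [h5 K h0', h5 _ (hd.trans h0')])
  -- The two powers differ, so neither term of the combination cancels, and testability provides
  -- coordinates for the components of both.
  have hpow : H.toUGraph ^ k ≠ K ^ (k + 1) := by
    intro h
    have := congrArg UGraph.darts h
    rw [UGraph.darts_pow, UGraph.darts_pow, hd] at this
    have := Nat.eq_of_mul_eq_mul_right hpos this
    omega
  rw [toComb_pow, toComb_pow] at hcomp hnn
  have hc1 : H.toUGraph ^ k ∈ (MonoidAlgebra.single (H.toUGraph ^ k) 1 -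
      MonoidAlgebra.single (K ^ (k + 1)) 1 : GraphComb).coeff.support := by
    rw [Finsupp.mem_support_iff, MonoidAlgebra.coeff_sub, MonoidAlgebra.coeff_single,
      MonoidAlgebra.coeff_single, Finsupp.sub_apply, Finsupp.single_eq_same,
      Finsupp.single_eq_of_ne hpow]
    simp
  have hc2 : K ^ (k + 1) ∈ (MonoidAlgebra.single (H.toUGraph ^ k) 1 -
      MonoidAlgebra.single (K ^ (k + 1)) 1 : GraphComb).coeff.support := by
    rw [Finsupp.mem_support_iff, MonoidAlgebra.coeff_sub, MonoidAlgebra.coeff_single,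
      MonoidAlgebra.coeff_single, Finsupp.sub_apply, Finsupp.single_eq_same,
      Finsupp.single_eq_of_ne hpow.symm]
    simp
  have hval := hnn _ hmem
  rw [← evalLin_apply, map_sub, evalLin_single, evalLin_single, evalGraph_eq φ (hcomp _ hc1),
    evalGraph_eq φ (hcomp _ hc2), map_pow, map_pow] at hval
  linarith

end Separation

/-! ### The path with three edges -/

section Path

theorem numDarts_toUGraph (G : FinGraph) : G.toUGraph.darts = numDarts G.graph := by
  rw [G.toUGraph_eq_mk, UGraph.darts_mk]

theorem PLGraph.unlabel_mul_self {F : PLGraph} (h : F.unl = 0) : (F * F).unlabel = F.unlabel := by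
  rw [PLGraph.unlabel_mul]
  refine (uclass_sup_map_congr (V := _) F.graph F.graph (PLGraph.inLeft_injective F F)
    (PLGraph.inRight_injective F F) Function.injective_id Function.injective_id
    fun a b => ?_).trans ?_
  · rw [PLGraph.inLeft_eq_inRight_iff]
    constructor
    · rintro ⟨l, h1, h2⟩
      exact PLGraph.lab_inj h1 h2
    · rintro (rfl : a = b)
      rcases a with l | i
      · exact ⟨l.1, rfl, rfl⟩
      · exact (i.cast h).elim0
  · rw [SimpleGraph.map_id, sup_idem, uclass_eq_mk F.noIsolated]
    rfl

/-- The exchange of the two copies of the unlabeled vertices. -/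
def PLGraph.flip (F : PLGraph) : (F * F).labels ⊕ Fin (F * F).unl →
    (F * F).labels ⊕ Fin (F * F).unl :=
  Sum.map id (Fin.addCases (m := F.unl) (n := F.unl) (Fin.natAdd F.unl) (Fin.castAdd F.unl))

theorem PLGraph.flip_inLeft (F : PLGraph) (a : F.labels ⊕ Fin F.unl) :
    F.flip (PLGraph.inLeft F F a) = PLGraph.inRight F F a := by
  rcases a with a | a
  · rfl
  · exact congrArg Sum.inr (Fin.addCases_left a)

theorem PLGraph.flip_inRight (F : PLGraph) (a : F.labels ⊕ Fin F.unl) :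
    F.flip (PLGraph.inRight F F a) = PLGraph.inLeft F F a := by
  rcases a with a | a
  · rfl
  · exact congrArg Sum.inr (Fin.addCases_right a)

theorem PLGraph.flip_adj {F : PLGraph} {u v : (F * F).labels ⊕ Fin (F * F).unl}
    (h : (F * F).graph.Adj u v) : (F * F).graph.Adj (F.flip u) (F.flip v) := by
  rcases h with h | h
  · obtain ⟨-, a, b, hab, rfl, rfl⟩ := (map_adj' _ _ _ _).1 h
    rw [F.flip_inLeft, F.flip_inLeft]
    exact Or.inr ((map_adj' _ _ _ _).2
      ⟨fun h => hab.ne (PLGraph.inRight_injective F F h), a, b, hab, rfl, rfl⟩)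
  · obtain ⟨-, a, b, hab, rfl, rfl⟩ := (map_adj' _ _ _ _).1 h
    rw [F.flip_inRight, F.flip_inRight]
    exact Or.inl ((map_adj' _ _ _ _).2
      ⟨fun h => hab.ne (PLGraph.inLeft_injective F F h), a, b, hab, rfl, rfl⟩)

/-- A label is fixed by the exchange, and the two copies of an unlabeled vertex are not joined. -/
theorem PLGraph.not_adj_flip {F : PLGraph} (u : (F * F).labels ⊕ Fin (F * F).unl) :
    ¬ (F * F).graph.Adj u (F.flip u) := by
  have key : ∀ a b, PLGraph.inRight F F a = PLGraph.inLeft F F b → a = b := fun a b h => by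
    obtain ⟨l, h1, h2⟩ := (PLGraph.inLeft_eq_inRight_iff b a).1 h.symm
    exact PLGraph.lab_inj h2 h1
  rintro (h | h)
  · obtain ⟨-, a, b, hab, rfl, hb⟩ := (map_adj' _ _ _ _).1 h
    rw [F.flip_inLeft] at hb
    exact hab.ne (key _ _ hb.symm)
  · obtain ⟨-, a, b, hab, rfl, hb⟩ := (map_adj' _ _ _ _).1 h
    rw [F.flip_inRight] at hb
    exact hab.ne (key _ _ hb).symm

theorem PLGraph.flip_injective (F : PLGraph) : Function.Injective F.flip := by
  refine Function.Injective.sumMap Function.injective_id ?_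
  refine Function.LeftInverse.injective (g := Fin.addCases (m := F.unl) (n := F.unl)
    (Fin.natAdd F.unl) (Fin.castAdd F.unl)) fun i => ?_
  refine Fin.addCases (fun j => ?_) (fun j => ?_) i
  · beta_reduce
    rw [Fin.addCases_left, Fin.addCases_right]
  · beta_reduce
    rw [Fin.addCases_right, Fin.addCases_left]

/-- The only injective walks through the path are the path itself and its reversal. The last
condition excludes the reversal, which moves the vertex 1 to its neighbor 2. -/
theorem path_walk_rigid : ∀ a b c e : Fin 4, (a.val + 1 = b.val ∨ b.val + 1 = a.val) →
    (b.val + 1 = c.val ∨ c.val + 1 = b.val) → (c.val + 1 = e.val ∨ e.val + 1 = c.val) →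
    a ≠ c → b ≠ e → ¬ (1 + 1 = b.val ∨ b.val + 1 = 1) → a = 0 ∧ b = 1 ∧ c = 2 ∧ e = 3 := by
  decide

theorem isTrivialSquare_P₃ : IsTrivialSquare P₃.toUGraph := by
  intro F hF
  have hunl : F.unl = 0 := by
    rw [P₃.toUGraph_eq_mk] at hF
    obtain ⟨f⟩ := (UGraph.mk_eq_mk_iff (F * F).noIsolated P₃.noIsolated).1 hF
    have hadj : ∀ a b : Fin 4, P₃.graph.Adj a b ↔ (a.val + 1 = b.val ∨ b.val + 1 = a.val) :=
      fun a b => pathGraph_adj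
    set σ : Fin 4 → Fin 4 := fun x => f (F.flip (f.symm x)) with hσ
    have hσadj : ∀ a b : Fin 4, P₃.graph.Adj a b → P₃.graph.Adj (σ a) (σ b) := fun a b hab =>
      f.map_adj_iff.2 (PLGraph.flip_adj (f.symm.map_adj_iff.2 hab))
    have hσinj : Function.Injective σ := f.injective.comp (F.flip_injective.comp f.symm.injective)
    have hσnot : ¬ P₃.graph.Adj (1 : Fin 4) (σ 1) := by
      intro h
      refine F.not_adj_flip (f.symm (1 : Fin 4)) ?_
      rw [← f.map_adj_iff]
      have h1 : f (f.symm (1 : Fin 4)) = (1 : Fin 4) := f.apply_symm_apply (1 : Fin 4)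
      exact h1.symm ▸ h
    have e01 := (hadj _ _).1 (hσadj 0 1 ((hadj _ _).2 (by decide)))
    have e12 := (hadj _ _).1 (hσadj 1 2 ((hadj _ _).2 (by decide)))
    have e23 := (hadj _ _).1 (hσadj 2 3 ((hadj _ _).2 (by decide)))
    obtain ⟨h0, h1, h2, h3⟩ := path_walk_rigid _ _ _ _ e01 e12 e23
      (fun h => absurd (hσinj h) (by decide)) (fun h => absurd (hσinj h) (by decide))
      (fun h => hσnot ((hadj _ _).2 h))
    have hid : ∀ x : Fin 4, σ x = x := by
      intro x
      fin_cases x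
      exacts [h0, h1, h2, h3]
    -- The exchange of the two halves of the square is an automorphism of the path that is not the
    -- reversal, hence the identity. But it moves every unlabeled vertex.
    by_contra hne
    have hpos : 0 < F.unl := Nat.pos_of_ne_zero hne
    have hx := hid (f (PLGraph.inLeft F F (Sum.inr ⟨0, hpos⟩)))
    simp only [hσ] at hx
    rw [f.symm_apply_apply, F.flip_inLeft] at hx
    obtain ⟨l, h, -⟩ := (PLGraph.inLeft_eq_inRight_iff _ _).1 (f.injective hx).symm
    simp [PLGraph.lab] at h
  refine ⟨hunl, ?_⟩
  rw [← PLGraph.unlabel_mul_self hunl, hF]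

theorem ncard_neighborSet_pathGraph_four (v : Fin 4) :
    ((pathGraph 4).neighborSet v).ncard = 1 ∨ ((pathGraph 4).neighborSet v).ncard = 1 + 1 := by
  have h : (pathGraph 4).neighborSet v =
      ((Finset.univ.filter fun w : Fin 4 => v.val + 1 = w.val ∨ w.val + 1 = v.val : Finset _) :
        Set (Fin 4)) := by
    ext w
    rw [mem_neighborSet, Finset.mem_coe, Finset.mem_filter]
    exact pathGraph_adj.trans (by simp)
  rw [h, Set.ncard_coe_finset]
  clear h
  revert v
  decide

theorem deg_P₃ (v : Fin P₃.n) : P₃.deg v = 1 ∨ P₃.deg v = 1 + 1 :=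
  ncard_neighborSet_pathGraph_four v

theorem darts_P₃ : P₃.toUGraph.darts = 6 := by
  have h : numDarts (pathGraph 4) = (Finset.univ.filter fun q : Fin 4 × Fin 4 =>
      q.1.val + 1 = q.2.val ∨ q.2.val + 1 = q.1.val).card := by
    classical
    rw [numDarts_eq_card]
    congr 1
    ext q
    simp [pathGraph_adj]
  rw [numDarts_toUGraph]
  exact h.trans (by decide)

theorem darts_K₂ : K₂.toUGraph.darts = 2 := by
  have h : numDarts (⊤ : SimpleGraph (Fin 2)) =
      (Finset.univ.filter fun q : Fin 2 × Fin 2 => q.1 ≠ q.2).card := by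
    classical
    rw [numDarts_eq_card]
    congr 1
    ext q
    simp
  rw [numDarts_toUGraph]
  exact h.trans (by decide)

theorem connected_K₂ : K₂.toUGraph.Connected :=
  ⟨K₂, rfl, (connected_top : (⊤ : SimpleGraph (Fin 2)).Connected)⟩

end Path

end GraphDensity

theorem theorem5p1 :
    (∀ (H K : GraphDensity.FinGraph) (p : ℕ), 1 ≤ p →
      ¬ H.Isom K →
      H.numEdges = K.numEdges →
      GraphDensity.IsTrivialSquare H.toUGraph →
      (∀ v, H.deg v = p ∨ H.deg v = p + 1) →
      (∀ w, K.deg w ≤ p + 1) →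
      ∀ k : ℕ, 2 * K.numEdges + 1 ≤ k →
        ¬ GraphDensity.SosTestable (H.toUGraph.toComb ^ k - K.toUGraph.toComb ^ (k + 1))) ∧
    (∀ k : ℕ, 7 ≤ k →
      ¬ GraphDensity.SosTestable
        (GraphDensity.P₃.toUGraph.toComb ^ k - GraphDensity.K₂.toUGraph.toComb ^ (3 * (k + 1)))) := by
  open GraphDensity in
  have hdarts : ∀ G : FinGraph, G.toUGraph.darts = 2 * G.numEdges := fun G =>
    (numDarts_toUGraph G).trans (numDarts_eq_two_mul _)
  refine ⟨fun H K p _ hne he hT hdeg _ k hk => ?_, fun k hk => ?_⟩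
  · refine GraphDensity.not_sosTestable (fun h => hne (Quotient.exact h)) ?_ hT hdeg ?_
    · exact (hdarts H).trans (he ▸ (hdarts K).symm)
    · exact (congrArg (· + 1) (hdarts K)).trans_le hk
  · have h3 : (GraphDensity.K₂.toUGraph ^ 3).darts = 6 := by
      rw [GraphDensity.UGraph.darts_pow, GraphDensity.darts_K₂]
    -- Here `K` is three disjoint edges, with 6 darts, which explains the bound 7.
    have h := GraphDensity.not_sosTestable (H := GraphDensity.P₃)
      (K := GraphDensity.K₂.toUGraph ^ 3) (p := 1) (k := k) ?_ ?_
      GraphDensity.isTrivialSquare_P₃ GraphDensity.deg_P₃ ?_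
    · rw [pow_mul]
      rwa [GraphDensity.toComb_pow (GraphDensity.K₂.toUGraph) 3]
    · intro h
      -- Three disjoint edges have a repeated component, so they are not a trivial square, unlike
      -- the path.
      have hT := GraphDensity.isTrivialSquare_P₃
      rw [h, pow_succ', pow_succ'] at hT
      exact GraphDensity.not_isTrivialSquare_mul_mul GraphDensity.connected_K₂ hT
    · rw [GraphDensity.darts_P₃, h3]
    · rw [h3]
      exact hk
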